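/- Let $M$ be an oriented smooth $3$-manifold and $\xi=\ker\alpha$ a cooriented contact structure on $M$, with $\alpha\wedge d\alpha>0$. Orient $\xi$ so that $\xi$ followed by a vector on which $\alpha>0$ gives the orientation of $M$. Let $L$ be an oriented Legendrian knot in $(M,\xi)$ that is the oriented boundary of a compact oriented embedded surface $\Sigma$ (a Seifert surface). Define: - the Thurston–Bennequin invariant $tb(L)$: the twisting, in the oriented normal bundle of $L$, of a vector field along $L$ in $\xi$ transverse to $L$, with respect to the Seifert framing (a vector field along $L$ tangent to $\Sigma$ and pointing out of $\Sigma$); - the rotation number $r(L)$: the winding number of the positive tangent vector of $L$ in the trivialization of $\xi|_L$ that is the restriction of an oriented trivialization of $\xi|_\Sigma$; - for a knot $T$ transverse to $\xi$ with Seifert surface $\Sigma_T$, the self-linking number $sl(T)$: the linking number of $T$ with a copy $T'$ obtained by pushing $T$ slightly in the direction of a nowhere zero section of $\xi|_{\Sigma_T}$, that is, the algebraic intersection number of $T'$ with $\Sigma_T$ (where $T'$ is transverse to $\Sigma_T$). Let $A\colon S^1\times[-1,1]\to M$ be a smooth embedding that restricts to $L$ on $S^1\times\{0\}$, such that $S^1\times\{t\}$,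 oriented like $L$, is positively transverse to $\xi$ for $t>0$ and negatively transverse to $\xi$ for $t<0$. The positive and negative transverse push-offs of $L$ are $T_\pm(L)=A(S^1\times\{\pm\frac12\})$. Let $\Sigma_\pm$ be Seifert surfaces of $T_\pm(L)$ that correspond to $\Sigma$ under the isotopy $t\mapsto A(S^1\times\{t\})$ from $L$ to $T_\pm(L)$, that is, this isotopy of knots extends to a smooth isotopy of Seifert surfaces from $\Sigma$ to $\Sigma_\pm$. Then, with $tb(L)$ and $r(L)$ computed with $\Sigma$ and $sl(T_\pm(L))$ with $\Sigma_\pm$, $$sl(T_+(L))=tb(L)-r(L),\qquad sl(T_-(L))=tb(L)+r(L),$$ whatever choices of vector fields, trivializations and push-offs are used to compute these numbers. -/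

import Mathlib

open Set Filter Topology Manifold
open scoped ContDiff

noncomputable section

/-- The model space of a surface. -/
abbrev E2 : Type := EuclideanSpace ℝ (Fin 2)

/-- The model space of a 3-manifold. -/
abbrev E3 : Type := EuclideanSpace ℝ (Fin 3)

/-- Determinant of two vectors of the plane. -/
def det2 (u v : E2) : ℝ := Matrix.det !![u 0, u 1; v 0, v 1]

/-- Determinant of three vectors of 3-space. -/
def det3 (u v w : E3) : ℝ :=
  Matrix.det !![u 0, u 1, u 2; v 0, v 1, v 2; w 0, w 1, w 2]

/-- The atlas of `X` is oriented: all coordinate changes have positive Jacobian determinant.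
Mathlib identifies the tangent space of `X` at `x` with the model space `E` through the preferred
chart at `x`, which belongs to the atlas. So a basis of `T_x X` is positive for the orientation given
by the atlas if and only if its determinant, as a family in `E`, is positive. -/
def IsOrientedAtlas {E H : Type*} [NormedAddCommGroup E] [NormedSpace ℝ E] [TopologicalSpace H]
    (I : ModelWithCorners ℝ E H) (X : Type*) [TopologicalSpace X] [ChartedSpace H X] : Prop :=
  ∀ e ∈ atlas H X, ∀ e' ∈ atlas H X, ∀ x ∈ e.source ∩ e'.source,
    0 < (fderivWithin ℝ (e'.extend I ∘ (e.extend I).symm) (range I) (e.extend I x)).det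

section ContactForms

variable {M : Type*} [TopologicalSpace M] [ChartedSpace E3 M] [IsManifold 𝓘(ℝ, E3) ∞ M]

/-- The 1-form `α`, written in the preferred chart at `p`: a function from (an open part of) `E3`
to linear forms on `E3`. -/
def formInChart (α : (p : M) → TangentSpace 𝓘(ℝ, E3) p →L[ℝ] ℝ) (p : M) (y : E3) : E3 →L[ℝ] ℝ :=
  (α ((extChartAt 𝓘(ℝ, E3) p).symm y)).comp
    (mfderiv 𝓘(ℝ, E3) 𝓘(ℝ, E3) (extChartAt 𝓘(ℝ, E3) p).symm y)

/-- The exterior derivative `dα` at `p`, computed in the preferred chart at `p`. -/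
def dForm (α : (p : M) → TangentSpace 𝓘(ℝ, E3) p →L[ℝ] ℝ) (p : M) (u v : E3) : ℝ :=
  fderiv ℝ (formInChart α p) (extChartAt 𝓘(ℝ, E3) p p) u v
    - fderiv ℝ (formInChart α p) (extChartAt 𝓘(ℝ, E3) p p) v u

/-- The 3-form `α ∧ dα` at `p`. -/
def wedgeForm (α : (p : M) → TangentSpace 𝓘(ℝ, E3) p →L[ℝ] ℝ) (p : M) (u v w : E3) : ℝ :=
  α p u * dForm α p v w + α p v * dForm α p w u + α p w * dForm α p u v

/-- `α` is a smooth 1-form (a smooth function on the tangent bundle, linear on the fibres) and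
`α ∧ dα` is positive on positive bases. Its kernel is the (cooriented, positive) contact structure
`ξ`. -/
structure IsContactForm (α : (p : M) → TangentSpace 𝓘(ℝ, E3) p →L[ℝ] ℝ) : Prop where
  smooth : ContMDiff 𝓘(ℝ, E3).tangent 𝓘(ℝ, ℝ) ∞
    (fun z : TangentBundle 𝓘(ℝ, E3) M => α z.proj z.snd)
  contact : ∀ (p : M) (u v w : E3), 0 < det3 u v w → 0 < wedgeForm α p u v w

/-- `(u, v)` is a positive basis of the contact plane `ξ_p = ker α_p`: both vectors lie in `ξ_p` and
`(u, v, R)` is a positive basis of `T_p M` for every `R` on the positive side of `ξ_p`. -/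
def IsPositiveFrame (α : (p : M) → TangentSpace 𝓘(ℝ, E3) p →L[ℝ] ℝ) (p : M) (u v : E3) : Prop :=
  α p u = 0 ∧ α p v = 0 ∧ ∀ R : E3, 0 < α p R → 0 < det3 u v R

end ContactForms

section Knots

variable {M : Type*} [TopologicalSpace M] [ChartedSpace E3 M] [IsManifold 𝓘(ℝ, E3) ∞ M]

/-- The velocity vector of a curve. -/
def velocity (K : ℝ → M) (θ : ℝ) : E3 := mfderiv 𝓘(ℝ, ℝ) 𝓘(ℝ, E3) K θ (1 : ℝ)

/-- `K` is an oriented knot: a smooth embedding of the circle `ℝ / ℤ`, written as a 1-periodic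
map on `ℝ`. -/
structure IsKnot (K : ℝ → M) : Prop where
  smooth : ContMDiff 𝓘(ℝ, ℝ) 𝓘(ℝ, E3) ∞ K
  periodic : Function.Periodic K 1
  injOn : InjOn K (Ico 0 1)
  immersion : ∀ θ, velocity K θ ≠ 0

/-- A Legendrian knot: a knot that is everywhere tangent to `ξ = ker α`. -/
def IsLegendrianKnot (α : (p : M) → TangentSpace 𝓘(ℝ, E3) p →L[ℝ] ℝ) (L : ℝ → M) : Prop :=
  IsKnot L ∧ ∀ θ, α (L θ) (velocity L θ) = 0

/-- A knot that crosses `ξ = ker α` positively at each of its points. -/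
def IsPositiveTransverseKnot (α : (p : M) → TangentSpace 𝓘(ℝ, E3) p →L[ℝ] ℝ) (T : ℝ → M) : Prop :=
  IsKnot T ∧ ∀ θ, 0 < α (T θ) (velocity T θ)

/-- A knot that crosses `ξ = ker α` negatively at each of its points. -/
def IsNegativeTransverseKnot (α : (p : M) → TangentSpace 𝓘(ℝ, E3) p →L[ℝ] ℝ) (T : ℝ → M) : Prop :=
  IsKnot T ∧ ∀ θ, α (T θ) (velocity T θ) < 0

/-- A smooth vector field of `M` along the closed curve `K`. -/
def IsFieldAlongKnot (K : ℝ → M) (a : ℝ → E3) : Prop :=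
  ContMDiff 𝓘(ℝ, ℝ) 𝓘(ℝ, E3).tangent ∞ (fun θ => (⟨K θ, a θ⟩ : TangentBundle 𝓘(ℝ, E3) M))
    ∧ Function.Periodic a 1

/-- The closed curve `z` in `ℂ \ {0}` has winding number `n` around the origin. -/
def HasWindingNumber (z : ℝ → ℂ) (n : ℤ) : Prop :=
  (∀ θ, z θ ≠ 0) ∧ ∃ φ : ℝ → ℝ, Continuous φ
    ∧ (∀ θ, z θ = (‖z θ‖ : ℂ) * Complex.exp ((φ θ : ℂ) * Complex.I))
    ∧ ∀ θ, φ (θ + 1) = φ θ + 2 * Real.pi * n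

/-- The vector field `a` along `K` twists `n` times with respect to the vector field `s` in the
normal bundle `ν = TM|_K / TK`. Here `s` is completed by a field `c` to a framing `(s, c)` of `ν`,
positive for the orientation of `ν` for which `TK ⊕ ν = TM|_K` as oriented bundles, and `n` is the
winding number of the class of `a` in `ν ≅ K × ℝ²`. -/
def HasTwisting (K : ℝ → M) (a s : ℝ → E3) (n : ℤ) : Prop :=
  IsFieldAlongKnot K a ∧ IsFieldAlongKnot K s ∧
    ∃ c : ℝ → E3, IsFieldAlongKnot K c ∧ (∀ θ, 0 < det3 (velocity K θ) (s θ) (c θ)) ∧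
      ∃ p q r : ℝ → ℝ, (∀ θ, a θ = p θ • s θ + q θ • c θ + r θ • velocity K θ) ∧
        HasWindingNumber (fun θ => (p θ : ℂ) + (q θ : ℂ) * Complex.I) n

/-- An annulus `A : S¹ × [-1, 1] → M` for the transverse push-offs of the Legendrian knot `L`:
a smooth embedding (the restriction of a smooth map `S¹ × ℝ → M`) with `A(S¹ × {0}) = L`, such that
the circles `S¹ × {t}` are positive transverse knots for `t > 0` and negative transverse knots for
`t < 0`. The push-offs are `L₊ = A(S¹ × {1/2})` and `L₋ = A(S¹ × {-1/2})`. -/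
structure IsPushOffAnnulus (α : (p : M) → TangentSpace 𝓘(ℝ, E3) p →L[ℝ] ℝ) (L : ℝ → M)
    (A : ℝ → ℝ → M) : Prop where
  smooth : ContMDiff (𝓘(ℝ, ℝ).prod 𝓘(ℝ, ℝ)) 𝓘(ℝ, E3) ∞ (fun z : ℝ × ℝ => A z.1 z.2)
  periodic : ∀ t, Function.Periodic (fun θ => A θ t) 1
  injOn : InjOn (fun z : ℝ × ℝ => A z.1 z.2) (Ico 0 1 ×ˢ Icc (-1) 1)
  immersion : ∀ θ, ∀ t ∈ Icc (-1 : ℝ) 1,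
    LinearIndependent ℝ ![velocity (fun θ' => A θ' t) θ, velocity (fun t' => A θ t') t]
  core : ∀ θ, A θ 0 = L θ
  pos : ∀ t ∈ Ioc (0 : ℝ) 1, IsPositiveTransverseKnot α (fun θ => A θ t)
  neg : ∀ t ∈ Ico (-1 : ℝ) 0, IsNegativeTransverseKnot α (fun θ => A θ t)

end Knots

section Surfaces

variable {M : Type*} [TopologicalSpace M] [ChartedSpace E3 M] [IsManifold 𝓘(ℝ, E3) ∞ M]
variable {S : Type*} [TopologicalSpace S] [ChartedSpace (EuclideanHalfSpace 2) S]

/-- The differential `T_x S → T_{f x} M` of `f : S → M`. -/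
def surfaceDeriv (f : S → M) (x : S) (u : E2) : E3 := mfderiv (𝓡∂ 2) 𝓘(ℝ, E3) f x u

/-- A smooth vector field of `M` along `f : S → M`. -/
def IsFieldAlongSurface (f : S → M) (τ : S → E3) : Prop :=
  ContMDiff (𝓡∂ 2) 𝓘(ℝ, E3).tangent ∞ (fun x => (⟨f x, τ x⟩ : TangentBundle 𝓘(ℝ, E3) M))

/-- The velocity vector of a curve in `S`. -/
def surfaceVelocity (b : ℝ → S) (θ : ℝ) : E2 := mfderiv 𝓘(ℝ, ℝ) (𝓡∂ 2) b θ (1 : ℝ)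

/-- At a boundary point of `S`, the vector `u` of `T_x S ≅ ℝ²` points strictly out of `S`, which is
`{y | 0 ≤ y 0}` in a chart. -/
def IsOutward (u : E2) : Prop := u 0 < 0

/-- `f : S → M` is an embedding of the surface `S` (which will be compact and oriented) whose
oriented boundary is the oriented knot `K`. The map `b` parametrizes the boundary of `S` so that
`f ∘ b = K`; it runs in the direction of the boundary orientation ("outward vector first"). -/
structure IsSeifertSurface (K : ℝ → M) (f : S → M) (b : ℝ → S) : Prop where
  knot : IsKnot K
  smooth : ContMDiff (𝓡∂ 2) 𝓘(ℝ, E3) ∞ f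
  injective : Function.Injective f
  immersion : ∀ x, Function.Injective (surfaceDeriv f x)
  smooth_bdry : ContMDiff 𝓘(ℝ, ℝ) (𝓡∂ 2) ∞ b
  periodic_bdry : Function.Periodic b 1
  range_bdry : range b = (𝓡∂ 2).boundary S
  bdry_eq : ∀ θ, f (b θ) = K θ
  orientation : ∀ θ u, IsOutward u → 0 < det2 u (surfaceVelocity b θ)

/-- `n` is the Thurston-Bennequin invariant of the Legendrian knot `L` with Seifert surface `f`:
the twisting of the line bundle `l = ξ ∩ ν` (spanned by a field `w` of `ξ` along `L` that is
transverse to `L`) with respect to the Seifert framing (given by a field `s` along `L`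
that is tangent to the surface and points out of it). -/
def IsThurstonBennequin (α : (p : M) → TangentSpace 𝓘(ℝ, E3) p →L[ℝ] ℝ) (L : ℝ → M)
    (f : S → M) (b : ℝ → S) (n : ℤ) : Prop :=
  ∃ w s : ℝ → E3,
    (∀ θ, α (L θ) (w θ) = 0 ∧ LinearIndependent ℝ ![velocity L θ, w θ]) ∧
    (∀ θ, ∃ u : E2, IsOutward u ∧ s θ = surfaceDeriv f (b θ) u) ∧
    HasTwisting L w s n

/-- `n` is the rotation number of the Legendrian knot `L` with Seifert surface `f`: the winding
number of the tangent vector of `L` in a trivialization `ξ|_L ≅ L × ℝ²` that is the restriction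
of an (oriented) trivialization `(τ₁, τ₂)` of `ξ` over the surface. -/
def IsRotationNumber (α : (p : M) → TangentSpace 𝓘(ℝ, E3) p →L[ℝ] ℝ) (L : ℝ → M)
    (f : S → M) (b : ℝ → S) (n : ℤ) : Prop :=
  ∃ τ₁ τ₂ : S → E3, IsFieldAlongSurface f τ₁ ∧ IsFieldAlongSurface f τ₂ ∧
    (∀ x, IsPositiveFrame α (f x) (τ₁ x) (τ₂ x)) ∧
    ∃ p q : ℝ → ℝ, (∀ θ, velocity L θ = p θ • τ₁ (b θ) + q θ • τ₂ (b θ)) ∧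
      HasWindingNumber (fun θ => (p θ : ℂ) + (q θ : ℂ) * Complex.I) n

/-- `n` is the linking number with `K` of a closed curve `K'` in the complement of `K` that is
transverse to the Seifert surface `f` of `K`: the algebraic intersection number of `K'` with the
surface. A crossing counts `+1` if the orientation of the surface followed by that of `K'` is the
orientation of `M`, and `-1` otherwise. -/
def IsLinkingNumber (K : ℝ → M) (f : S → M) (K' : ℝ → M) (n : ℤ) : Prop :=
  (∀ θ θ', K' θ ≠ K θ') ∧
  (∀ θ x, f x = K' θ →
    det3 (surfaceDeriv f x !₂[1, 0]) (surfaceDeriv f x !₂[0, 1]) (velocity K' θ) ≠ 0) ∧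
  ∃ P : Finset (ℝ × S), (∀ z, z ∈ P ↔ z.1 ∈ Ico (0 : ℝ) 1 ∧ f z.2 = K' z.1) ∧
    n = ∑ z ∈ P, (SignType.sign (det3 (surfaceDeriv f z.2 !₂[1, 0])
      (surfaceDeriv f z.2 !₂[0, 1]) (velocity K' z.1)) : ℤ)

/-- `n` is the self-linking number of the transverse knot `T` with Seifert surface `f`: for a
nowhere zero section `v` of `ξ` over the surface, it is the linking number with `T` of the copies
`T' = H(·, u)`, `u > 0` small, obtained by pushing `T` in the direction of `v`. -/
def IsSelfLinking (α : (p : M) → TangentSpace 𝓘(ℝ, E3) p →L[ℝ] ℝ) (T : ℝ → M)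
    (f : S → M) (b : ℝ → S) (n : ℤ) : Prop :=
  ∃ v : S → E3, IsFieldAlongSurface f v ∧ (∀ x, α (f x) (v x) = 0 ∧ v x ≠ 0) ∧
    ∃ H : ℝ → ℝ → M,
      ContMDiff (𝓘(ℝ, ℝ).prod 𝓘(ℝ, ℝ)) 𝓘(ℝ, E3) ∞ (fun z : ℝ × ℝ => H z.1 z.2) ∧
      (∀ u, Function.Periodic (fun θ => H θ u) 1) ∧
      (∀ θ, H θ 0 = T θ) ∧
      (∀ θ, velocity (fun u => H θ u) 0 = v (b θ)) ∧
      ∀ᶠ u in 𝓝[>] (0 : ℝ), IsLinkingNumber T f (fun θ => H θ u) n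

/-- The Seifert surface `f'` of the push-off `A(·, t₁)` corresponds to the Seifert surface `f` of
`L = A(·, 0)` under the isotopy `t ↦ A(·, t)` of knots: that isotopy extends to a smooth isotopy
`F t` of Seifert surfaces from `f` to `f'`. -/
def IsCarriedSeifertSurface (A : ℝ → ℝ → M) (t₁ : ℝ) (f f' : S → M) (b : ℝ → S) : Prop :=
  ∃ F : ℝ → S → M,
    ContMDiff (𝓘(ℝ, ℝ).prod (𝓡∂ 2)) 𝓘(ℝ, E3) ∞ (fun z : ℝ × S => F z.1 z.2) ∧
    F 0 = f ∧ F t₁ = f' ∧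
    ∀ t ∈ uIcc 0 t₁, IsSeifertSurface (fun θ => A θ t) (F t) b

end Surfaces

end

/-! Rescale the isotopy of surfaces to `0 ≤ t ≤ 1`, let `K_t` be the boundary of the surface at time
`t`, so that `K_0 = L` and `K_1` is the push-off, and let `ε = ±1` be the sign with which `K_t`
crosses `ξ` for `t > 0`. Along `K_t` there are two oriented plane bundles: `ξ`, framed by a frame of
`ξ` over the whole surface, and the normal bundle `TM / TK_t`, framed by the surface. The projection
from `ξ` to the normal bundle is an isomorphism for `t > 0`, orientation preserving for `ε = 1` and
reversing for `ε = -1`. At `t = 0` its kernel is the tangent line of `L`.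

Take the field `w` in `ξ` that computes `tb`. Transport the frame of `ξ` along the isotopy and keep
the coordinates of `w` in it fixed. The class of the resulting section in the normal bundle never
vanishes: at `t = 0` because `w` is transverse to `L`, later because the projection is injective.
Hence its winding number against the surface framing is `tb` at all times
(`IsTransverseIsotopy.exists_frame`). Its winding number against the frame of `ξ` is `r`, since `w`
and the velocity of `L` are independent in `ξ` and so never antiparallel.

At `t = 1` let `v` be a nowhere zero section of `ξ` over the surface. By Stokes' theorem it winds
zero times against the frame of `ξ` (`IsBoundaryCurve.hasWindingNumber_zero`). A fibrewise
isomorphism of sign `ε` multiplies the relative winding of two sections by `ε`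
(`HasWindingNumber.linear_image`), so `v` winds `tb - ε r` times in the normal bundle
(`hasWindingNumber_boundaryTwist_section`).

This number is the self-linking number (`IsBoundaryCurve.linkingNumber_eq`). A small push-off along
`v` meets the surface exactly near the parameters where the class of `v` points into the surface.
With a function `h` that defines the surface near its boundary, intersections become crossings of a
plane loop with the negative real axis, and the winding number counts these with sign. -/

noncomputable section

set_option linter.unusedSectionVars false


/-! ### Winding numbers of plane loops -/

section Winding

theorem HasWindingNumber.mul {z w : ℝ → ℂ} {m n : ℤ} (hz : HasWindingNumber z m)
    (hw : HasWindingNumber w n) : HasWindingNumber (fun θ => z θ * w θ) (m + n) := by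
  obtain ⟨h0, φ, hφ, hzφ, hφ1⟩ := hz
  obtain ⟨h0', ψ, hψ, hzψ, hψ1⟩ := hw
  refine ⟨fun θ => mul_ne_zero (h0 θ) (h0' θ), fun θ => φ θ + ψ θ, by fun_prop, fun θ => ?_,
    fun θ => ?_⟩
  · show z θ * w θ = _
    conv_lhs => rw [hzφ θ, hzψ θ]
    rw [norm_mul]; push_cast; rw [add_mul, Complex.exp_add]; ring
  · simp only [hφ1, hψ1]; push_cast; ring

theorem HasWindingNumber.inv {z : ℝ → ℂ} {m : ℤ} (hz : HasWindingNumber z m) :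
    HasWindingNumber (fun θ => (z θ)⁻¹) (-m) := by
  obtain ⟨h0, φ, hφ, hzφ, hφ1⟩ := hz
  refine ⟨fun θ => inv_ne_zero (h0 θ), fun θ => -φ θ, by fun_prop, fun θ => ?_, fun θ => ?_⟩
  · show (z θ)⁻¹ = _
    conv_lhs => rw [hzφ θ]
    rw [norm_inv, mul_inv, ← Complex.exp_neg]; push_cast; ring_nf
  · simp only [hφ1]; push_cast; ring

theorem HasWindingNumber.conj {z : ℝ → ℂ} {m : ℤ} (hz : HasWindingNumber z m) :
    HasWindingNumber (fun θ => (starRingEnd ℂ) (z θ)) (-m) := by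
  obtain ⟨h0, φ, hφ, hzφ, hφ1⟩ := hz
  refine ⟨fun θ => by simpa using h0 θ, fun θ => -φ θ, by fun_prop, fun θ => ?_, fun θ => ?_⟩
  · show (starRingEnd ℂ) (z θ) = _
    conv_lhs => rw [hzφ θ]
    rw [map_mul, ← Complex.exp_conj, map_mul, Complex.conj_I, Complex.conj_ofReal,
      Complex.conj_ofReal, RCLike.norm_conj]
    push_cast; ring_nf
  · simp only [hφ1]; push_cast; ring

/-- The principal argument is continuous on the slit plane, so it serves as a periodic angle
function. -/
theorem hasWindingNumber_zero_of_mem_slitPlane {ρ : ℝ → ℂ} (hρ : Continuous ρ)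
    (hp : Function.Periodic ρ 1) (h : ∀ θ, ρ θ ∈ Complex.slitPlane) : HasWindingNumber ρ 0 := by
  refine ⟨fun θ => Complex.slitPlane_ne_zero (h θ), fun θ => (ρ θ).arg, ?_, fun θ => ?_, fun θ => ?_⟩
  · exact continuous_iff_continuousAt.2 fun θ =>
      (Complex.continuousAt_arg (h θ)).comp hρ.continuousAt
  · exact (Complex.norm_mul_exp_arg_mul_I _).symm
  · simp [hp θ]

/-- Two loops in the punctured plane that are nowhere antiparallel have the same winding number. -/
theorem HasWindingNumber.of_forall_add_ne {z w : ℝ → ℂ} {n : ℤ} (hz : HasWindingNumber z n)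
    (hzc : Continuous z) (hwc : Continuous w) (hzp : Function.Periodic z 1)
    (hwp : Function.Periodic w 1) (h : ∀ θ, ∀ k : ℝ, 0 ≤ k → w θ + k * z θ ≠ 0) :
    HasWindingNumber w n := by
  -- Not being antiparallel means that the quotient avoids the closed negative real axis.
  have h1 : HasWindingNumber (fun θ => w θ / z θ) 0 := by
    refine hasWindingNumber_zero_of_mem_slitPlane (hwc.div hzc hz.1)
      (fun θ => by simp only [hzp θ, hwp θ]) fun θ => ?_
    rw [Complex.mem_slitPlane_iff]
    by_contra hcon
    push Not at hcon
    refine h θ (-(w θ / z θ).re) (by linarith [hcon.1]) ?_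
    have h2 : w θ = (w θ / z θ) * z θ := (div_mul_cancel₀ _ (hz.1 θ)).symm
    have h3 : w θ / z θ = ((w θ / z θ).re : ℂ) := Complex.ext rfl (by simpa using hcon.2)
    rw [h2]; nth_rw 1 [h3]; push_cast
    rw [div_mul_cancel₀ _ (hz.1 θ)]; ring
  have h2 := hz.mul h1
  rw [add_zero] at h2
  convert h2 using 2 with θ
  rw [mul_div_cancel₀ _ (hz.1 θ)]

theorem HasWindingNumber.of_norm_sub_lt {z w : ℝ → ℂ} {n : ℤ} (hz : HasWindingNumber z n)
    (hzc : Continuous z) (hwc : Continuous w) (hzp : Function.Periodic z 1)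
    (hwp : Function.Periodic w 1) (h : ∀ θ, ‖w θ - z θ‖ < ‖z θ‖) :
    HasWindingNumber w n := by
  refine hz.of_forall_add_ne hzc hwc hzp hwp fun θ k hk h0 => ?_
  have h1 : w θ - z θ = -((1 + k : ℝ) : ℂ) * z θ := by push_cast; linear_combination h0
  have h2 := h θ
  rw [h1, norm_mul, norm_neg, Complex.norm_real, Real.norm_of_nonneg (by linarith)] at h2
  nlinarith [norm_nonneg (z θ)]

/-- Here the bound is relative to the loop in the conclusion. Together with
`HasWindingNumber.of_norm_sub_lt` it makes one inequality give both directions of an equivalence. -/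
theorem HasWindingNumber.of_norm_sub_lt' {z w : ℝ → ℂ} {n : ℤ} (hz : HasWindingNumber z n)
    (hzc : Continuous z) (hwc : Continuous w) (hzp : Function.Periodic z 1)
    (hwp : Function.Periodic w 1) (h : ∀ θ, ‖w θ - z θ‖ < ‖w θ‖) :
    HasWindingNumber w n := by
  refine hz.of_forall_add_ne hzc hwc hzp hwp fun θ k hk h0 => ?_
  have h2 := h θ
  have h1 : ‖w θ‖ = k * ‖z θ‖ := by
    rw [eq_neg_of_add_eq_zero_left h0, norm_neg, norm_mul, Complex.norm_real,
      Real.norm_of_nonneg hk]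
  have h3 : w θ - z θ = -((1 + k : ℝ) : ℂ) * z θ := by push_cast; linear_combination h0
  rw [h3, norm_mul, norm_neg, Complex.norm_real, Real.norm_of_nonneg (by linarith), h1] at h2
  nlinarith [norm_nonneg (z θ)]

/-- The truth value of "`Z t` winds `n` times" is locally constant in `t`: by compactness of a
period, nearby loops differ from `Z t` by less than its norm. -/
theorem hasWindingNumber_of_homotopy {Z : unitInterval → ℝ → ℂ}
    (hZ : Continuous fun y : unitInterval × ℝ => Z y.1 y.2)
    (hp : ∀ t, Function.Periodic (Z t) 1) (h0 : ∀ t θ, Z t θ ≠ 0) {n : ℤ} {t₀ : unitInterval}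
    (h : HasWindingNumber (Z t₀) n) (t₁ : unitInterval) : HasWindingNumber (Z t₁) n := by
  have hc : ∀ t, Continuous (Z t) := fun t => hZ.comp (by fun_prop : Continuous fun θ : ℝ => (t, θ))
  have hl : IsLocallyConstant fun t => HasWindingNumber (Z t) n := by
    rw [IsLocallyConstant.iff_eventually_eq]
    intro t
    have key : ∀ᶠ s in 𝓝 t, ∀ θ ∈ Icc (0 : ℝ) 1, ‖Z s θ - Z t θ‖ < ‖Z t θ‖ := by
      refine isCompact_Icc.eventually_forall_of_forall_eventually
        (P := fun s θ => ‖Z s θ - Z t θ‖ < ‖Z t θ‖) fun θ _ => ?_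
      have h1 : Continuous fun y : unitInterval × ℝ => ‖Z y.1 y.2 - Z t y.2‖ :=
        (hZ.sub ((hc t).comp continuous_snd)).norm
      have h2 : Continuous fun y : unitInterval × ℝ => ‖Z t y.2‖ :=
        ((hc t).comp continuous_snd).norm
      exact h1.continuousAt.eventually_lt h2.continuousAt (by simpa using h0 t θ)
    filter_upwards [key] with s hs
    have hs' : ∀ θ, ‖Z s θ - Z t θ‖ < ‖Z t θ‖ := fun θ => by
      have h1 := hs (Int.fract θ) ⟨Int.fract_nonneg _, (Int.fract_lt_one _).le⟩
      have h2 : ∀ u, Z u (Int.fract θ) = Z u θ := fun u => by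
        have := (hp u).sub_int_mul_eq (x := θ) ⌊θ⌋
        rwa [mul_one] at this
      rwa [h2, h2] at h1
    refine propext ⟨fun hh => hh.of_norm_sub_lt' (hc s) (hc t) (hp s) (hp t) fun θ => ?_,
      fun hh => hh.of_norm_sub_lt (hc t) (hc s) (hp t) (hp s) hs'⟩
    rw [norm_sub_rev]; exact hs' θ
  rw [hl.apply_eq_of_preconnectedSpace t₁ t₀]
  exact h

/-- Winding numbers of the images of a loop `x₁ + i x₂` in the plane under a loop of linear maps,
with columns `m₁`, `m₂` and determinant of constant sign `ε`. -/
theorem HasWindingNumber.linear_image {x₁ x₂ : ℝ → ℝ} {m₁ m₂ : ℝ → ℂ} {r N : ℤ}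
    (hx₁ : Continuous x₁) (hx₂ : Continuous x₂) (hm₁ : Continuous m₁) (hm₂ : Continuous m₂)
    (px₁ : Function.Periodic x₁ 1) (px₂ : Function.Periodic x₂ 1) (pm₁ : Function.Periodic m₁ 1)
    (pm₂ : Function.Periodic m₂ 1) {ε : ℤ} (hε : ε = 1 ∨ ε = -1)
    (hdet : ∀ θ, 0 < (ε : ℝ) * ((m₁ θ).re * (m₂ θ).im - (m₁ θ).im * (m₂ θ).re))
    (hr : HasWindingNumber (fun θ => (x₁ θ : ℂ) + x₂ θ * Complex.I) r)
    (hN : HasWindingNumber (fun θ => x₁ θ * m₁ θ + x₂ θ * m₂ θ) N) :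
    HasWindingNumber m₁ (N - ε * r) := by
  have hx0 : ∀ θ, x₁ θ ≠ 0 ∨ x₂ θ ≠ 0 := fun θ => by
    by_contra hcon
    push Not at hcon
    exact hr.1 θ (by simp [hcon.1, hcon.2])
  have hm0 : ∀ θ, m₁ θ ≠ 0 := fun θ h => by have := hdet θ; simp [h] at this
  -- `g` is `x₁ + ε i x₂`
  have hg : HasWindingNumber (fun θ => (x₁ θ : ℂ) + ε * (x₂ θ * Complex.I)) (ε * r) := by
    rcases hε with rfl | rfl
    · simpa using hr
    · have := hr.conj
      rw [show (-1 : ℤ) * r = -r by ring]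
      convert this using 2 with θ
      simp
  have hgc : Continuous (fun θ => (x₁ θ : ℂ) + ε * (x₂ θ * Complex.I)) := by fun_prop
  -- If `m₂ = ε i m₁`, the linear map is multiplication by `m₁`, after conjugation when `ε = -1`,
  -- and this quotient equals `m₁`. In general the sign of the determinant keeps the two from being
  -- antiparallel.
  have h1 : HasWindingNumber (fun θ => (x₁ θ * m₁ θ + x₂ θ * m₂ θ) *
      ((x₁ θ : ℂ) + ε * (x₂ θ * Complex.I))⁻¹) (N - ε * r) := hN.mul hg.inv
  refine h1.of_forall_add_ne ((by fun_prop : Continuous fun θ => x₁ θ * m₁ θ + x₂ θ * m₂ θ).mul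
    (hgc.inv₀ hg.1)) hm₁ (fun θ => by simp only [px₁ θ, px₂ θ, pm₁ θ, pm₂ θ]) pm₁
    fun θ k hk h => ?_
  have hgθ : (x₁ θ : ℂ) + ε * (x₂ θ * Complex.I) ≠ 0 := hg.1 θ
  have h2 : m₁ θ * ((x₁ θ : ℂ) + ε * (x₂ θ * Complex.I)) + k * (x₁ θ * m₁ θ + x₂ θ * m₂ θ) = 0 := by
    have := congrArg (· * ((x₁ θ : ℂ) + ε * (x₂ θ * Complex.I))) h
    simp only [zero_mul] at this
    rw [add_mul, mul_assoc (k : ℂ), inv_mul_cancel_right₀ hgθ] at this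
    exact this
  have hd := hdet θ
  have hre := congrArg Complex.re h2
  have him := congrArg Complex.im h2
  simp only [Complex.add_re, Complex.mul_re, Complex.ofReal_re, Complex.ofReal_im, Complex.I_re,
    Complex.I_im, Complex.intCast_re, Complex.intCast_im, Complex.add_im, Complex.mul_im,
    Complex.zero_re, Complex.zero_im] at hre him
  set a := (m₁ θ).re; set b := (m₁ θ).im; set c := (m₂ θ).re; set d := (m₂ θ).im
  have hab : 0 < a ^ 2 + b ^ 2 := by
    have : a ≠ 0 ∨ b ≠ 0 := by
      by_contra hcon
      push Not at hcon
      exact hm0 θ (Complex.ext hcon.1 hcon.2)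
    rcases this with h | h <;> positivity
  -- Both summands of the second factor have sign `ε` or vanish, and the first is not zero.
  have e1 : x₂ θ * ((ε : ℝ) * (a ^ 2 + b ^ 2) + k * (a * d - b * c)) = 0 := by
    linear_combination a * him - b * hre
  have e2 : x₂ θ = 0 := by
    refine (mul_eq_zero.1 e1).resolve_right ?_
    rcases hε with rfl | rfl
    · norm_num at hd ⊢; nlinarith
    · norm_num at hd ⊢; nlinarith
  have e3 : x₁ θ * ((1 + k) * (a ^ 2 + b ^ 2)) = 0 := by
    rw [e2] at hre him
    linear_combination a * hre + b * him
  rcases hx0 θ with h | h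
  · exact h ((mul_eq_zero.1 e3).resolve_right (by positivity))
  · exact h e2

theorem eventually_floor_eq_of_notMem_range {X : Type*} [TopologicalSpace X] {g : X → ℝ} {x : X}
    (hg : ContinuousAt g x) (hx : ∀ k : ℤ, g x ≠ k) : ∀ᶠ y in 𝓝 x, ⌊g y⌋ = ⌊g x⌋ := by
  have h1 : (⌊g x⌋ : ℝ) < g x := lt_of_le_of_ne (Int.floor_le _) (hx _).symm
  filter_upwards [hg.eventually_const_lt h1, hg.eventually_lt_const (Int.lt_floor_add_one (g x))]
    with y h2 h3
  exact Int.floor_eq_iff.2 ⟨h2.le, h3⟩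

/-- The values of `D` at isolated bad points are irrelevant: the punctured limits agree at nearby
points, so they form a locally constant function on the connected line. -/
theorem eq_of_forall_eventually_punctured_eq {D : ℝ → ℤ}
    (h : ∀ x, ∃ c, ∀ᶠ y in 𝓝[≠] x, D y = c) : ∃ c, ∀ x, ∀ᶠ y in 𝓝[≠] x, D y = c := by
  choose c hc using h
  have hl : IsLocallyConstant c := by
    rw [IsLocallyConstant.iff_eventually_eq]
    intro x
    have h1 := eventually_eventually_nhdsWithin.2 (hc x)
    have h2 : ∀ᶠ y in 𝓝[≠] x, c y = c x := by
      filter_upwards [h1, self_mem_nhdsWithin] with y hy hyx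
      have h3 : 𝓝[≠] y ≤ 𝓝[≠] x ⊔ 𝓝[≠] y := le_sup_right
      have h4 : ∀ᶠ z in 𝓝[≠] y, D z = c x := by
        have : 𝓝[{x}ᶜ] y = 𝓝 y := isOpen_compl_singleton.nhdsWithin_eq hyx
        rw [this] at hy
        exact hy.filter_mono nhdsWithin_le_nhds
      obtain ⟨z, hz1, hz2⟩ := (h4.and (hc y)).exists
      exact hz2.symm.trans hz1
    rw [eventually_nhdsWithin_iff] at h2
    filter_upwards [h2] with y hy
    by_cases hyx : y = x
    · rw [hyx]
    · exact hy hyx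
  refine ⟨c 0, fun x => ?_⟩
  rw [← hl.apply_eq_of_preconnectedSpace x 0]
  exact hc x

/-- The first floor counts passages of the angle through odd multiples of `π`, that is, through the
negative real axis. There the sine has the sign opposite to the increment of the angle, so an upward
crossing lowers this floor by one. The second term jumps by the sign of `d` at `θ₀` and compensates.
-/
theorem eventually_floor_add_sign_floor {φ y : ℝ → ℝ} {r : ℝ → ℝ} {θ₀ d : ℝ} {k m : ℤ}
    (hφ : ContinuousAt φ θ₀) (hk : φ θ₀ = 2 * Real.pi * k - Real.pi) (hr : ∀ θ, 0 < r θ)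
    (hy : ∀ θ, y θ = r θ * Real.sin (φ θ)) (hd : HasDerivAt y d θ₀) (hd0 : d ≠ 0) :
    ∃ c, ∀ᶠ θ in 𝓝[≠] θ₀,
      ⌊(φ θ + Real.pi) / (2 * Real.pi)⌋ + (SignType.sign d : ℤ) * ⌊θ - θ₀ + m⌋ = c := by
  have hpi := Real.pi_pos
  have hy0 : y θ₀ = 0 := by
    rw [hy, hk, Real.sin_sub_pi, mul_comm (2 * Real.pi), ← zero_add ((k : ℝ) * _),
      Real.sin_add_int_mul_two_pi]; simp
  have hδ : ∀ᶠ θ in 𝓝 θ₀, |φ θ - φ θ₀| < 1 := by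
    have : ContinuousAt (fun θ => |φ θ - φ θ₀|) θ₀ := (hφ.sub continuousAt_const).abs
    exact this.eventually_lt_const (by simp)
  have hfl : ∀ θ, |φ θ - φ θ₀| < 1 → y θ ≠ 0 →
      ⌊(φ θ + Real.pi) / (2 * Real.pi)⌋ = k + if 0 < y θ then -1 else 0 := by
    intro θ h1 h2
    have h3 : Real.sin (φ θ) = - Real.sin (φ θ - φ θ₀) := by
      rw [hk, show φ θ - (2 * Real.pi * k - Real.pi) = φ θ + Real.pi - k * (2 * Real.pi) by ring,
        Real.sin_sub_int_mul_two_pi, Real.sin_add_pi, neg_neg]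
    have h4 : (φ θ + Real.pi) / (2 * Real.pi) = k + (φ θ - φ θ₀) / (2 * Real.pi) := by
      rw [hk]; field_simp; ring
    rw [h4, Int.floor_intCast_add, add_right_inj]
    have hyθ := hy θ
    rw [h3] at hyθ
    obtain ⟨h5, h6⟩ := abs_lt.1 h1
    have hpi3 := Real.pi_gt_three
    rcases lt_trichotomy (φ θ - φ θ₀) 0 with h | h | h
    · have : Real.sin (φ θ - φ θ₀) < 0 := Real.sin_neg_of_neg_of_neg_pi_lt h (by linarith)
      rw [if_pos (by rw [hyθ]; have := hr θ; nlinarith)]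
      rw [Int.floor_eq_iff]
      constructor
      · rw [le_div_iff₀ (by positivity)]; push_cast; nlinarith
      · rw [div_lt_iff₀ (by positivity)]; push_cast; nlinarith
    · rw [h] at hyθ; simp at hyθ; exact absurd hyθ h2
    · have : 0 < Real.sin (φ θ - φ θ₀) := Real.sin_pos_of_pos_of_lt_pi h (by linarith)
      rw [if_neg (by rw [hyθ]; have := hr θ; nlinarith)]
      rw [Int.floor_eq_iff]
      constructor
      · rw [le_div_iff₀ (by positivity)]; push_cast; nlinarith
      · rw [div_lt_iff₀ (by positivity)]; push_cast; nlinarith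
  have hm1 : ∀ θ, |θ - θ₀| < 1 → ⌊θ - θ₀ + m⌋ = m + if θ < θ₀ then -1 else 0 := by
    intro θ h1
    obtain ⟨h5, h6⟩ := abs_lt.1 h1
    rw [Int.floor_add_intCast, add_comm, add_right_inj, Int.floor_eq_iff]
    split_ifs with h
    · push_cast; constructor <;> linarith
    · push_cast; constructor <;> linarith
  have hnear : ∀ᶠ θ in 𝓝 θ₀, |θ - θ₀| < 1 := by
    have : ContinuousAt (fun θ => |θ - θ₀|) θ₀ := (continuousAt_id.sub continuousAt_const).abs
    exact this.eventually_lt_const (by simp)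
  rcases lt_or_gt_of_ne hd0 with hneg | hpos
  · have hs := eventually_nhdsWithin_sign_eq_of_deriv_neg (f := y) (by rwa [hd.deriv]) hy0
    refine ⟨k - m, ?_⟩
    filter_upwards [hs.filter_mono nhdsWithin_le_nhds, hδ.filter_mono nhdsWithin_le_nhds,
      hnear.filter_mono nhdsWithin_le_nhds, self_mem_nhdsWithin] with θ h1 h2 h3 h4
    rw [sign_neg hneg, hm1 θ h3]
    rcases lt_or_gt_of_ne h4 with h | h
    · rw [sign_pos (sub_pos.2 h)] at h1
      have := sign_eq_one_iff.1 h1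
      rw [hfl θ h2 this.ne', if_pos this, if_pos h]; simp; ring
    · rw [sign_neg (sub_neg.2 h)] at h1
      have := sign_eq_neg_one_iff.1 h1
      rw [hfl θ h2 this.ne, if_neg this.le.not_gt, if_neg h.le.not_gt]; simp; ring
  · have hs := eventually_nhdsWithin_sign_eq_of_deriv_pos (f := y) (by rwa [hd.deriv]) hy0
    refine ⟨k + m - 1, ?_⟩
    filter_upwards [hs.filter_mono nhdsWithin_le_nhds, hδ.filter_mono nhdsWithin_le_nhds,
      hnear.filter_mono nhdsWithin_le_nhds, self_mem_nhdsWithin] with θ h1 h2 h3 h4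
    rw [sign_pos hpos, hm1 θ h3]
    rcases lt_or_gt_of_ne h4 with h | h
    · rw [sign_neg (sub_neg.2 h)] at h1
      have := sign_eq_neg_one_iff.1 h1
      rw [hfl θ h2 this.ne, if_neg this.le.not_gt, if_pos h]; simp; ring
    · rw [sign_pos (sub_pos.2 h)] at h1
      have := sign_eq_one_iff.1 h1
      rw [hfl θ h2 this.ne', if_pos this, if_neg h.le.not_gt]; simp; ring

/-- The winding number of a loop counts, with signs, its crossings with the negative real axis. -/
theorem HasWindingNumber.eq_neg_sum_crossings {z : ℝ → ℂ} {n : ℤ} (h : HasWindingNumber z n)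
    (hp : Function.Periodic z 1) (P : Finset ℝ)
    (hP : ∀ θ, θ ∈ P ↔ θ ∈ Ico (0 : ℝ) 1 ∧ (z θ).im = 0 ∧ (z θ).re < 0) {y' : ℝ → ℝ}
    (hd : ∀ θ ∈ P, HasDerivAt (fun θ => (z θ).im) (y' θ) θ) (hne : ∀ θ ∈ P, y' θ ≠ 0) :
    n = -∑ θ ∈ P, (SignType.sign (y' θ) : ℤ) := by
  obtain ⟨h0, φ, hφ, hzφ, hφ1⟩ := h
  have hpi := Real.pi_pos
  have him : ∀ θ, (z θ).im = ‖z θ‖ * Real.sin (φ θ) := fun θ => by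
    conv_lhs => rw [hzφ θ, Complex.im_ofReal_mul, Complex.exp_ofReal_mul_I_im]
  have hre : ∀ θ, (z θ).re = ‖z θ‖ * Real.cos (φ θ) := fun θ => by
    conv_lhs => rw [hzφ θ, Complex.re_ofReal_mul, Complex.exp_ofReal_mul_I_re]
  have hpos : ∀ θ, 0 < ‖z θ‖ := fun θ => norm_pos_iff.2 (h0 θ)
  -- crossings in terms of the angle
  have hcross : ∀ θ, ((z θ).im = 0 ∧ (z θ).re < 0) ↔
      ∃ k : ℤ, (φ θ + Real.pi) / (2 * Real.pi) = k := by
    intro θ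
    have e1 : (∃ k : ℤ, (φ θ + Real.pi) / (2 * Real.pi) = k) ↔ Real.cos (φ θ + Real.pi) = 1 := by
      rw [Real.cos_eq_one_iff]
      refine exists_congr fun k => ?_
      rw [div_eq_iff (by positivity)]; exact eq_comm
    rw [e1, Real.cos_add_pi, him, hre]
    constructor
    · rintro ⟨h1, h2⟩
      have h3 : Real.sin (φ θ) = 0 := (mul_eq_zero.1 h1).resolve_left (hpos θ).ne'
      have h4 : Real.cos (φ θ) < 0 := by have := hpos θ; by_contra hcon; nlinarith
      nlinarith [Real.sin_sq_add_cos_sq (φ θ)]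
    · intro h1
      have h2 : Real.sin (φ θ) = 0 := by
        have := Real.sin_sq_add_cos_sq (φ θ)
        have h3 : Real.cos (φ θ) = -1 := by linarith
        rw [h3] at this
        exact pow_eq_zero_iff (two_ne_zero) |>.1 (by linarith)
      have := hpos θ
      exact ⟨by rw [h2, mul_zero], by nlinarith⟩
  have hfract : ∀ θ, z (Int.fract θ) = z θ := fun θ => by
    have := hp.sub_int_mul_eq (x := θ) ⌊θ⌋
    rwa [mul_one] at this
  have hmem : ∀ θ, (∃ k : ℤ, (φ θ + Real.pi) / (2 * Real.pi) = k) ↔ Int.fract θ ∈ P := fun θ => by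
    rw [← hcross, hP, hfract]
    exact ⟨fun h => ⟨⟨Int.fract_nonneg _, Int.fract_lt_one _⟩, h⟩, fun h => h.2⟩
  -- The sum of floors jumps by the sign of the crossing at every translate of a point of `P` and
  -- undoes the jumps of the angle. So `D` is constant away from the crossings.
  set D : ℝ → ℤ := fun θ => ⌊(φ θ + Real.pi) / (2 * Real.pi)⌋
    + ∑ p ∈ P, (SignType.sign (y' p) : ℤ) * ⌊θ - p⌋ with hD
  have hPI : ∀ p ∈ P, ∀ (θ : ℝ) (k : ℤ), θ - p = k → p = Int.fract θ := by
    intro p hpP θ k hk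
    have h1 := ((hP p).1 hpP).1
    rw [show θ = p + k by linarith, Int.fract_add_intCast, Int.fract_eq_self.2 ⟨h1.1, h1.2⟩]
  have hsum : ∀ (Q : Finset ℝ) (θ₀ : ℝ), Q ⊆ P → Int.fract θ₀ ∉ Q → ∀ᶠ θ in 𝓝 θ₀,
      ∑ p ∈ Q, (SignType.sign (y' p) : ℤ) * ⌊θ - p⌋
        = ∑ p ∈ Q, (SignType.sign (y' p) : ℤ) * ⌊θ₀ - p⌋ := by
    intro Q θ₀ hQ hn
    have : ∀ᶠ θ in 𝓝 θ₀, ∀ p ∈ Q, ⌊θ - p⌋ = ⌊θ₀ - p⌋ := by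
      rw [Filter.eventually_all_finset]
      intro p hpQ
      refine eventually_floor_eq_of_notMem_range (g := fun θ => θ - p) (by fun_prop) ?_
      intro k hk
      exact hn (hPI p (hQ hpQ) _ k hk ▸ hpQ)
    filter_upwards [this] with θ hθ
    exact Finset.sum_congr rfl fun p hpQ => by rw [hθ p hpQ]
  have hpun : ∀ θ₀, ∃ c, ∀ᶠ θ in 𝓝[≠] θ₀, D θ = c := by
    intro θ₀
    by_cases hc : Int.fract θ₀ ∈ P
    · set p := Int.fract θ₀ with hpdef
      obtain ⟨k, hk⟩ := (hmem θ₀).2 hc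
      have hder : HasDerivAt (fun θ => (z θ).im) (y' p) θ₀ := by
        have h1 : HasDerivAt (fun θ => (z θ).im) (y' p) (θ₀ - ⌊θ₀⌋) := hd p hc
        have h2 := h1.comp_sub_const θ₀ (⌊θ₀⌋ : ℝ)
        have h3 : (fun θ => (z (θ - ⌊θ₀⌋)).im) = fun θ => (z θ).im := funext fun θ => by
          have := hp.sub_int_mul_eq (x := θ) ⌊θ₀⌋
          rw [mul_one] at this
          rw [this]
        rwa [h3] at h2
      obtain ⟨c, hcc⟩ := eventually_floor_add_sign_floor (m := ⌊θ₀⌋) (k := k)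
        (r := fun θ => ‖z θ‖) hφ.continuousAt
        (by rw [div_eq_iff (by positivity)] at hk; linarith) hpos him hder (hne p hc)
      refine ⟨c + ∑ q ∈ P.erase p, (SignType.sign (y' q) : ℤ) * ⌊θ₀ - q⌋, ?_⟩
      filter_upwards [hcc, (hsum (P.erase p) θ₀ (Finset.erase_subset _ _)
        (by simp [hpdef])).filter_mono nhdsWithin_le_nhds] with θ h1 h2
      rw [← h2, ← h1, hD]
      simp only
      rw [← Finset.add_sum_erase P _ hc, add_assoc]
      congr 3
      · rw [hpdef, Int.fract]; ring_nf
    · refine ⟨D θ₀, Filter.Eventually.filter_mono nhdsWithin_le_nhds ?_⟩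
      have h1 : ∀ᶠ θ in 𝓝 θ₀, ⌊(φ θ + Real.pi) / (2 * Real.pi)⌋
          = ⌊(φ θ₀ + Real.pi) / (2 * Real.pi)⌋ :=
        eventually_floor_eq_of_notMem_range (g := fun θ => (φ θ + Real.pi) / (2 * Real.pi))
          (by fun_prop) fun k hk => hc ((hmem θ₀).1 ⟨k, hk⟩)
      filter_upwards [h1, hsum P θ₀ subset_rfl hc] with θ h2 h3
      simp only [hD, h2, h3]
  obtain ⟨c, hc⟩ := eq_of_forall_eventually_punctured_eq hpun
  -- Over one period the angle term grows by `n` and each floor by one. Constancy of `D` forces the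
  -- total increment to vanish.
  have hshift : ∀ θ, D (θ + 1) = D θ + (n + ∑ p ∈ P, (SignType.sign (y' p) : ℤ)) := by
    intro θ
    have h1 : (φ (θ + 1) + Real.pi) / (2 * Real.pi) = (φ θ + Real.pi) / (2 * Real.pi) + n := by
      rw [hφ1]; field_simp; ring
    have h2 : ∀ p : ℝ, ⌊θ + 1 - p⌋ = ⌊θ - p⌋ + 1 := fun p => by
      rw [show θ + 1 - p = θ - p + 1 by ring, Int.floor_add_one]
    simp only [hD, h1, Int.floor_add_intCast, h2, mul_add, Finset.sum_add_distrib, mul_one]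
    ring
  have h1 : ∀ᶠ θ in 𝓝[≠] (0 : ℝ), D (θ + 1) = c := by
    have ht : Tendsto (fun θ : ℝ => θ + 1) (𝓝[≠] 0) (𝓝[≠] 1) := by
      refine tendsto_nhdsWithin_iff.2 ⟨?_, ?_⟩
      · have : Tendsto (fun θ : ℝ => θ + 1) (𝓝 0) (𝓝 (0 + 1)) := by
          exact (continuous_id.add continuous_const).continuousAt
        rw [zero_add] at this
        exact this.mono_left nhdsWithin_le_nhds
      · filter_upwards [self_mem_nhdsWithin] with θ hθ
        simpa using hθ
    exact ht.eventually (hc 1)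
  obtain ⟨θ, h2, h3⟩ := (h1.and (hc 0)).exists
  have := hshift θ
  linarith
end Winding


/-! ### Determinants, and Green's formula on the half plane -/

section PlaneAnalysis
open MeasureTheory

theorem det2_eq (u v : E2) : det2 u v = u 0 * v 1 - u 1 * v 0 := by
  simp [det2, Matrix.det_fin_two]

theorem det3_eq (u v w : E3) : det3 u v w = u 0 * (v 1 * w 2 - v 2 * w 1)
    - u 1 * (v 0 * w 2 - v 2 * w 0) + u 2 * (v 0 * w 1 - v 1 * w 0) := by
  simp [det3, Matrix.det_fin_three]; ring

theorem E2.eq_smul_add (u : E2) : u = u 0 • (!₂[1, 0] : E2) + u 1 • (!₂[0, 1] : E2) := by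
  ext i; fin_cases i <;> simp

theorem E3.eq_smul_add (u : E3) : u = u 0 • (!₂[1, 0, 0] : E3) + u 1 • (!₂[0, 1, 0] : E3)
    + u 2 • (!₂[0, 0, 1] : E3) := by
  ext i; fin_cases i <;> simp

theorem det_eq_det2 (L : E2 →L[ℝ] E2) : L.det = det2 (L !₂[1, 0]) (L !₂[0, 1]) := by
  have h := LinearMap.det_toMatrix (EuclideanSpace.basisFun (Fin 2) ℝ).toBasis (L : E2 →ₗ[ℝ] E2)
  have e0 : EuclideanSpace.single (0 : Fin 2) (1 : ℝ) = !₂[1, 0] := by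
    ext i; fin_cases i <;> simp
  have e1 : EuclideanSpace.single (1 : Fin 2) (1 : ℝ) = !₂[0, 1] := by
    ext i; fin_cases i <;> simp
  rw [ContinuousLinearMap.det, ← h, Matrix.det_fin_two, det2_eq]
  simp only [LinearMap.toMatrix_apply, OrthonormalBasis.coe_toBasis, EuclideanSpace.basisFun_apply,
    OrthonormalBasis.coe_toBasis_repr_apply, EuclideanSpace.basisFun_repr,
    ContinuousLinearMap.coe_coe, e0, e1]
  ring

theorem det_eq_det3 (L : E3 →L[ℝ] E3) :
    L.det = det3 (L !₂[1, 0, 0]) (L !₂[0, 1, 0]) (L !₂[0, 0, 1]) := by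
  have h := LinearMap.det_toMatrix (EuclideanSpace.basisFun (Fin 3) ℝ).toBasis (L : E3 →ₗ[ℝ] E3)
  have e0 : EuclideanSpace.single (0 : Fin 3) (1 : ℝ) = !₂[1, 0, 0] := by
    ext i; fin_cases i <;> simp
  have e1 : EuclideanSpace.single (1 : Fin 3) (1 : ℝ) = !₂[0, 1, 0] := by
    ext i; fin_cases i <;> simp
  have e2 : EuclideanSpace.single (2 : Fin 3) (1 : ℝ) = !₂[0, 0, 1] := by
    ext i; fin_cases i <;> simp
  rw [ContinuousLinearMap.det, ← h, Matrix.det_fin_three, det3_eq]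
  simp only [LinearMap.toMatrix_apply, OrthonormalBasis.coe_toBasis, EuclideanSpace.basisFun_apply,
    OrthonormalBasis.coe_toBasis_repr_apply, EuclideanSpace.basisFun_repr,
    ContinuousLinearMap.coe_coe, e0, e1, e2]
  ring

theorem det3_map (L : E3 →L[ℝ] E3) (u v w : E3) :
    det3 (L u) (L v) (L w) = L.det * det3 u v w := by
  rw [det_eq_det3]
  conv_lhs => rw [E3.eq_smul_add u, E3.eq_smul_add v, E3.eq_smul_add w]
  simp only [map_add, map_smul, det3_eq, PiLp.add_apply, PiLp.smul_apply, smul_eq_mul]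
  ring

/-- The closed right half plane, the model of surfaces with boundary. -/
def halfPlane : Set E2 := {y | 0 ≤ y 0}

theorem range_model_eq : range (𝓡∂ 2) = halfPlane := range_modelWithCornersEuclideanHalfSpace 2

theorem uniqueDiffOn_halfPlane : UniqueDiffOn ℝ halfPlane :=
  range_model_eq ▸ (𝓡∂ 2).uniqueDiffOn

theorem isClosed_halfPlane : IsClosed halfPlane := by
  rw [← range_model_eq]; exact (𝓡∂ 2).isClosed_range

theorem interior_halfPlane : interior halfPlane = {y | 0 < y 0} := by
  rw [← range_model_eq]; exact interior_range_modelWithCornersEuclideanHalfSpace 2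

/-- The plane as a product. -/
def prodEquivE2 : (ℝ × ℝ) ≃L[ℝ] E2 :=
  (ContinuousLinearEquiv.finTwoArrow ℝ ℝ).symm.trans (EuclideanSpace.equiv (Fin 2) ℝ).symm

theorem prodEquivE2_apply (z : ℝ × ℝ) : prodEquivE2 z = !₂[z.1, z.2] := by
  ext i; fin_cases i <;> rfl

theorem measurePreserving_prodEquivE2 : MeasurePreserving prodEquivE2 := by
  have h1 := (volume_preserving_finTwoArrow ℝ).symm
  have h2 := (EuclideanSpace.volume_preserving_symm_measurableEquiv_toLp (Fin 2)).symm
  exact h2.comp h1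

theorem measurableEmbedding_prodEquivE2 : MeasurableEmbedding prodEquivE2 :=
  prodEquivE2.toHomeomorph.measurableEmbedding

theorem fderivWithin_halfPlane_eq_zero {X : E2 → ℝ} {K : Set E2} (hK : IsClosed K)
    (X0 : ∀ y ∈ halfPlane, y ∉ K → X y = 0) {y : E2} (hy : y ∈ halfPlane) (hyK : y ∉ K) :
    fderivWithin ℝ X halfPlane y = 0 := by
  have h1 : X =ᶠ[𝓝[halfPlane] y] fun _ => 0 := by
    filter_upwards [self_mem_nhdsWithin,
      nhdsWithin_le_nhds (hK.isOpen_compl.mem_nhds hyK)] with z hz hzK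
    exact X0 z hz hzK
  rw [h1.fderivWithin_eq (X0 y hy hyK)]
  simp

/-- Apply the divergence theorem on the box `[0, R] × [-R, R]` for a ball of radius `R` containing
`K`. Only the face on the boundary line carries flux, and its outward normal is `-e₁`, whence the
minus sign. -/
theorem integral_divergence_halfPlane {X Y : E2 → ℝ} (hX : ContDiffOn ℝ 1 X halfPlane)
    (hY : ContDiffOn ℝ 1 Y halfPlane) {K : Set E2} (hK : IsCompact K)
    (X0 : ∀ y ∈ halfPlane, y ∉ K → X y = 0) (Y0 : ∀ y ∈ halfPlane, y ∉ K → Y y = 0) :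
    ∫ y in halfPlane, (fderivWithin ℝ X halfPlane y !₂[1, 0]
      + fderivWithin ℝ Y halfPlane y !₂[0, 1]) = -∫ s : ℝ, X !₂[0, s] := by
  obtain ⟨R, hR0, hR⟩ := hK.isBounded.subset_ball_lt 0 0
  set D : E2 → ℝ := fun y => fderivWithin ℝ X halfPlane y !₂[1, 0]
      + fderivWithin ℝ Y halfPlane y !₂[0, 1] with hD
  have hnK : ∀ x y : ℝ, (R ≤ |x| ∨ R ≤ |y|) → (!₂[x, y] : E2) ∉ K := by
    intro x y h hk
    have h1 := hR hk
    rw [mem_ball_zero_iff] at h1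
    have h2 := PiLp.norm_apply_le (!₂[x, y] : E2) 0
    have h3 := PiLp.norm_apply_le (!₂[x, y] : E2) 1
    simp only [Real.norm_eq_abs] at h2 h3
    have h4 : |x| ≤ ‖(!₂[x, y] : E2)‖ := h2
    have h5 : |y| ≤ ‖(!₂[x, y] : E2)‖ := h3
    rcases h with h | h <;> linarith
  have hmem : ∀ z : ℝ × ℝ, 0 ≤ z.1 → prodEquivE2 z ∈ halfPlane := fun z hz => by
    rw [prodEquivE2_apply]; exact hz
  have hint : ∀ z : ℝ × ℝ, 0 < z.1 → halfPlane ∈ 𝓝 (prodEquivE2 z) := fun z hz => by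
    rw [← mem_interior_iff_mem_nhds, interior_halfPlane, prodEquivE2_apply]; exact hz
  have hmaps : MapsTo prodEquivE2 (Icc ((0 : ℝ), -R) (R, R)) halfPlane :=
    fun z hz => hmem z hz.1.1
  have hder : ∀ {Z : E2 → ℝ}, ContDiffOn ℝ 1 Z halfPlane →
      ∀ z ∈ Ioo (0 : ℝ) R ×ˢ Ioo (-R) R, HasFDerivAt (Z ∘ prodEquivE2)
        ((fderivWithin ℝ Z halfPlane (prodEquivE2 z)).comp (prodEquivE2 : (ℝ × ℝ) →L[ℝ] E2)) z := by
    intro Z hZ z hz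
    have h1 := (hZ.differentiableOn one_ne_zero _ (hmem z hz.1.1.le)).hasFDerivWithinAt
    exact (h1.hasFDerivAt (hint z hz.1.1)).comp z prodEquivE2.hasFDerivAt
  have hcontD : ContinuousOn (D ∘ prodEquivE2) (Icc ((0 : ℝ), -R) (R, R)) := by
    refine ContinuousOn.comp ?_ prodEquivE2.continuous.continuousOn hmaps
    exact ((hX.continuousOn_fderivWithin uniqueDiffOn_halfPlane le_rfl).clm_apply
      continuousOn_const).add ((hY.continuousOn_fderivWithin uniqueDiffOn_halfPlane le_rfl).clm_apply
      continuousOn_const)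
  have hfun : ∀ z : ℝ × ℝ, ((fderivWithin ℝ X halfPlane (prodEquivE2 z)).comp
      (prodEquivE2 : (ℝ × ℝ) →L[ℝ] E2)) (1, 0) + ((fderivWithin ℝ Y halfPlane (prodEquivE2 z)).comp
      (prodEquivE2 : (ℝ × ℝ) →L[ℝ] E2)) (0, 1) = D (prodEquivE2 z) := fun z => by
    simp [hD, prodEquivE2_apply]
  have key := integral_divergence_prod_Icc_of_hasFDerivAt_of_le (X ∘ prodEquivE2) (Y ∘ prodEquivE2)
    (fun z => (fderivWithin ℝ X halfPlane (prodEquivE2 z)).comp (prodEquivE2 : (ℝ × ℝ) →L[ℝ] E2))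
    (fun z => (fderivWithin ℝ Y halfPlane (prodEquivE2 z)).comp (prodEquivE2 : (ℝ × ℝ) →L[ℝ] E2))
    (0, -R) (R, R) ⟨hR0.le, by simp; linarith⟩
    (hX.continuousOn.comp prodEquivE2.continuous.continuousOn hmaps)
    (hY.continuousOn.comp prodEquivE2.continuous.continuousOn hmaps) (hder hX) (hder hY)
    (by simp only [hfun]; exact hcontD.integrableOn_compact isCompact_Icc)
  simp only [hfun] at key
  have hYR : ∀ x : ℝ, x ∈ uIcc 0 R → (Y ∘ prodEquivE2) (x, R) = 0 := fun x hx => by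
    rw [uIcc_of_le hR0.le] at hx
    refine Y0 _ (hmem _ hx.1) ?_
    rw [prodEquivE2_apply]; exact hnK _ _ (Or.inr (le_abs_self R))
  have hYR' : ∀ x : ℝ, x ∈ uIcc 0 R → (Y ∘ prodEquivE2) (x, -R) = 0 := fun x hx => by
    rw [uIcc_of_le hR0.le] at hx
    refine Y0 _ (hmem _ hx.1) ?_
    rw [prodEquivE2_apply]; exact hnK _ _ (Or.inr (by rw [abs_neg]; exact le_abs_self R))
  have hXR : ∀ y : ℝ, (X ∘ prodEquivE2) (R, y) = 0 := fun y => by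
    refine X0 _ (hmem _ hR0.le) ?_
    rw [prodEquivE2_apply]; exact hnK _ _ (Or.inl (le_abs_self R))
  rw [intervalIntegral.integral_congr hYR, intervalIntegral.integral_congr hYR',
    intervalIntegral.integral_congr fun y _ => hXR y] at key
  simp only [intervalIntegral.integral_zero, sub_zero, zero_add, zero_sub] at key
  have hright : ∫ y in (-R)..R, (X ∘ prodEquivE2) (0, y) = ∫ s : ℝ, X !₂[0, s] := by
    rw [intervalIntegral.integral_eq_integral_of_support_subset]
    · simp only [Function.comp, prodEquivE2_apply]
    · intro s hs
      by_contra hcon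
      refine hs (X0 _ (hmem _ le_rfl) ?_)
      rw [prodEquivE2_apply]
      refine hnK _ _ (Or.inr ?_)
      by_contra h2
      push Not at h2
      exact hcon ⟨(abs_lt.1 h2).1, (abs_lt.1 h2).2.le⟩
  rw [hright] at key
  rw [← key, ← measurePreserving_prodEquivE2.setIntegral_preimage_emb
    measurableEmbedding_prodEquivE2]
  refine setIntegral_eq_of_subset_of_forall_sdiff_eq_zero
    (isClosed_halfPlane.measurableSet.preimage prodEquivE2.continuous.measurable)
    hmaps fun z hz => ?_
  have hzK : prodEquivE2 z ∉ K := by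
    rw [prodEquivE2_apply]
    apply hnK
    by_contra hcon
    push Not at hcon
    have h0 : 0 ≤ z.1 := by
      have := hz.1
      rw [mem_preimage, prodEquivE2_apply] at this
      exact this
    exact hz.2 ⟨⟨h0, (abs_lt.1 hcon.2).1.le⟩, ⟨(abs_lt.1 hcon.1).2.le, (abs_lt.1 hcon.2).2.le⟩⟩
  show fderivWithin ℝ X halfPlane (prodEquivE2 z) _ + fderivWithin ℝ Y halfPlane (prodEquivE2 z) _ = 0
  rw [fderivWithin_halfPlane_eq_zero hK.isClosed X0 hz.1 hzK,
    fderivWithin_halfPlane_eq_zero hK.isClosed Y0 hz.1 hzK]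
  exact add_zero _

/-- The coefficient of `da ∧ dβ` in the plane. -/
def wedgeD (a β : E2 → ℝ) (y : E2) : ℝ :=
  fderivWithin ℝ a halfPlane y !₂[1, 0] * fderivWithin ℝ β halfPlane y !₂[0, 1]
    - fderivWithin ℝ a halfPlane y !₂[0, 1] * fderivWithin ℝ β halfPlane y !₂[1, 0]

/-- Green's formula for the form `a dβ` on the half plane, `a` having compact support in the
relatively open set `T`. -/
theorem integral_wedgeD_halfPlane {a β : E2 → ℝ} {T V K : Set E2} (hV : IsOpen V)
    (hT : T = halfPlane ∩ V) (ha : ContDiffOn ℝ ∞ a T) (hβ : ContDiffOn ℝ ∞ β T)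
    (hK : IsCompact K) (hKT : K ⊆ T) (a0 : ∀ y ∈ halfPlane, y ∉ K → a y = 0) :
    ∫ y in halfPlane, wedgeD a β y =
      -∫ s : ℝ, a !₂[0, s] * fderivWithin ℝ β halfPlane !₂[0, s] !₂[0, 1] := by
  have hTd : UniqueDiffOn ℝ T := hT ▸ uniqueDiffOn_halfPlane.inter hV
  have hTeq : ∀ (g : E2 → ℝ) (y : E2), y ∈ T →
      fderivWithin ℝ g T y = fderivWithin ℝ g halfPlane y := fun g y hy => by
    rw [hT] at hy ⊢; exact fderivWithin_inter (hV.mem_nhds hy.2)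
  have hβ' : ∀ e : E2, ContDiffOn ℝ ∞ (fun y => fderivWithin ℝ β halfPlane y e) T := fun e => by
    have h1 : ContDiffOn ℝ ∞ (fun y => fderivWithin ℝ β T y e) T :=
      (hβ.fderivWithin hTd (by simp)).clm_apply contDiffOn_const
    exact h1.congr fun y hy => by rw [hTeq β y hy]
  -- The derivatives of `β` are controlled on `T` only. Products with `a` vanish off `K`, and hence
  -- are of class `C¹` on the whole half plane.
  have hprod : ∀ {c : E2 → ℝ}, ContDiffOn ℝ ∞ c T → (∀ y ∈ halfPlane, y ∉ K → c y = 0) →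
      ContDiffOn ℝ 1 c halfPlane := by
    intro c hc hc0 y hy
    by_cases hyK : y ∈ K
    · have h1 : ContDiffWithinAt ℝ 1 c T y := (hc y (hKT hyK)).of_le (by simp)
      rw [hT] at h1
      have h2 := hKT hyK
      rw [hT] at h2
      exact (contDiffWithinAt_inter (hV.mem_nhds h2.2)).1 h1
    · have h1 : c =ᶠ[𝓝[halfPlane] y] fun _ => 0 := by
        filter_upwards [self_mem_nhdsWithin,
          nhdsWithin_le_nhds (hK.isClosed.isOpen_compl.mem_nhds hyK)] with z hz hzK
        exact hc0 z hz hzK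
      exact contDiffWithinAt_const.congr_of_eventuallyEq h1 (hc0 y hy hyK)
  -- The divergence of `(a ∂₂β, -a ∂₁β)` is the coefficient of `da ∧ dβ`, as the mixed second
  -- derivatives of `β` cancel.
  have key := integral_divergence_halfPlane
    (X := fun y => a y * fderivWithin ℝ β halfPlane y !₂[0, 1])
    (Y := fun y => -(a y * fderivWithin ℝ β halfPlane y !₂[1, 0]))
    (hprod (ha.mul (hβ' _)) fun y hy hyK => by rw [a0 y hy hyK, zero_mul])
    (hprod (ha.mul (hβ' _)).neg fun y hy hyK => by rw [a0 y hy hyK, zero_mul, neg_zero]) hK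
    (fun y hy hyK => by rw [a0 y hy hyK, zero_mul])
    (fun y hy hyK => by rw [a0 y hy hyK, zero_mul, neg_zero])
  rw [← key]
  -- The boundary line is a null set. In the interior the derivatives are ordinary ones, and the
  -- symmetry of second derivatives is available.
  have hae : interior halfPlane =ᵐ[volume] halfPlane := by
    have : Convex ℝ halfPlane := by
      intro x hx y hy s t hs ht _
      simp only [halfPlane, mem_ofPred_eq, PiLp.add_apply, PiLp.smul_apply, smul_eq_mul] at hx hy ⊢
      positivity
    exact (this.addHaar_frontier volume) |> fun h => interior_ae_eq_of_null_frontier h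
  rw [← setIntegral_congr_set hae, ← setIntegral_congr_set hae]
  refine setIntegral_congr_fun isOpen_interior.measurableSet fun y hy => ?_
  have hyH : y ∈ halfPlane := interior_subset hy
  have hyn : halfPlane ∈ 𝓝 y := mem_interior_iff_mem_nhds.1 hy
  by_cases hyK : y ∈ K
  · have hyT := hKT hyK
    have hTn : T ∈ 𝓝 y := by
      rw [hT] at hyT ⊢; exact inter_mem hyn (hV.mem_nhds hyT.2)
    have hda : DifferentiableAt ℝ a y := (ha.contDiffAt hTn).differentiableAt (by simp)
    have hβy : ContDiffAt ℝ ∞ β y := hβ.contDiffAt hTn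
    have hev : ∀ e : E2, (fun y => fderivWithin ℝ β halfPlane y e) =ᶠ[𝓝 y]
        fun y => fderiv ℝ β y e := fun e => by
      filter_upwards [isOpen_interior.mem_nhds hy] with z hz
      rw [fderivWithin_of_mem_nhds (mem_interior_iff_mem_nhds.1 hz)]
    have hd1 : DifferentiableAt ℝ (fderiv ℝ β) y :=
      (hβy.fderiv_right (m := 1) (by rw [one_add_one_eq_two]; exact ENat.LEInfty.out)).differentiableAt one_ne_zero
    have hfe : ∀ e : E2, HasFDerivAt (fun y => fderivWithin ℝ β halfPlane y e)
        ((fderiv ℝ (fderiv ℝ β) y).flip e) y := fun e => by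
      refine HasFDerivAt.congr_of_eventuallyEq ?_ (hev e)
      have := hd1.hasFDerivAt.clm_apply (hasFDerivAt_const e y)
      simpa using this
    have hsymm := hβy.isSymmSndFDerivAt (by
      rw [minSmoothness_of_isRCLikeNormedField]; exact (ENat.LEInfty.out : (2 : ℕ∞ω) ≤ ∞)) !₂[1, 0] !₂[0, 1]
    have e1 : fderiv ℝ (fun y => a y * fderivWithin ℝ β halfPlane y !₂[0, 1]) y = _ :=
      (hda.hasFDerivAt.mul (hfe !₂[0, 1])).fderiv
    have e2 : fderiv ℝ (fun y => -(a y * fderivWithin ℝ β halfPlane y !₂[1, 0])) y = _ :=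
      (hda.hasFDerivAt.mul (hfe !₂[1, 0])).neg.fderiv
    simp only [fderivWithin_of_mem_nhds hyn, wedgeD] at e1 e2 ⊢
    simp only [e1, e2]
    simp only [add_apply, smul_apply, smul_eq_mul,
      neg_apply, ContinuousLinearMap.flip_apply, hsymm]
    ring
  · have z1 := fderivWithin_halfPlane_eq_zero hK.isClosed a0 hyH hyK
    have z2 := fderivWithin_halfPlane_eq_zero
      (X := fun y => a y * fderivWithin ℝ β halfPlane y !₂[0, 1]) hK.isClosed
      (fun y hy hyK => by rw [a0 y hy hyK, zero_mul]) hyH hyK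
    have z3 := fderivWithin_halfPlane_eq_zero
      (X := fun y => -(a y * fderivWithin ℝ β halfPlane y !₂[1, 0])) hK.isClosed
      (fun y hy hyK => by rw [a0 y hy hyK, zero_mul, neg_zero]) hyH hyK
    simp only [wedgeD, z1, z2, z3]
    simp

end PlaneAnalysis


/-! ### Functions and two-forms on a surface in charts -/

section SurfaceCharts
open MeasureTheory

/-- The velocity of a curve in a manifold, in the preferred chart. -/
def curveVelocity {E H N : Type*} [NormedAddCommGroup E] [NormedSpace ℝ E]
    [TopologicalSpace H] (I : ModelWithCorners ℝ E H) [TopologicalSpace N] [ChartedSpace H N]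
    (c : ℝ → N) (θ : ℝ) : E := mfderiv 𝓘(ℝ, ℝ) I c θ (1 : ℝ)

/-- The coordinate representation of a curve has as derivative its velocity. -/
theorem hasDerivAt_extChartAt_comp {E H N : Type*} [NormedAddCommGroup E] [NormedSpace ℝ E]
    [TopologicalSpace H] {I : ModelWithCorners ℝ E H} [TopologicalSpace N] [ChartedSpace H N]
    {c : ℝ → N} {θ : ℝ} (hc : MDifferentiableAt 𝓘(ℝ, ℝ) I c θ) :
    HasDerivAt (fun θ' => extChartAt I (c θ) (c θ')) (curveVelocity I c θ) θ := by
  have h := hc.hasMFDerivAt.2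
  simp only [writtenInExtChartAt, extChartAt_model_space_eq_id, PartialEquiv.refl_coe,
    PartialEquiv.refl_symm, Function.comp_id, modelWithCornersSelf_coe, range_id,
    id_eq] at h
  have key : ∀ L : ℝ →L[ℝ] E, HasFDerivWithinAt (fun θ' => extChartAt I (c θ) (c θ')) L univ θ →
      HasDerivAt (fun θ' => extChartAt I (c θ) (c θ')) (L 1) θ :=
    fun L hL => (hasFDerivWithinAt_univ.1 hL).hasDerivAt
  exact key _ h

variable {S : Type*} [TopologicalSpace S] [ChartedSpace (EuclideanHalfSpace 2) S]

/-- A function on the surface, read in the preferred chart at `x`. -/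
def chartFun (x : S) (u : S → ℝ) : E2 → ℝ := u ∘ (extChartAt (𝓡∂ 2) x).symm

theorem exists_isOpen_target_eq (x : S) :
    ∃ V, IsOpen V ∧ (extChartAt (𝓡∂ 2) x).target = halfPlane ∩ V := by
  refine ⟨(𝓡∂ 2).symm ⁻¹' (chartAt (EuclideanHalfSpace 2) x).target,
    (chartAt (EuclideanHalfSpace 2) x).open_target.preimage (𝓡∂ 2).continuous_symm, ?_⟩
  rw [extChartAt_target, range_model_eq, inter_comm]

theorem target_subset_halfPlane (x : S) : (extChartAt (𝓡∂ 2) x).target ⊆ halfPlane := by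
  rw [← range_model_eq]; exact extChartAt_target_subset_range x

theorem measurableSet_target (x : S) : MeasurableSet (extChartAt (𝓡∂ 2) x).target := by
  obtain ⟨V, hV, h⟩ := exists_isOpen_target_eq x
  rw [h]; exact isClosed_halfPlane.measurableSet.inter hV.measurableSet

theorem nhdsWithin_target_eq {x : S} {y : E2} (hy : y ∈ (extChartAt (𝓡∂ 2) x).target) :
    𝓝[(extChartAt (𝓡∂ 2) x).target] y = 𝓝[halfPlane] y := by
  obtain ⟨V, hV, h⟩ := exists_isOpen_target_eq x
  rw [h] at hy ⊢
  exact nhdsWithin_inter_of_mem' (nhdsWithin_le_nhds (hV.mem_nhds hy.2))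

variable [IsManifold (𝓡∂ 2) ∞ S]

theorem contDiffOn_chartFun {u : S → ℝ} (hu : ContMDiff (𝓡∂ 2) 𝓘(ℝ, ℝ) ∞ u) (x : S) :
    ContDiffOn ℝ ∞ (chartFun x u) (extChartAt (𝓡∂ 2) x).target :=
  contMDiffOn_iff_contDiffOn.1 (hu.comp_contMDiffOn (contMDiffOn_extChartAt_symm x))

theorem differentiableWithinAt_chartFun {u : S → ℝ} (hu : ContMDiff (𝓡∂ 2) 𝓘(ℝ, ℝ) ∞ u) (x : S)
    {y : E2} (hy : y ∈ (extChartAt (𝓡∂ 2) x).target) :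
    DifferentiableWithinAt ℝ (chartFun x u) halfPlane y := by
  have h := (contDiffOn_chartFun hu x).differentiableOn (by simp) y hy
  rw [DifferentiableWithinAt] at h ⊢
  obtain ⟨f', hf'⟩ := h
  exact ⟨f', hf'.mono_of_mem_nhdsWithin (by
    rw [← nhdsWithin_target_eq hy]; exact self_mem_nhdsWithin)⟩

theorem continuousOn_fderivWithin_chartFun {u : S → ℝ} (hu : ContMDiff (𝓡∂ 2) 𝓘(ℝ, ℝ) ∞ u)
    (x : S) (e : E2) : ContinuousOn (fun y => fderivWithin ℝ (chartFun x u) halfPlane y e)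
      (extChartAt (𝓡∂ 2) x).target := by
  obtain ⟨V, hV, hT⟩ := exists_isOpen_target_eq x
  have hTd : UniqueDiffOn ℝ (extChartAt (𝓡∂ 2) x).target :=
    hT ▸ uniqueDiffOn_halfPlane.inter hV
  have h := ((contDiffOn_chartFun hu x).continuousOn_fderivWithin hTd (by simp)).clm_apply
    (continuousOn_const (c := e))
  refine h.congr fun y hy => ?_
  rw [hT] at hy ⊢
  simp only [fderivWithin_inter (hV.mem_nhds hy.2)]

theorem continuousOn_wedgeD_chartFun {u w : S → ℝ} (hu : ContMDiff (𝓡∂ 2) 𝓘(ℝ, ℝ) ∞ u)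
    (hw : ContMDiff (𝓡∂ 2) 𝓘(ℝ, ℝ) ∞ w) (x : S) :
    ContinuousOn (wedgeD (chartFun x u) (chartFun x w)) (extChartAt (𝓡∂ 2) x).target :=
  ((continuousOn_fderivWithin_chartFun hu x _).mul (continuousOn_fderivWithin_chartFun hw x _)).sub
    ((continuousOn_fderivWithin_chartFun hu x _).mul (continuousOn_fderivWithin_chartFun hw x _))

/-- The coordinate change between the preferred charts at `x` and `x'`. -/
def chartTransition (x x' : S) : E2 → E2 :=
  extChartAt (𝓡∂ 2) x' ∘ (extChartAt (𝓡∂ 2) x).symm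

theorem hasFDerivWithinAt_chartTransition {x x' : S} {y : E2}
    (hy : y ∈ (extChartAt (𝓡∂ 2) x).target)
    (hy' : (extChartAt (𝓡∂ 2) x).symm y ∈ (extChartAt (𝓡∂ 2) x').source) :
    HasFDerivWithinAt (chartTransition x x')
      (fderivWithin ℝ (chartTransition x x') halfPlane y) halfPlane y := by
  have h1 : ContDiffWithinAt ℝ ∞ (chartTransition x x') (range (𝓡∂ 2)) y :=
    contDiffWithinAt_ext_coord_change x' x (n := ∞) (by
      rw [PartialEquiv.trans_source, PartialEquiv.symm_source]; exact ⟨hy, hy'⟩)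
  rw [range_model_eq] at h1
  exact (h1.differentiableWithinAt (by simp)).hasFDerivWithinAt

theorem det_fderivWithin_chartTransition_pos (hS : IsOrientedAtlas (𝓡∂ 2) S) {x x' : S} {y : E2}
    (hy : y ∈ (extChartAt (𝓡∂ 2) x).target)
    (hy' : (extChartAt (𝓡∂ 2) x).symm y ∈ (extChartAt (𝓡∂ 2) x').source) :
    0 < (fderivWithin ℝ (chartTransition x x') halfPlane y).det := by
  have h1 := hS _ (chart_mem_atlas (EuclideanHalfSpace 2) x) _
    (chart_mem_atlas (EuclideanHalfSpace 2) x') ((extChartAt (𝓡∂ 2) x).symm y)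
    ⟨by have := (extChartAt (𝓡∂ 2) x).map_target hy; rwa [extChartAt_source] at this,
     by rwa [extChartAt_source] at hy'⟩
  rw [range_model_eq] at h1
  have h2 : ((chartAt (EuclideanHalfSpace 2) x).extend (𝓡∂ 2))
      ((extChartAt (𝓡∂ 2) x).symm y) = y := (extChartAt (𝓡∂ 2) x).right_inv hy
  rw [h2] at h1
  exact h1

theorem eventually_symm_mem_source {x x' : S} {y : E2}
    (hy : y ∈ (extChartAt (𝓡∂ 2) x).target)
    (hy' : (extChartAt (𝓡∂ 2) x).symm y ∈ (extChartAt (𝓡∂ 2) x').source) :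
    ∀ᶠ z in 𝓝[halfPlane] y, (extChartAt (𝓡∂ 2) x).symm z ∈ (extChartAt (𝓡∂ 2) x').source := by
  have h := continuousOn_extChartAt_symm (I := 𝓡∂ 2) x y hy
  rw [ContinuousWithinAt, nhdsWithin_target_eq hy] at h
  exact h.eventually ((isOpen_extChartAt_source x').mem_nhds hy')

theorem fderivWithin_chartFun_eq {u : S → ℝ} (hu : ContMDiff (𝓡∂ 2) 𝓘(ℝ, ℝ) ∞ u) {x x' : S}
    {y : E2} (hy : y ∈ (extChartAt (𝓡∂ 2) x).target)
    (hy' : (extChartAt (𝓡∂ 2) x).symm y ∈ (extChartAt (𝓡∂ 2) x').source) :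
    fderivWithin ℝ (chartFun x u) halfPlane y =
      (fderivWithin ℝ (chartFun x' u) halfPlane (chartTransition x x' y)).comp
        (fderivWithin ℝ (chartTransition x x') halfPlane y) := by
  have hτ := hasFDerivWithinAt_chartTransition hy hy'
  have hty : chartTransition x x' y ∈ (extChartAt (𝓡∂ 2) x').target :=
    (extChartAt (𝓡∂ 2) x').map_source hy'
  have hyH := target_subset_halfPlane x hy
  have hev := eventually_symm_mem_source hy hy'
  have hmaps : ∀ᶠ z in 𝓝[halfPlane] y, chartTransition x x' z ∈ halfPlane := by
    filter_upwards [hev] with z hz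
    exact target_subset_halfPlane x' ((extChartAt (𝓡∂ 2) x').map_source hz)
  have heq : chartFun x u =ᶠ[𝓝[halfPlane] y] chartFun x' u ∘ chartTransition x x' := by
    filter_upwards [hev] with z hz
    simp only [chartFun, chartTransition, Function.comp]
    rw [(extChartAt (𝓡∂ 2) x').left_inv hz]
  have h1 : HasFDerivWithinAt (chartFun x' u ∘ chartTransition x x')
      ((fderivWithin ℝ (chartFun x' u) halfPlane (chartTransition x x' y)).comp
        (fderivWithin ℝ (chartTransition x x') halfPlane y)) halfPlane y := by
    refine HasFDerivWithinAt.comp_of_tendsto y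
      (differentiableWithinAt_chartFun hu x' hty).hasFDerivWithinAt hτ ?_
    exact tendsto_nhdsWithin_iff.2 ⟨hτ.continuousWithinAt, hmaps⟩
  exact (h1.congr_of_eventuallyEq heq (heq.self_of_nhdsWithin hyH)).fderivWithin
    (uniqueDiffOn_halfPlane y hyH)

theorem wedgeD_chartFun_eq {u w : S → ℝ} (hu : ContMDiff (𝓡∂ 2) 𝓘(ℝ, ℝ) ∞ u)
    (hw : ContMDiff (𝓡∂ 2) 𝓘(ℝ, ℝ) ∞ w) {x x' : S} {y : E2}
    (hy : y ∈ (extChartAt (𝓡∂ 2) x).target)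
    (hy' : (extChartAt (𝓡∂ 2) x).symm y ∈ (extChartAt (𝓡∂ 2) x').source) :
    wedgeD (chartFun x u) (chartFun x w) y =
      (fderivWithin ℝ (chartTransition x x') halfPlane y).det *
        wedgeD (chartFun x' u) (chartFun x' w) (chartTransition x x' y) := by
  simp only [wedgeD, fderivWithin_chartFun_eq hu hy hy', fderivWithin_chartFun_eq hw hy hy',
    ContinuousLinearMap.comp_apply]
  set L := fderivWithin ℝ (chartTransition x x') halfPlane y
  rw [det_eq_det2, det2_eq]
  set A := fderivWithin ℝ (chartFun x' u) halfPlane (chartTransition x x' y)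
  set B := fderivWithin ℝ (chartFun x' w) halfPlane (chartTransition x x' y)
  rw [E2.eq_smul_add (L !₂[1, 0]), E2.eq_smul_add (L !₂[0, 1])]
  simp only [map_add, map_smul, smul_eq_mul, PiLp.add_apply, PiLp.smul_apply]
  simp
  ring

/-- Change of charts in the integral of the two-form `g du ∧ dw`. -/
theorem setIntegral_wedgeD_chart_change (hS : IsOrientedAtlas (𝓡∂ 2) S) {g u w : S → ℝ}
    (hu : ContMDiff (𝓡∂ 2) 𝓘(ℝ, ℝ) ∞ u) (hw : ContMDiff (𝓡∂ 2) 𝓘(ℝ, ℝ) ∞ w) {x x' : S}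
    (hg : ∀ p ∈ (extChartAt (𝓡∂ 2) x).source, p ∉ (extChartAt (𝓡∂ 2) x').source → g p = 0)
    (hu0 : ∀ p ∈ (extChartAt (𝓡∂ 2) x').source, p ∉ (extChartAt (𝓡∂ 2) x).source →
      p ∉ tsupport u) :
    ∫ y in (extChartAt (𝓡∂ 2) x).target, chartFun x g y * wedgeD (chartFun x u) (chartFun x w) y
      = ∫ y in (extChartAt (𝓡∂ 2) x').target,
        chartFun x' g y * wedgeD (chartFun x' u) (chartFun x' w) y := by
  set A : Set E2 := (extChartAt (𝓡∂ 2) x).target ∩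
    (extChartAt (𝓡∂ 2) x).symm ⁻¹' (extChartAt (𝓡∂ 2) x').source with hA
  have hAm : MeasurableSet A := by
    obtain ⟨V, hV, h⟩ := continuousOn_iff'.1 (continuousOn_extChartAt_symm (I := 𝓡∂ 2) x) _
      (isOpen_extChartAt_source (I := 𝓡∂ 2) x')
    rw [hA, inter_comm, h]
    exact hV.measurableSet.inter (measurableSet_target x)
  have hAH : A ⊆ halfPlane := fun y hy => target_subset_halfPlane x hy.1
  have hinj : InjOn (chartTransition x x') A := by
    intro y hy z hz h
    have h1 := (extChartAt (𝓡∂ 2) x').injOn hy.2 hz.2 h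
    exact (extChartAt (𝓡∂ 2) x).symm.injOn hy.1 hz.1 h1
  have himg : chartTransition x x' '' A = (extChartAt (𝓡∂ 2) x').target ∩
      (extChartAt (𝓡∂ 2) x').symm ⁻¹' (extChartAt (𝓡∂ 2) x).source := by
    ext z
    constructor
    · rintro ⟨y, hy, rfl⟩
      refine ⟨(extChartAt (𝓡∂ 2) x').map_source hy.2, ?_⟩
      simp only [mem_preimage, chartTransition, Function.comp]
      rw [(extChartAt (𝓡∂ 2) x').left_inv hy.2]
      exact (extChartAt (𝓡∂ 2) x).map_target hy.1
    · rintro ⟨hz, hz'⟩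
      refine ⟨extChartAt (𝓡∂ 2) x ((extChartAt (𝓡∂ 2) x').symm z),
        ⟨(extChartAt (𝓡∂ 2) x).map_source hz', ?_⟩, ?_⟩
      · simp only [mem_preimage]
        rw [(extChartAt (𝓡∂ 2) x).left_inv hz']
        exact (extChartAt (𝓡∂ 2) x').map_target hz
      · simp only [chartTransition, Function.comp]
        rw [(extChartAt (𝓡∂ 2) x).left_inv hz', (extChartAt (𝓡∂ 2) x').right_inv hz]
  have h1 := integral_image_eq_integral_abs_det_fderiv_smul volume hAm
    (fun y hy => (hasFDerivWithinAt_chartTransition hy.1 hy.2).mono hAH) hinj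
    (fun y => chartFun x' g y * wedgeD (chartFun x' u) (chartFun x' w) y)
  -- Outside the overlap of the charts both integrands vanish: in the chart at `x` because `g` does,
  -- in the chart at `x'` because `u`, and with it `du`, does.
  have h2 : ∫ y in (extChartAt (𝓡∂ 2) x).target,
      chartFun x g y * wedgeD (chartFun x u) (chartFun x w) y
      = ∫ y in A, chartFun x g y * wedgeD (chartFun x u) (chartFun x w) y := by
    refine setIntegral_eq_of_subset_of_forall_sdiff_eq_zero (measurableSet_target x)
      inter_subset_left fun y hy => ?_
    have : chartFun x g y = 0 := hg _ ((extChartAt (𝓡∂ 2) x).map_target hy.1)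
      fun h => hy.2 ⟨hy.1, h⟩
    rw [this, zero_mul]
  have h3 : ∫ y in (extChartAt (𝓡∂ 2) x').target,
      chartFun x' g y * wedgeD (chartFun x' u) (chartFun x' w) y
      = ∫ y in chartTransition x x' '' A,
        chartFun x' g y * wedgeD (chartFun x' u) (chartFun x' w) y := by
    refine setIntegral_eq_of_subset_of_forall_sdiff_eq_zero (measurableSet_target x')
      (himg ▸ inter_subset_left) fun y hy => ?_
    rw [himg] at hy
    have hns : (extChartAt (𝓡∂ 2) x').symm y ∉ tsupport u :=
      hu0 _ ((extChartAt (𝓡∂ 2) x').map_target hy.1) fun h => hy.2 ⟨hy.1, h⟩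
    have h4 := continuousOn_extChartAt_symm (I := 𝓡∂ 2) x' y hy.1
    rw [ContinuousWithinAt, nhdsWithin_target_eq hy.1] at h4
    have h5 : chartFun x' u =ᶠ[𝓝[halfPlane] y] fun _ => 0 := by
      filter_upwards [h4.eventually ((isClosed_tsupport u).isOpen_compl.mem_nhds hns)] with z hz
      exact image_eq_zero_of_notMem_tsupport (f := u) hz
    have h6 : fderivWithin ℝ (chartFun x' u) halfPlane y = 0 := by
      rw [h5.fderivWithin_eq (image_eq_zero_of_notMem_tsupport (f := u) hns)]; simp
    simp [wedgeD, h6]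
  rw [h2, h3, h1]
  refine setIntegral_congr_fun hAm fun y hy => ?_
  -- Orientation enters here: the Jacobian is positive, so the absolute value in the change of
  -- variables can be dropped.
  have hdet := det_fderivWithin_chartTransition_pos hS hy.1 hy.2
  have hgy : chartFun x' g (chartTransition x x' y) = chartFun x g y := by
    simp only [chartFun, chartTransition, Function.comp]
    rw [(extChartAt (𝓡∂ 2) x').left_inv hy.2]
  simp only [smul_eq_mul, hgy, abs_of_pos hdet]
  rw [wedgeD_chartFun_eq hu hw hy.1 hy.2]
  ring

end SurfaceCharts


/-! ### The boundary of a surface in charts -/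

section Stokes
open MeasureTheory

variable {S : Type*} [TopologicalSpace S] [ChartedSpace (EuclideanHalfSpace 2) S]

/-- An embedded parametrization of the boundary of a surface, with the boundary orientation. -/
structure IsBoundaryCurve (b : ℝ → S) : Prop where
  smooth : ContMDiff 𝓘(ℝ, ℝ) (𝓡∂ 2) ∞ b
  periodic : Function.Periodic b 1
  injOn : InjOn b (Ico 0 1)
  range_eq : range b = (𝓡∂ 2).boundary S
  orientation : ∀ θ u, IsOutward u → 0 < det2 u (surfaceVelocity b θ)

theorem IsBoundaryCurve.surfaceVelocity_zero {b : ℝ → S} (hb : IsBoundaryCurve b) (θ : ℝ) :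
    surfaceVelocity b θ 0 = 0 := by
  by_contra hne
  -- If the first coordinate of the velocity were not zero, this multiple of the velocity would
  -- point outward, but its determinant with the velocity is zero.
  have h := hb.orientation θ !₂[-1, -(surfaceVelocity b θ 1) / surfaceVelocity b θ 0] (by
    simp [IsOutward])
  rw [det2_eq] at h
  simp only [Matrix.cons_val_zero, Matrix.cons_val_one] at h
  rw [div_mul_cancel₀ _ hne] at h
  linarith

theorem IsBoundaryCurve.surfaceVelocity_one_neg {b : ℝ → S} (hb : IsBoundaryCurve b) (θ : ℝ) :
    surfaceVelocity b θ 1 < 0 := by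
  have h := hb.orientation θ !₂[-1, 0] (by simp [IsOutward])
  rw [det2_eq] at h
  simp at h
  exact h

variable [IsManifold (𝓡∂ 2) ∞ S]

/-- Whether a point is interior can be tested in any chart of the smooth atlas, not only in the
preferred chart at the point. -/
theorem mem_boundary_iff {x p : S} (hp : p ∈ (extChartAt (𝓡∂ 2) x).source) :
    p ∈ (𝓡∂ 2).boundary S ↔ extChartAt (𝓡∂ 2) x p 0 = 0 := by
  have h1 : p ∈ (𝓡∂ 2).interior S ↔
      extChartAt (𝓡∂ 2) x p ∈ interior (extChartAt (𝓡∂ 2) x).target :=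
    (𝓡∂ 2).isInteriorPoint_iff_of_mem_atlas (n := ∞) (by simp)
      (chart_mem_atlas (EuclideanHalfSpace 2) x) (by rwa [extChartAt_source] at hp)
  obtain ⟨V, hV, hT⟩ := exists_isOpen_target_eq x
  have hpT := (extChartAt (𝓡∂ 2) x).map_source hp
  have hpH : 0 ≤ extChartAt (𝓡∂ 2) x p 0 := target_subset_halfPlane x hpT
  rw [hT, interior_inter, hV.interior_eq, interior_halfPlane] at h1
  rw [hT] at hpT
  rw [← (𝓡∂ 2).compl_interior, mem_compl_iff, h1]
  constructor
  · intro h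
    by_contra hne
    exact h ⟨lt_of_le_of_ne hpH (Ne.symm hne), hpT.2⟩
  · intro h h2
    have : 0 < extChartAt (𝓡∂ 2) x p 0 := h2.1
    linarith

/-- In every chart, the boundary runs in the negative direction of the second coordinate axis. -/
theorem IsBoundaryCurve.exists_hasDerivAt (hS : IsOrientedAtlas (𝓡∂ 2) S) {b : ℝ → S}
    (hb : IsBoundaryCurve b) {x : S} {θ : ℝ} (hx : b θ ∈ (extChartAt (𝓡∂ 2) x).source) :
    ∃ d < 0, HasDerivAt (fun θ' => extChartAt (𝓡∂ 2) x (b θ')) (!₂[0, d] : E2) θ := by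
  set y := extChartAt (𝓡∂ 2) (b θ) (b θ) with hydef
  have hy : y ∈ (extChartAt (𝓡∂ 2) (b θ)).target := mem_extChartAt_target (b θ)
  have hyH := target_subset_halfPlane _ hy
  have hsy : (extChartAt (𝓡∂ 2) (b θ)).symm y = b θ := extChartAt_to_inv (b θ)
  have hy' : (extChartAt (𝓡∂ 2) (b θ)).symm y ∈ (extChartAt (𝓡∂ 2) x).source := by rwa [hsy]
  set L := fderivWithin ℝ (chartTransition (b θ) x) halfPlane y with hL
  have hτ : HasFDerivWithinAt (chartTransition (b θ) x) L halfPlane y :=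
    hasFDerivWithinAt_chartTransition hy hy'
  have hdet : 0 < L.det := det_fderivWithin_chartTransition_pos hS hy hy'
  set v : E2 := surfaceVelocity b θ with hv
  have hd : HasDerivAt (fun θ' => extChartAt (𝓡∂ 2) (b θ) (b θ')) v θ :=
    hasDerivAt_extChartAt_comp (I := 𝓡∂ 2) (hb.smooth.mdifferentiableAt (by simp))
  have hbc : ContinuousAt b θ := hb.smooth.continuous.continuousAt
  have hev1 : ∀ᶠ θ' in 𝓝 θ, b θ' ∈ (extChartAt (𝓡∂ 2) (b θ)).source :=
    hbc.eventually (extChartAt_source_mem_nhds (I := 𝓡∂ 2) (b θ))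
  have hev2 : ∀ᶠ θ' in 𝓝 θ, b θ' ∈ (extChartAt (𝓡∂ 2) x).source :=
    hbc.eventually ((isOpen_extChartAt_source x).mem_nhds hx)
  have hcomp : HasDerivAt (fun θ' => extChartAt (𝓡∂ 2) x (b θ')) (L v) θ := by
    have h1 : HasDerivAt (chartTransition (b θ) x ∘ fun θ' => extChartAt (𝓡∂ 2) (b θ) (b θ'))
        (L v) θ := by
      refine (hτ.comp_hasDerivWithinAt_of_eq θ (hd.hasDerivWithinAt (s := b ⁻¹'
        (extChartAt (𝓡∂ 2) (b θ)).source)) ?_ rfl).hasDerivAt hev1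
      intro θ' hθ'
      exact target_subset_halfPlane _ ((extChartAt (𝓡∂ 2) (b θ)).map_source hθ')
    refine h1.congr_of_eventuallyEq ?_
    filter_upwards [hev1] with θ' hθ'
    simp only [chartTransition, Function.comp]
    rw [(extChartAt (𝓡∂ 2) (b θ)).left_inv hθ']
  have hz : ∀ᶠ θ' in 𝓝 θ, extChartAt (𝓡∂ 2) x (b θ') 0 = 0 := by
    filter_upwards [hev2] with θ' hθ'
    exact (mem_boundary_iff hθ').1 (hb.range_eq ▸ mem_range_self θ')
  -- The coordinate change carries boundary to boundary, so the image of the velocity is again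
  -- tangent to the boundary line.
  have hLv0 : L v 0 = 0 := by
    have h1 : HasDerivAt (fun θ' => extChartAt (𝓡∂ 2) x (b θ') 0) (L v 0) θ :=
      (EuclideanSpace.proj (𝕜 := ℝ) (0 : Fin 2)).hasFDerivAt.comp_hasDerivAt θ hcomp
    have h2 : HasDerivAt (fun θ' => extChartAt (𝓡∂ 2) x (b θ') 0) 0 θ :=
      (hasDerivAt_const θ (0 : ℝ)).congr_of_eventuallyEq hz
    exact h1.unique h2
  have hv0 : v 0 = 0 := hb.surfaceVelocity_zero θ
  have hv1 : v 1 < 0 := hb.surfaceVelocity_one_neg θ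
  have hve : v = v 1 • (!₂[0, 1] : E2) := by
    conv_lhs => rw [E2.eq_smul_add v, hv0, zero_smul, zero_add]
  have hL10 : L !₂[0, 1] 0 = 0 := by
    rw [hve, map_smul, PiLp.smul_apply, smul_eq_mul] at hLv0
    exact (mul_eq_zero.1 hLv0).resolve_left hv1.ne
  have hty : chartTransition (b θ) x y 0 = 0 := by
    simp only [chartTransition, Function.comp, hsy]
    exact hz.self_of_nhds
  -- The first coordinate of the transition is nonnegative on the half plane and zero at `y`: its
  -- derivative in the inward direction cannot be negative. Positivity of the determinant then makes
  -- the tangential entry positive.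
  have hL00 : 0 ≤ L !₂[1, 0] 0 := by
    have hmin : IsLocalMinOn (fun z => chartTransition (b θ) x z 0) halfPlane y := by
      have h1 := eventually_symm_mem_source hy hy'
      filter_upwards [h1] with z hz
      rw [hty]
      exact target_subset_halfPlane x ((extChartAt (𝓡∂ 2) x).map_source hz)
    have hfd : HasFDerivWithinAt (fun z => chartTransition (b θ) x z 0)
        ((EuclideanSpace.proj (𝕜 := ℝ) (0 : Fin 2)).comp L) halfPlane y :=
      (EuclideanSpace.proj (𝕜 := ℝ) (0 : Fin 2)).hasFDerivAt.comp_hasFDerivWithinAt y hτ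
    refine hmin.hasFDerivWithinAt_nonneg hfd (y := !₂[1, 0])
      (mem_posTangentConeAt_of_segment_subset ?_)
    rintro z ⟨s, t, hs, ht, hst, rfl⟩
    have hy0 : 0 ≤ y 0 := hyH
    simp only [halfPlane, mem_ofPred_eq, PiLp.add_apply, PiLp.smul_apply, smul_eq_mul]
    simp
    positivity
  refine ⟨L v 1, ?_, ?_⟩
  · rw [det_eq_det2, det2_eq, hL10, mul_zero, sub_zero] at hdet
    have h1 : 0 < L !₂[0, 1] 1 := (pos_iff_pos_of_mul_pos hdet).1
      (lt_of_le_of_ne hL00 (left_ne_zero_of_mul hdet.ne').symm)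
    rw [hve, map_smul, PiLp.smul_apply, smul_eq_mul]
    exact mul_neg_of_neg_of_pos hv1 h1
  · convert hcomp using 1
    ext i; fin_cases i
    · simp [hLv0]
    · simp

theorem IsBoundaryCurve.contDiff_comp {b : ℝ → S} (hb : IsBoundaryCurve b) {u : S → ℝ}
    (hu : ContMDiff (𝓡∂ 2) 𝓘(ℝ, ℝ) ∞ u) : ContDiff ℝ ∞ (u ∘ b) :=
  contMDiff_iff_contDiff.1 (hu.comp hb.smooth)

theorem IsBoundaryCurve.exists_mem_Ico {b : ℝ → S} (hb : IsBoundaryCurve b) {p : S}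
    (hp : p ∈ (𝓡∂ 2).boundary S) : ∃ θ ∈ Ico (0 : ℝ) 1, b θ = p := by
  rw [← hb.range_eq] at hp
  obtain ⟨θ, rfl⟩ := hp
  refine ⟨Int.fract θ, ⟨Int.fract_nonneg _, Int.fract_lt_one _⟩, ?_⟩
  have := hb.periodic.sub_int_mul_eq (x := θ) ⌊θ⌋
  rwa [mul_one] at this

/-- The integral over the boundary of `g dβ`, with `g` supported in a chart. -/
theorem IsBoundaryCurve.integral_chart (hS : IsOrientedAtlas (𝓡∂ 2) S) {b : ℝ → S}
    (hb : IsBoundaryCurve b) {x : S} {g β : S → ℝ} (hβ : ContMDiff (𝓡∂ 2) 𝓘(ℝ, ℝ) ∞ β)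
    (hg : ∀ p ∉ (extChartAt (𝓡∂ 2) x).source, g p = 0) :
    ∫ s : ℝ, (extChartAt (𝓡∂ 2) x).target.indicator (chartFun x g) !₂[0, s]
        * fderivWithin ℝ (chartFun x β) halfPlane !₂[0, s] !₂[0, 1]
      = -∫ θ in Ico (0 : ℝ) 1, g (b θ) * deriv (β ∘ b) θ := by
  set Θ : Set ℝ := Ico 0 1 ∩ b ⁻¹' (extChartAt (𝓡∂ 2) x).source with hΘ
  have hΘm : MeasurableSet Θ := measurableSet_Ico.inter
    ((isOpen_extChartAt_source x).preimage hb.smooth.continuous).measurableSet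
  have hex : ∀ θ, ∃ d, θ ∈ Θ → d < 0 ∧
      HasDerivAt (fun θ' => extChartAt (𝓡∂ 2) x (b θ')) (!₂[0, d] : E2) θ := fun θ => by
    by_cases h : θ ∈ Θ
    · obtain ⟨d, h1, h2⟩ := hb.exists_hasDerivAt hS h.2
      exact ⟨d, fun _ => ⟨h1, h2⟩⟩
    · exact ⟨0, fun h' => absurd h' h⟩
  choose d hd using hex
  set Y : ℝ → ℝ := fun θ => extChartAt (𝓡∂ 2) x (b θ) 1 with hY
  have hYe : ∀ θ ∈ Θ, extChartAt (𝓡∂ 2) x (b θ) = !₂[0, Y θ] := fun θ hθ => by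
    have h0 := (mem_boundary_iff hθ.2).1 (hb.range_eq ▸ mem_range_self θ)
    ext i; fin_cases i
    · exact h0
    · rfl
  have hYd : ∀ θ ∈ Θ, HasDerivWithinAt Y (d θ) Θ θ := fun θ hθ => by
    have h1 : HasDerivAt Y ((!₂[0, d θ] : E2) 1) θ :=
      (EuclideanSpace.proj (𝕜 := ℝ) (1 : Fin 2)).hasFDerivAt.comp_hasDerivAt θ (hd θ hθ).2
    exact h1.hasDerivWithinAt
  have hYi : InjOn Y Θ := fun θ hθ θ' hθ' h => by
    have h1 : extChartAt (𝓡∂ 2) x (b θ) = extChartAt (𝓡∂ 2) x (b θ') := by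
      rw [hYe θ hθ, hYe θ' hθ', h]
    exact hb.injOn hθ.1 hθ'.1 ((extChartAt (𝓡∂ 2) x).injOn hθ.2 hθ'.2 h1)
  -- The boundary parameter thus gives a bijective change of variables onto the boundary part of the
  -- chart. It is decreasing, and so `|d| = -d` produces the minus sign.
  have himg : Y '' Θ = {s : ℝ | !₂[0, s] ∈ (extChartAt (𝓡∂ 2) x).target} := by
    ext s
    constructor
    · rintro ⟨θ, hθ, rfl⟩
      rw [mem_ofPred_eq, ← hYe θ hθ]
      exact (extChartAt (𝓡∂ 2) x).map_source hθ.2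
    · intro hs
      have hp := (extChartAt (𝓡∂ 2) x).map_target hs
      obtain ⟨θ, hθ, hbθ⟩ := hb.exists_mem_Ico ((mem_boundary_iff hp).2 (by
        rw [(extChartAt (𝓡∂ 2) x).right_inv hs]; rfl))
      refine ⟨θ, ⟨hθ, by rw [mem_preimage, hbθ]; exact hp⟩, ?_⟩
      simp only [hY, hbθ]
      rw [(extChartAt (𝓡∂ 2) x).right_inv hs]; rfl
  set G : ℝ → ℝ := fun s => (extChartAt (𝓡∂ 2) x).target.indicator (chartFun x g) !₂[0, s]
        * fderivWithin ℝ (chartFun x β) halfPlane !₂[0, s] !₂[0, 1] with hG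
  have h1 : ∫ s : ℝ, G s = ∫ s in Y '' Θ, G s := by
    rw [himg]
    symm
    refine setIntegral_eq_integral_of_forall_compl_eq_zero fun s hs => ?_
    simp only [hG]
    rw [mem_ofPred_eq] at hs
    rw [indicator_of_notMem hs, zero_mul]
  have h2 : ∫ θ in Ico (0 : ℝ) 1, g (b θ) * deriv (β ∘ b) θ
      = ∫ θ in Θ, g (b θ) * deriv (β ∘ b) θ := by
    refine setIntegral_eq_of_subset_of_forall_sdiff_eq_zero measurableSet_Ico inter_subset_left
      fun θ hθ => ?_
    rw [hg _ fun h => hθ.2 ⟨hθ.1, h⟩, zero_mul]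
  rw [h1, integral_image_eq_integral_abs_deriv_smul hΘm hYd hYi, h2, ← integral_neg]
  refine setIntegral_congr_fun hΘm fun θ hθ => ?_
  have hT := (extChartAt (𝓡∂ 2) x).map_source hθ.2
  have hT' : (!₂[0, Y θ] : E2) ∈ (extChartAt (𝓡∂ 2) x).target := by rwa [← hYe θ hθ]
  have hgθ : chartFun x g !₂[0, Y θ] = g (b θ) := by
    rw [← hYe θ hθ, chartFun, Function.comp, (extChartAt (𝓡∂ 2) x).left_inv hθ.2]
  have hder : deriv (β ∘ b) θ
      = d θ * fderivWithin ℝ (chartFun x β) halfPlane !₂[0, Y θ] !₂[0, 1] := by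
    have hev : ∀ᶠ θ' in 𝓝 θ, b θ' ∈ (extChartAt (𝓡∂ 2) x).source :=
      hb.smooth.continuous.continuousAt.eventually ((isOpen_extChartAt_source x).mem_nhds hθ.2)
    have h3 : HasDerivAt (chartFun x β ∘ fun θ' => extChartAt (𝓡∂ 2) x (b θ'))
        (fderivWithin ℝ (chartFun x β) halfPlane !₂[0, Y θ] !₂[0, d θ]) θ := by
      refine ((differentiableWithinAt_chartFun hβ x hT').hasFDerivWithinAt
        |>.comp_hasDerivWithinAt_of_eq θ ((hd θ hθ).2.hasDerivWithinAt (s := b ⁻¹'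
        (extChartAt (𝓡∂ 2) x).source)) ?_ (hYe θ hθ).symm).hasDerivAt hev
      intro θ' hθ'
      exact target_subset_halfPlane _ ((extChartAt (𝓡∂ 2) x).map_source hθ')
    have h4 : HasDerivAt (β ∘ b)
        (fderivWithin ℝ (chartFun x β) halfPlane !₂[0, Y θ] !₂[0, d θ]) θ := by
      refine h3.congr_of_eventuallyEq ?_
      filter_upwards [hev] with θ' hθ'
      simp only [chartFun, Function.comp]
      rw [(extChartAt (𝓡∂ 2) x).left_inv hθ']
    rw [h4.deriv, show (!₂[0, d θ] : E2) = d θ • (!₂[0, 1] : E2) by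
      ext i; fin_cases i <;> simp, map_smul, smul_eq_mul]
  simp only [hG, smul_eq_mul]
  rw [indicator_of_mem hT', hgθ, hder, abs_of_neg (hd θ hθ).1]
  ring

end Stokes


/-! ### Stokes' theorem, and winding of functions that extend over the surface -/

section StokesTheorem
open MeasureTheory

variable {S : Type*} [TopologicalSpace S] [ChartedSpace (EuclideanHalfSpace 2) S]
  [IsManifold (𝓡∂ 2) ∞ S]

theorem isCompact_extChartAt_image {x : S} {C : Set S} (hC : IsCompact C)
    (hCx : C ⊆ (extChartAt (𝓡∂ 2) x).source) : IsCompact (extChartAt (𝓡∂ 2) x '' C) :=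
  hC.image_of_continuousOn ((continuousOn_extChartAt x).mono hCx)

theorem notMem_of_notMem_extChartAt_image {x : S} {C : Set S} {y : E2}
    (hy : y ∈ (extChartAt (𝓡∂ 2) x).target) (h : y ∉ extChartAt (𝓡∂ 2) x '' C) :
    (extChartAt (𝓡∂ 2) x).symm y ∉ C :=
  fun hc => h ⟨_, hc, (extChartAt (𝓡∂ 2) x).right_inv hy⟩

theorem image_extChartAt_subset_target {x : S} {C : Set S}
    (hCx : C ⊆ (extChartAt (𝓡∂ 2) x).source) :
    extChartAt (𝓡∂ 2) x '' C ⊆ (extChartAt (𝓡∂ 2) x).target := by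
  rintro _ ⟨p, hp, rfl⟩
  exact (extChartAt (𝓡∂ 2) x).map_source (hCx hp)

theorem continuousOn_chartFun {g : S → ℝ} (hg : Continuous g) (x : S) :
    ContinuousOn (chartFun x g) (extChartAt (𝓡∂ 2) x).target :=
  hg.comp_continuousOn (continuousOn_extChartAt_symm x)

theorem chartFun_wedgeD_eq_zero {x : S} {u w : S → ℝ} {y : E2}
    (hy : y ∈ (extChartAt (𝓡∂ 2) x).target)
    (h : (extChartAt (𝓡∂ 2) x).symm y ∉ tsupport u) :
    wedgeD (chartFun x u) (chartFun x w) y = 0 := by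
  have h4 := continuousOn_extChartAt_symm (I := 𝓡∂ 2) x y hy
  rw [ContinuousWithinAt, nhdsWithin_target_eq hy] at h4
  have h5 : chartFun x u =ᶠ[𝓝[halfPlane] y] fun _ => 0 := by
    filter_upwards [h4.eventually ((isClosed_tsupport u).isOpen_compl.mem_nhds h)] with z hz
    exact image_eq_zero_of_notMem_tsupport (f := u) hz
  have h6 : fderivWithin ℝ (chartFun x u) halfPlane y = 0 := by
    rw [h5.fderivWithin_eq (image_eq_zero_of_notMem_tsupport (f := u) h)]; simp
  simp [wedgeD, h6]

theorem integrableOn_chartFun_mul_wedgeD {x : S} {g u w : S → ℝ} (hg : Continuous g)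
    (hu : ContMDiff (𝓡∂ 2) 𝓘(ℝ, ℝ) ∞ u) (hw : ContMDiff (𝓡∂ 2) 𝓘(ℝ, ℝ) ∞ w) {C : Set S}
    (hC : IsCompact C) (hCx : C ⊆ (extChartAt (𝓡∂ 2) x).source)
    (h0 : ∀ p ∉ C, g p = 0 ∨ p ∉ tsupport u) :
    IntegrableOn (fun y => chartFun x g y * wedgeD (chartFun x u) (chartFun x w) y)
      (extChartAt (𝓡∂ 2) x).target := by
  have hKT := image_extChartAt_subset_target hCx
  have h1 : IntegrableOn (fun y => chartFun x g y * wedgeD (chartFun x u) (chartFun x w) y)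
      (extChartAt (𝓡∂ 2) x '' C) :=
    (((continuousOn_chartFun hg x).mul (continuousOn_wedgeD_chartFun hu hw x)).mono
      hKT).integrableOn_compact (isCompact_extChartAt_image hC hCx)
  refine h1.of_forall_sdiff_eq_zero (measurableSet_target x) fun y hy => ?_
  rcases h0 _ (notMem_of_notMem_extChartAt_image hy.1 hy.2) with h | h
  · rw [chartFun, Function.comp, h, zero_mul]
  · rw [chartFun_wedgeD_eq_zero hy.1 h, mul_zero]

/-- Green's formula in one chart for `ρ a dβ`. The minus sign in Green's formula cancels against the
downward direction of the boundary. Since `da ∧ dβ = 0`, only `a dρ ∧ dβ` remains of `d(ρ a) ∧ dβ`.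
-/
theorem IsBoundaryCurve.integral_eq_setIntegral_wedgeD (hS : IsOrientedAtlas (𝓡∂ 2) S) {b : ℝ → S}
    (hb : IsBoundaryCurve b) {a β ρ : S → ℝ} (ha : ContMDiff (𝓡∂ 2) 𝓘(ℝ, ℝ) ∞ a)
    (hβ : ContMDiff (𝓡∂ 2) 𝓘(ℝ, ℝ) ∞ β) (hρ : ContMDiff (𝓡∂ 2) 𝓘(ℝ, ℝ) ∞ ρ) {x : S}
    (hcl : ∀ y ∈ (extChartAt (𝓡∂ 2) x).target, wedgeD (chartFun x a) (chartFun x β) y = 0)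
    (hρc : IsCompact (tsupport ρ)) (hρx : tsupport ρ ⊆ (extChartAt (𝓡∂ 2) x).source) :
    ∫ θ in Ico (0 : ℝ) 1, ρ (b θ) * a (b θ) * deriv (β ∘ b) θ =
      ∫ y in (extChartAt (𝓡∂ 2) x).target,
        chartFun x a y * wedgeD (chartFun x ρ) (chartFun x β) y := by
  set g : S → ℝ := fun p => ρ p * a p with hg
  have hgs : ContMDiff (𝓡∂ 2) 𝓘(ℝ, ℝ) ∞ g := hρ.mul ha
  set T := (extChartAt (𝓡∂ 2) x).target with hTdef
  set K := extChartAt (𝓡∂ 2) x '' tsupport ρ with hKdef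
  have hK : IsCompact K := isCompact_extChartAt_image hρc hρx
  have hKT : K ⊆ T := image_extChartAt_subset_target hρx
  obtain ⟨V, hV, hT⟩ := exists_isOpen_target_eq x
  have ha0 : ∀ y ∈ halfPlane, y ∉ K → T.indicator (chartFun x g) y = 0 := by
    intro y _ hyK
    by_cases hyT : y ∈ T
    · rw [indicator_of_mem hyT, chartFun, Function.comp]
      simp only [hg]
      rw [image_eq_zero_of_notMem_tsupport (notMem_of_notMem_extChartAt_image hyT hyK), zero_mul]
    · exact indicator_of_notMem hyT _
  have h1 := integral_wedgeD_halfPlane hV hT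
    ((contDiffOn_chartFun hgs x).congr fun y hy => indicator_of_mem hy _)
    (contDiffOn_chartFun hβ x) hK hKT ha0
  have h2 := hb.integral_chart hS (x := x) (g := g) hβ fun p hp => by
    simp only [hg]
    rw [image_eq_zero_of_notMem_tsupport fun h => hp (hρx h), zero_mul]
  rw [h2, neg_neg] at h1
  rw [← h1]
  have h3 : ∫ y in halfPlane, wedgeD (T.indicator (chartFun x g)) (chartFun x β) y
      = ∫ y in T, wedgeD (T.indicator (chartFun x g)) (chartFun x β) y := by
    refine setIntegral_eq_of_subset_of_forall_sdiff_eq_zero isClosed_halfPlane.measurableSet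
      (target_subset_halfPlane x) fun y hy => ?_
    rw [wedgeD, fderivWithin_halfPlane_eq_zero hK.isClosed ha0 hy.1 fun h => hy.2 (hKT h)]
    simp
  rw [h3]
  refine setIntegral_congr_fun (measurableSet_target x) fun y hy => ?_
  have hyH := target_subset_halfPlane x hy
  have hprod : chartFun x ρ * chartFun x a = chartFun x g := rfl
  have h4 : T.indicator (chartFun x g) =ᶠ[𝓝[halfPlane] y] chartFun x ρ * chartFun x a := by
    rw [← nhdsWithin_target_eq hy]
    filter_upwards [self_mem_nhdsWithin] with z hz
    rw [indicator_of_mem hz, hprod]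
  have h5 : fderivWithin ℝ (T.indicator (chartFun x g)) halfPlane y =
      chartFun x ρ y • fderivWithin ℝ (chartFun x a) halfPlane y
      + chartFun x a y • fderivWithin ℝ (chartFun x ρ) halfPlane y := by
    rw [h4.fderivWithin_eq (by rw [indicator_of_mem hy, hprod])]
    exact ((differentiableWithinAt_chartFun hρ x hy).hasFDerivWithinAt.mul
      (differentiableWithinAt_chartFun ha x hy).hasFDerivWithinAt).fderivWithin
      (uniqueDiffOn_halfPlane y hyH)
  have h6 := hcl y hy
  simp only [wedgeD] at h6 ⊢
  simp only [h5, add_apply, smul_apply, smul_eq_mul]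
  linear_combination (chartFun x ρ y) * h6

/-- Stokes' theorem for a one-form `a dβ` with `da ∧ dβ = 0`. -/
theorem IsBoundaryCurve.integral_eq_zero [CompactSpace S] [T2Space S]
    (hS : IsOrientedAtlas (𝓡∂ 2) S) {b : ℝ → S}
    (hb : IsBoundaryCurve b) {a β : S → ℝ} (ha : ContMDiff (𝓡∂ 2) 𝓘(ℝ, ℝ) ∞ a)
    (hβ : ContMDiff (𝓡∂ 2) 𝓘(ℝ, ℝ) ∞ β)
    (hcl : ∀ x, ∀ y ∈ (extChartAt (𝓡∂ 2) x).target, wedgeD (chartFun x a) (chartFun x β) y = 0) :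
    ∫ θ in Ico (0 : ℝ) 1, a (b θ) * deriv (β ∘ b) θ = 0 := by
  obtain ⟨t, ht⟩ := isCompact_univ.elim_finite_subcover
    (fun x : S => (extChartAt (𝓡∂ 2) x).source) (fun x => isOpen_extChartAt_source x)
    fun x _ => mem_iUnion.2 ⟨x, mem_extChartAt_source x⟩
  obtain ⟨ρ, hρ⟩ := SmoothPartitionOfUnity.exists_isSubordinate (𝓡∂ 2) (s := (univ : Set S))
    isClosed_univ (fun i : t => (extChartAt (𝓡∂ 2) (i : S)).source)
    (fun i => isOpen_extChartAt_source (i : S)) (by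
      intro p hp
      obtain ⟨x, hx, hpx⟩ := mem_iUnion₂.1 (ht hp)
      exact mem_iUnion.2 ⟨⟨x, hx⟩, hpx⟩)
  have hsum : ∀ p : S, ∑ i, ρ i p = 1 := fun p => by
    rw [← finsum_eq_sum_of_fintype]; exact ρ.sum_eq_one (mem_univ p)
  have hρs : ∀ i, ContMDiff (𝓡∂ 2) 𝓘(ℝ, ℝ) ∞ (ρ i) := fun i => (ρ i).contMDiff
  have hρc : ∀ i, IsCompact (tsupport (ρ i)) := fun i => (isClosed_tsupport _).isCompact
  have hcont : Continuous (deriv (β ∘ b)) :=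
    (hb.contDiff_comp hβ).continuous_deriv (by simp)
  have hac : Continuous fun θ => a (b θ) := ha.continuous.comp hb.smooth.continuous
  calc ∫ θ in Ico (0 : ℝ) 1, a (b θ) * deriv (β ∘ b) θ
      = ∫ θ in Ico (0 : ℝ) 1, ∑ i, ρ i (b θ) * a (b θ) * deriv (β ∘ b) θ := by
        congr 1
        ext θ
        rw [← Finset.sum_mul, ← Finset.sum_mul, hsum, one_mul]
    _ = ∑ i, ∫ θ in Ico (0 : ℝ) 1, ρ i (b θ) * a (b θ) * deriv (β ∘ b) θ := by
        refine integral_finsetSum _ fun i _ => ?_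
        have h1 : Continuous fun θ => ρ i (b θ) * a (b θ) * deriv (β ∘ b) θ :=
          (((hρs i).continuous.comp hb.smooth.continuous).mul hac).mul hcont
        exact (h1.continuousOn.integrableOn_compact isCompact_Icc).mono_set Ico_subset_Icc_self
    _ = ∑ i : t, ∫ y in (extChartAt (𝓡∂ 2) (i : S)).target,
          chartFun (i : S) a y * wedgeD (chartFun (i : S) (ρ i)) (chartFun (i : S) β) y :=
        Finset.sum_congr rfl fun i _ => hb.integral_eq_setIntegral_wedgeD hS ha hβ (hρs i)
          (hcl i) (hρc i) (hρ i)
    -- Integrals are taken in single charts only. Inserting `∑ ρ_j = 1` localizes each term in two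
    -- charts, so it can be moved from chart `i` to chart `j`. There the sum over `i` contains the
    -- factor `∑ dρ_i = 0`.
    _ = ∑ i : t, ∑ j : t, ∫ y in (extChartAt (𝓡∂ 2) (i : S)).target,
          chartFun (i : S) (fun p => ρ j p * a p) y
            * wedgeD (chartFun (i : S) (ρ i)) (chartFun (i : S) β) y := by
        refine Finset.sum_congr rfl fun i _ => ?_
        rw [← integral_finsetSum]
        · congr 1
          ext y
          rw [← Finset.sum_mul]
          congr 1
          simp only [chartFun, Function.comp]
          rw [← Finset.sum_mul, hsum, one_mul]
        · intro j _
          exact integrableOn_chartFun_mul_wedgeD ((hρs j).continuous.mul ha.continuous) (hρs i) hβ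
            (hρc i) (hρ i) fun p hp => Or.inr hp
    _ = ∑ i : t, ∑ j : t, ∫ y in (extChartAt (𝓡∂ 2) (j : S)).target,
          chartFun (j : S) (fun p => ρ j p * a p) y
            * wedgeD (chartFun (j : S) (ρ i)) (chartFun (j : S) β) y := by
        refine Finset.sum_congr rfl fun i _ => Finset.sum_congr rfl fun j _ => ?_
        refine setIntegral_wedgeD_chart_change hS (hρs i) hβ (fun p _ hp => ?_) fun p _ hp h => ?_
        · rw [image_eq_zero_of_notMem_tsupport fun h => hp (hρ j h), zero_mul]
        · exact hp (hρ i h)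
    _ = ∑ j : t, ∑ i : t, ∫ y in (extChartAt (𝓡∂ 2) (j : S)).target,
          chartFun (j : S) (fun p => ρ j p * a p) y
            * wedgeD (chartFun (j : S) (ρ i)) (chartFun (j : S) β) y := Finset.sum_comm
    _ = 0 := by
        refine Finset.sum_eq_zero fun j _ => ?_
        rw [← integral_finsetSum]
        · refine setIntegral_eq_zero_of_forall_eq_zero fun y hy => ?_
          rw [← Finset.mul_sum]
          have hD : ∑ i : t, fderivWithin ℝ (chartFun (j : S) (ρ i)) halfPlane y = 0 := by
            have h1 : HasFDerivWithinAt (fun z => ∑ i : t, chartFun (j : S) (ρ i) z)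
                (∑ i : t, fderivWithin ℝ (chartFun (j : S) (ρ i)) halfPlane y) halfPlane y :=
              HasFDerivWithinAt.fun_sum fun i _ =>
                (differentiableWithinAt_chartFun (hρs i) (j : S) hy).hasFDerivWithinAt
            have h2 : (fun z => ∑ i : t, chartFun (j : S) (ρ i) z) = fun _ => (1 : ℝ) :=
              funext fun z => hsum _
            rw [h2] at h1
            exact (uniqueDiffOn_halfPlane y (target_subset_halfPlane _ hy)).eq h1
              (hasFDerivWithinAt_const _ _ _)
          have h3 : ∑ i : t, wedgeD (chartFun (j : S) (ρ i)) (chartFun (j : S) β) y = 0 := by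
            simp only [wedgeD, Finset.sum_sub_distrib, ← Finset.sum_mul]
            rw [← sum_apply, ← sum_apply, hD]
            simp
          rw [h3, mul_zero]
        · intro i _
          refine integrableOn_chartFun_mul_wedgeD ((hρs j).continuous.mul ha.continuous) (hρs i) hβ
            (hρc j) (hρ j) fun p hp => Or.inl ?_
          rw [image_eq_zero_of_notMem_tsupport hp, zero_mul]

/-- A smooth loop of unit complex numbers has winding number zero if its angular form integrates
to zero. -/
theorem hasWindingNumber_zero_of_integral_eq_zero {u w : ℝ → ℝ} (hu : ContDiff ℝ ∞ u)
    (hw : ContDiff ℝ ∞ w) (hup : Function.Periodic u 1) (hwp : Function.Periodic w 1)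
    (h1 : ∀ θ, u θ ^ 2 + w θ ^ 2 = 1)
    (h : ∫ θ in (0 : ℝ)..1, (u θ * deriv w θ - w θ * deriv u θ) = 0) :
    HasWindingNumber (fun θ => (u θ : ℂ) + w θ * Complex.I) 0 := by
  set κ : ℝ → ℝ := fun θ => u θ * deriv w θ - w θ * deriv u θ with hκ
  have hud : Continuous (deriv u) := hu.continuous_deriv (by simp)
  have hwd : Continuous (deriv w) := hw.continuous_deriv (by simp)
  have hu' : ∀ θ, HasDerivAt u (deriv u θ) θ := fun θ =>
    (hu.differentiable (by simp) θ).hasDerivAt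
  have hw' : ∀ θ, HasDerivAt w (deriv w θ) θ := fun θ =>
    (hw.differentiable (by simp) θ).hasDerivAt
  have hκc : Continuous κ := by
    have := hu.continuous; have := hw.continuous; fun_prop
  have hκp : Function.Periodic κ 1 := by
    have d1 : Function.Periodic (deriv u) 1 := fun θ => by
      rw [← deriv_comp_add_const, show (fun x => u (x + 1)) = u from funext hup]
    have d2 : Function.Periodic (deriv w) 1 := fun θ => by
      rw [← deriv_comp_add_const, show (fun x => w (x + 1)) = w from funext hwp]
    intro θ
    simp only [hκ, hup θ, hwp θ, d1 θ, d2 θ]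
  -- The primitive of the angular form is the angle, up to a constant. It is periodic exactly
  -- because the integral over a period is zero.
  set Φ : ℝ → ℝ := fun θ => ∫ s in (0 : ℝ)..θ, κ s with hΦ
  have hΦd : ∀ θ, HasDerivAt Φ (κ θ) θ := fun θ =>
    intervalIntegral.integral_hasDerivAt_right (hκc.intervalIntegrable _ _)
      (hκc.stronglyMeasurableAtFilter _ _) hκc.continuousAt
  have hΦp : ∀ θ, Φ (θ + 1) = Φ θ := fun θ => by
    have e1 : Φ (θ + 1) = Φ θ + ∫ s in θ..(θ + 1), κ s := by
      simp only [hΦ]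
      rw [intervalIntegral.integral_add_adjacent_intervals] <;> exact hκc.intervalIntegrable _ _
    rw [e1, hκp.intervalIntegral_add_eq θ 0, zero_add, h, add_zero]
  set z : ℝ → ℂ := fun θ => (u θ : ℂ) + w θ * Complex.I with hz
  have hzn : ∀ θ, ‖z θ‖ = 1 := fun θ => by
    rw [hz, Complex.norm_add_mul_I, h1, Real.sqrt_one]
  have hlin : ∀ θ, u θ * deriv u θ + w θ * deriv w θ = 0 := fun θ => by
    have e1 : HasDerivAt (fun θ => u θ ^ 2 + w θ ^ 2)
        (2 * u θ * deriv u θ + 2 * w θ * deriv w θ) θ := by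
      refine (((hu' θ).fun_pow 2).fun_add ((hw' θ).fun_pow 2)).congr_deriv ?_
      push_cast; ring
    have e2 : (fun θ => u θ ^ 2 + w θ ^ 2) = fun _ => (1 : ℝ) := funext h1
    rw [e2] at e1
    have := e1.unique (hasDerivAt_const θ (1 : ℝ))
    linarith
  -- On the unit circle `z' = i κ z`, so multiplication by `exp (-iΦ)` freezes `z`.
  have hconst : ∀ θ, z θ * Complex.exp (-(Φ θ : ℂ) * Complex.I) = z 0 := by
    have hd : ∀ θ, HasDerivAt (fun θ => z θ * Complex.exp (-(Φ θ : ℂ) * Complex.I)) 0 θ := by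
      intro θ
      have e1 : HasDerivAt z (((deriv u θ : ℝ) : ℂ) + (deriv w θ : ℝ) * Complex.I) θ :=
        (hu' θ).ofReal_comp.fun_add ((hw' θ).ofReal_comp.mul_const _)
      have e2 : HasDerivAt (fun θ => -(Φ θ : ℂ) * Complex.I) (-(κ θ : ℂ) * Complex.I) θ :=
        (hΦd θ).ofReal_comp.neg.mul_const _
      have e3 := e1.mul e2.cexp
      refine e3.congr_deriv ?_
      have e4 : ((deriv u θ : ℝ) : ℂ) + (deriv w θ : ℝ) * Complex.I = z θ * ((κ θ : ℂ) * Complex.I) := by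
        have r1 := h1 θ
        have r2 := hlin θ
        simp only [hz, hκ]
        apply Complex.ext
        · simp
          linear_combination (-deriv u θ) * r1 + u θ * r2
        · simp
          linear_combination (-deriv w θ) * r1 + w θ * r2
      rw [e4]; ring
    intro θ
    have h2 : z θ * Complex.exp (-(Φ θ : ℂ) * Complex.I) =
        z 0 * Complex.exp (-(Φ 0 : ℂ) * Complex.I) := is_const_of_deriv_eq_zero (𝕜 := ℝ)
      (fun θ => (hd θ).differentiableAt) (fun θ => (hd θ).deriv) θ 0
    rw [h2]
    simp [hΦ]
  refine ⟨fun θ h0 => ?_, fun θ => Φ θ + (z 0).arg, ?_, fun θ => ?_, fun θ => ?_⟩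
  · have := hzn θ
    rw [show z θ = 0 from h0, norm_zero] at this
    exact zero_ne_one this
  · exact (continuous_iff_continuousAt.2 fun θ => (hΦd θ).continuousAt).add continuous_const
  · show z θ = (‖z θ‖ : ℂ) * _
    rw [hzn, Complex.ofReal_one, one_mul]
    have e1 : z 0 = Complex.exp ((z 0).arg * Complex.I) := by
      have := Complex.norm_mul_exp_arg_mul_I (z 0)
      rw [hzn, Complex.ofReal_one, one_mul] at this
      exact this.symm
    have e2 : z θ = z 0 * Complex.exp ((Φ θ : ℂ) * Complex.I) := by
      rw [← hconst θ, mul_assoc, ← Complex.exp_add]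
      simp
    rw [e2]
    nth_rw 1 [e1]
    rw [← Complex.exp_add]
    push_cast; ring_nf
  · simp only [hΦp]; push_cast; ring

/-- A nowhere zero function on a compact surface winds zero times around the boundary. -/
theorem IsBoundaryCurve.hasWindingNumber_zero [CompactSpace S] [T2Space S]
    (hS : IsOrientedAtlas (𝓡∂ 2) S) {b : ℝ → S} (hb : IsBoundaryCurve b) {G : S → ℂ}
    (hG : Continuous G) (hG0 : ∀ x, G x ≠ 0) : HasWindingNumber (fun θ => G (b θ)) 0 := by
  -- Stokes' theorem needs smoothness. An approximation with error less than `‖G‖` has no zeros, is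
  -- nowhere antiparallel to `G`, and can be normalized to unit length.
  obtain ⟨g, hg, -⟩ := hG.exists_contMDiff_approx (𝓡∂ 2) ⊤ hG.norm fun x => norm_pos_iff.2 (hG0 x)
  have hgs : ContMDiff (𝓡∂ 2) 𝓘(ℝ, ℂ) ∞ g := g.contMDiff
  have hg0 : ∀ x, g x ≠ 0 := fun x h => by
    have := hg x
    rw [h, dist_zero_left] at this
    exact lt_irrefl _ this
  have hre : ContMDiff (𝓡∂ 2) 𝓘(ℝ, ℝ) ∞ fun x => (g x).re :=
    Complex.reCLM.contDiff.contMDiff.comp hgs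
  have him : ContMDiff (𝓡∂ 2) 𝓘(ℝ, ℝ) ∞ fun x => (g x).im :=
    Complex.imCLM.contDiff.contMDiff.comp hgs
  set q : S → ℝ := fun x => (Real.sqrt ((g x).re ^ 2 + (g x).im ^ 2))⁻¹ with hq
  have hpos : ∀ x, 0 < (g x).re ^ 2 + (g x).im ^ 2 := fun x => by
    have h1 := Complex.normSq_pos.2 (hg0 x)
    rw [Complex.normSq_apply] at h1
    nlinarith
  have hqs : ContMDiff (𝓡∂ 2) 𝓘(ℝ, ℝ) ∞ q := by
    intro x
    have h1 : ContDiffAt ℝ ∞ (fun s : ℝ => (Real.sqrt s)⁻¹) ((g x).re ^ 2 + (g x).im ^ 2) :=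
      (Real.contDiffAt_sqrt (hpos x).ne').inv (Real.sqrt_pos.2 (hpos x)).ne'
    have h2 : ContMDiff (𝓡∂ 2) 𝓘(ℝ, ℝ) ∞ fun x => (g x).re ^ 2 + (g x).im ^ 2 :=
      (hre.pow 2).add (him.pow 2)
    exact ContMDiffAt.comp (g := fun s : ℝ => (Real.sqrt s)⁻¹)
      (f := fun x => (g x).re ^ 2 + (g x).im ^ 2) x h1.contMDiffAt (h2 x)
  set u : S → ℝ := fun x => (g x).re * q x with hu
  set w : S → ℝ := fun x => (g x).im * q x with hw
  have hus : ContMDiff (𝓡∂ 2) 𝓘(ℝ, ℝ) ∞ u := hre.mul hqs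
  have hws : ContMDiff (𝓡∂ 2) 𝓘(ℝ, ℝ) ∞ w := him.mul hqs
  have hqpos : ∀ x, 0 < q x := fun x => inv_pos.2 (Real.sqrt_pos.2 (hpos x))
  have hq2 : ∀ x, q x ^ 2 * ((g x).re ^ 2 + (g x).im ^ 2) = 1 := fun x => by
    simp only [hq]
    rw [inv_pow, Real.sq_sqrt (hpos x).le, inv_mul_cancel₀ (hpos x).ne']
  have h1 : ∀ x, u x ^ 2 + w x ^ 2 = 1 := fun x => by
    have := hq2 x
    simp only [hu, hw]
    linear_combination this
  -- `du ∧ dw = 0` as `u² + w² = 1`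
  have hcl : ∀ x, ∀ y ∈ (extChartAt (𝓡∂ 2) x).target,
      wedgeD (chartFun x u) (chartFun x w) y = 0 := by
    intro x y hy
    have hyu := uniqueDiffOn_halfPlane y (target_subset_halfPlane x hy)
    have e1 := ((differentiableWithinAt_chartFun hus x hy).hasFDerivWithinAt.pow 2).add
      ((differentiableWithinAt_chartFun hws x hy).hasFDerivWithinAt.pow 2)
    have e2 : ((fun z => chartFun x u z ^ 2) + fun z => chartFun x w z ^ 2) = fun _ => (1 : ℝ) :=
      funext fun z => h1 _
    rw [e2] at e1
    have e3 := hyu.eq e1 (hasFDerivWithinAt_const _ _ _)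
    have e4 : ∀ e : E2, chartFun x u y * fderivWithin ℝ (chartFun x u) halfPlane y e
        + chartFun x w y * fderivWithin ℝ (chartFun x w) halfPlane y e = 0 := fun e => by
      have := congrArg (fun L : E2 →L[ℝ] ℝ => L e) e3
      simp at this
      linarith
    have f1 := e4 !₂[1, 0]
    have f2 := e4 !₂[0, 1]
    have f3 : chartFun x u y ^ 2 + chartFun x w y ^ 2 = 1 := h1 _
    simp only [wedgeD]
    set A := fderivWithin ℝ (chartFun x u) halfPlane y !₂[1, 0]
    set B := fderivWithin ℝ (chartFun x u) halfPlane y !₂[0, 1]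
    set C := fderivWithin ℝ (chartFun x w) halfPlane y !₂[1, 0]
    set D := fderivWithin ℝ (chartFun x w) halfPlane y !₂[0, 1]
    set U := chartFun x u y
    set W := chartFun x w y
    linear_combination (-(A * D - B * C)) * f3 + (U * D - W * B) * f1 + (W * A - U * C) * f2
  have hcl' : ∀ x, ∀ y ∈ (extChartAt (𝓡∂ 2) x).target,
      wedgeD (chartFun x w) (chartFun x u) y = 0 := fun x y hy => by
    have := hcl x y hy
    simp only [wedgeD] at this ⊢
    linarith
  -- The angular form `u dw - w du` is a difference of two forms to which Stokes' theorem applies,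
  -- since `du ∧ dw = 0`.
  have i1 := hb.integral_eq_zero hS hus hws hcl
  have i2 := hb.integral_eq_zero hS hws hus hcl'
  have cu := hb.contDiff_comp hus
  have cw := hb.contDiff_comp hws
  have hwind : HasWindingNumber (fun θ => (((u ∘ b) θ : ℝ) : ℂ) + ((w ∘ b) θ : ℝ) * Complex.I) 0 := by
    refine hasWindingNumber_zero_of_integral_eq_zero cu cw
      (fun θ => by simp only [Function.comp, hb.periodic θ])
      (fun θ => by simp only [Function.comp, hb.periodic θ]) (fun θ => h1 _) ?_
    have c1 : Continuous fun θ => (u ∘ b) θ * deriv (w ∘ b) θ :=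
      cu.continuous.mul (cw.continuous_deriv (by simp))
    have c2 : Continuous fun θ => (w ∘ b) θ * deriv (u ∘ b) θ :=
      cw.continuous.mul (cu.continuous_deriv (by simp))
    rw [intervalIntegral.integral_sub (c1.intervalIntegrable _ _) (c2.intervalIntegrable _ _),
      intervalIntegral.integral_of_le zero_le_one, intervalIntegral.integral_of_le zero_le_one,
      ← integral_Ico_eq_integral_Ioc, ← integral_Ico_eq_integral_Ioc]
    simp only [Function.comp] at i1 i2 ⊢
    rw [i1, i2, sub_zero]
  have hbc := hb.smooth.continuous
  refine hwind.of_forall_add_ne ?_ (hG.comp hbc)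
    (fun θ => by simp only [Function.comp, hb.periodic θ])
    (fun θ => by simp only [hb.periodic θ]) fun θ k hk h0 => ?_
  · have e1 := cu.continuous
    have e2 := cw.continuous
    exact (Complex.continuous_ofReal.comp e1).add
      ((Complex.continuous_ofReal.comp e2).mul continuous_const)
  · have e1 : (((u ∘ b) θ : ℝ) : ℂ) + ((w ∘ b) θ : ℝ) * Complex.I = q (b θ) * g (b θ) := by
      simp only [Function.comp, hu, hw]
      apply Complex.ext <;> simp <;> ring
    rw [e1] at h0
    have e2 := hg (b θ)
    have e3 : g (b θ) - G (b θ) = ((1 + k * q (b θ) : ℝ) : ℂ) * g (b θ) := by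
      push_cast; linear_combination -h0
    have e4 : ‖G (b θ)‖ = k * q (b θ) * ‖g (b θ)‖ := by
      rw [show G (b θ) = ((-(k * q (b θ)) : ℝ) : ℂ) * g (b θ) by push_cast; linear_combination h0,
        norm_mul, Complex.norm_real, norm_neg,
        Real.norm_of_nonneg (mul_nonneg hk (hqpos _).le)]
    rw [dist_eq_norm, e3, e4, norm_mul, Complex.norm_real,
      Real.norm_of_nonneg (by have := mul_nonneg hk (hqpos (b θ)).le; linarith)] at e2
    nlinarith [norm_nonneg (g (b θ))]

end StokesTheorem


/-! ### Straightening an immersed half plane at a boundary point -/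

section AdaptedChart

/-- The projection of the plane onto the boundary of the half plane. -/
def boundaryProj : E2 →L[ℝ] E2 :=
  (EuclideanSpace.proj (𝕜 := ℝ) (1 : Fin 2)).smulRight (!₂[0, 1] : E2)

/-- The reflection of the plane in the boundary of the half plane. -/
def boundaryRefl : E2 →L[ℝ] E2 := (2 : ℝ) • boundaryProj - ContinuousLinearMap.id ℝ E2

theorem boundaryProj_apply (y : E2) : boundaryProj y = !₂[0, y 1] := by
  ext i; fin_cases i <;> simp [boundaryProj]

theorem boundaryRefl_apply (y : E2) : boundaryRefl y = !₂[-y 0, y 1] := by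
  ext i; fin_cases i <;> simp [boundaryRefl, boundaryProj_apply]
  ring

theorem boundaryProj_eq_self {y : E2} (h : y 0 = 0) : boundaryProj y = y := by
  rw [boundaryProj_apply]; ext i; fin_cases i <;> simp [h]

theorem boundaryRefl_eq_self {y : E2} (h : y 0 = 0) : boundaryRefl y = y := by
  rw [boundaryRefl_apply]; ext i; fin_cases i <;> simp [h]

variable {F : Type*} [NormedAddCommGroup F] [NormedSpace ℝ F]

theorem hasFDerivWithinAt_fderivWithin_halfPlane {f : E2 → F} {V : Set E2} (hV : IsOpen V)
    (hf : ContDiffOn ℝ 1 f (halfPlane ∩ V)) {y : E2} (hy : y ∈ halfPlane ∩ V) :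
    HasFDerivWithinAt f (fderivWithin ℝ f halfPlane y) halfPlane y := by
  have h1 := (hf.differentiableOn one_ne_zero y hy)
  rw [differentiableWithinAt_inter (hV.mem_nhds hy.2)] at h1
  exact h1.hasFDerivWithinAt

theorem continuousOn_fderivWithin_halfPlane {f : E2 → F} {V : Set E2} (hV : IsOpen V)
    (hf : ContDiffOn ℝ 1 f (halfPlane ∩ V)) :
    ContinuousOn (fderivWithin ℝ f halfPlane) (halfPlane ∩ V) := by
  refine (hf.continuousOn_fderivWithin (uniqueDiffOn_halfPlane.inter hV) le_rfl).congr
    fun y hy => ?_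
  rw [fderivWithin_inter (hV.mem_nhds hy.2)]

/-- A map of class `C¹` on the half plane extends across the boundary, by reflection. -/
theorem exists_contDiffAt_extension {f : E2 → F} {V : Set E2} (hV : IsOpen V)
    (hf : ContDiffOn ℝ 1 f (halfPlane ∩ V)) {y₀ : E2} (hy₀ : y₀ ∈ V) (h0 : y₀ 0 = 0) :
    ∃ g : E2 → F, ContDiffAt ℝ 1 g y₀ ∧ ∀ y ∈ halfPlane, g y = f y := by
  classical
  set D := fderivWithin ℝ f halfPlane with hD
  -- Reflection of second kind: on the boundary the value is `2f - f = f`, and the derivative is `D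
  -- ∘ (2 proj - refl) = D`. Both pieces match to first order.
  set g : E2 → F := fun y => if 0 ≤ y 0 then f y else
    (2 : ℝ) • f (boundaryProj y) - f (boundaryRefl y) with hg
  set g' : E2 → E2 →L[ℝ] F := fun y => if 0 ≤ y 0 then D y else
    (2 : ℝ) • (D (boundaryProj y)).comp boundaryProj - (D (boundaryRefl y)).comp boundaryRefl
    with hg'
  set V' : Set E2 := V ∩ boundaryProj ⁻¹' V ∩ boundaryRefl ⁻¹' V with hV'
  have hV'o : IsOpen V' := (hV.inter (hV.preimage boundaryProj.continuous)).inter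
    (hV.preimage boundaryRefl.continuous)
  set N : Set E2 := {y | y 0 ≤ 0} with hN
  have hNc : IsClosed N := isClosed_le (by fun_prop) continuous_const
  have hpH : ∀ y : E2, boundaryProj y ∈ halfPlane := fun y => by
    rw [boundaryProj_apply]; simp [halfPlane]
  have hrH : ∀ y ∈ N, boundaryRefl y ∈ halfPlane := fun y hy => by
    have : y 0 ≤ 0 := hy
    rw [boundaryRefl_apply]; simpa [halfPlane] using this
  have egH : ∀ y ∈ halfPlane, g y = f y := fun y hy => if_pos hy
  have egN : ∀ y ∈ N, g y = (2 : ℝ) • f (boundaryProj y) - f (boundaryRefl y) := fun y hy => by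
    by_cases h : 0 ≤ y 0
    · have h2 : y 0 = 0 := le_antisymm hy h
      rw [egH y h, boundaryProj_eq_self h2, boundaryRefl_eq_self h2, two_smul, add_sub_cancel_right]
    · exact if_neg h
  have egH' : ∀ y ∈ halfPlane, g' y = D y := fun y hy => if_pos hy
  have egN' : ∀ y ∈ N, g' y = (2 : ℝ) • (D (boundaryProj y)).comp boundaryProj
      - (D (boundaryRefl y)).comp boundaryRefl := fun y hy => by
    by_cases h : 0 ≤ y 0
    · have h2 : y 0 = 0 := le_antisymm hy h
      rw [egH' y h, boundaryProj_eq_self h2, boundaryRefl_eq_self h2]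
      ext w
      simp [boundaryRefl, two_smul]
    · exact if_neg h
  have hDer := fun {y} hy => hasFDerivWithinAt_fderivWithin_halfPlane hV hf (y := y) hy
  have hDc := continuousOn_fderivWithin_halfPlane hV hf
  have hmp : MapsTo boundaryProj (N ∩ V') (halfPlane ∩ V) := fun y hy => ⟨hpH y, hy.2.1.2⟩
  have hmr : MapsTo boundaryRefl (N ∩ V') (halfPlane ∩ V) := fun y hy => ⟨hrH y hy.1, hy.2.2⟩
  have dH : ∀ y ∈ halfPlane ∩ V', HasFDerivWithinAt g (g' y) halfPlane y := fun y hy => by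
    rw [egH' y hy.1]
    exact (hDer ⟨hy.1, hy.2.1.1⟩).congr egH (egH y hy.1)
  have dN : ∀ y ∈ N ∩ V', HasFDerivWithinAt g (g' y) N y := fun y hy => by
    rw [egN' y hy.1]
    refine HasFDerivWithinAt.congr ?_ egN (egN y hy.1)
    exact (((hDer (hmp hy)).comp y boundaryProj.hasFDerivWithinAt fun z _ => hpH z).const_smul
      (2 : ℝ)).fun_sub ((hDer (hmr hy)).comp y boundaryRefl.hasFDerivWithinAt hrH)
  have cov : ∀ y : E2, y ∈ halfPlane ∨ y ∈ N := fun y => le_total 0 (y 0)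
  refine ⟨g, contDiffAt_one_iff.2 ⟨g', V', hV'o.mem_nhds ⟨⟨hy₀, ?_⟩, ?_⟩, ?_, fun y hy => ?_⟩, egH⟩
  · rw [mem_preimage, boundaryProj_eq_self h0]; exact hy₀
  · rw [mem_preimage, boundaryRefl_eq_self h0]; exact hy₀
  · have c1 : ContinuousOn g' (halfPlane ∩ V') :=
      (hDc.mono fun y hy => ⟨hy.1, hy.2.1.1⟩).congr fun y hy => egH' y hy.1
    have c2 : ContinuousOn g' (N ∩ V') := by
      refine ContinuousOn.congr ?_ fun y hy => egN' y hy.1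
      exact (((hDc.comp boundaryProj.continuous.continuousOn hmp).clm_comp
        continuousOn_const).const_smul (2 : ℝ)).sub
        ((hDc.comp boundaryRefl.continuous.continuousOn hmr).clm_comp continuousOn_const)
    intro y hy
    have e : V' = (halfPlane ∩ V') ∪ (N ∩ V') := by
      rw [← union_inter_distrib_right, eq_comm]
      exact inter_eq_right.2 fun z _ => cov z
    rw [e]
    refine ContinuousWithinAt.union ?_ ?_
    · by_cases h : y ∈ halfPlane
      · exact c1 y ⟨h, hy⟩
      · refine continuousWithinAt_of_notMem_closure fun h' => h ?_
        exact isClosed_halfPlane.closure_subset (closure_mono inter_subset_left h')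
    · by_cases h : y ∈ N
      · exact c2 y ⟨h, hy⟩
      · refine continuousWithinAt_of_notMem_closure fun h' => h ?_
        exact hNc.closure_subset (closure_mono inter_subset_left h')
  · rw [← hasFDerivWithinAt_univ, show (univ : Set E2) = halfPlane ∪ N from
      (eq_univ_of_forall cov).symm]
    refine HasFDerivWithinAt.union ?_ ?_
    · by_cases h : y ∈ halfPlane
      · exact dH y ⟨h, hy⟩
      · exact HasFDerivWithinAt.of_notMem_closure fun h' => h (isClosed_halfPlane.closure_subset h')
    · by_cases h : y ∈ N
      · exact dN y ⟨h, hy⟩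
      · exact HasFDerivWithinAt.of_notMem_closure fun h' => h (hNc.closure_subset h')

theorem det3_add_smul_right (D : E2 →L[ℝ] E3) (w : E2) (z : ℝ) (c : E3) :
    det3 (D !₂[1, 0]) (D !₂[0, 1]) (D w + z • c) = z * det3 (D !₂[1, 0]) (D !₂[0, 1]) c := by
  rw [E2.eq_smul_add w]
  simp only [map_add, map_smul, det3_eq, PiLp.add_apply, PiLp.smul_apply, smul_eq_mul]
  ring

theorem det3_map_plane (D : E2 →L[ℝ] E3) (u v : E2) (c : E3) :
    det3 (D u) (D v) c = det2 u v * det3 (D !₂[1, 0]) (D !₂[0, 1]) c := by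
  rw [E2.eq_smul_add u, E2.eq_smul_add v]
  simp only [map_add, map_smul, det3_eq, det2_eq, PiLp.add_apply, PiLp.smul_apply, smul_eq_mul]
  simp
  ring

/-- The linear equivalence given by an injective linear map of the plane and a complementary
vector. -/
theorem exists_equiv_of_det3_ne_zero {D : E2 →L[ℝ] E3} {c : E3}
    (hc : det3 (D !₂[1, 0]) (D !₂[0, 1]) c ≠ 0) :
    ∃ e : (E2 × ℝ) ≃L[ℝ] E3, ∀ w z, e (w, z) = D w + z • c := by
  set T : E2 × ℝ →ₗ[ℝ] E3 := (D : E2 →ₗ[ℝ] E3).coprod (LinearMap.toSpanSingleton ℝ E3 c) with hT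
  have hTa : ∀ w z, T (w, z) = D w + z • c := fun w z => by simp [hT]
  have hinj : Function.Injective T := by
    rw [← LinearMap.ker_eq_bot, LinearMap.ker_eq_bot']
    rintro ⟨w, z⟩ h
    rw [hTa] at h
    have h1 := det3_add_smul_right D w z c
    rw [h] at h1
    have h2 : det3 (D !₂[1, 0]) (D !₂[0, 1]) 0 = 0 := by simp [det3_eq]
    rw [h2, eq_comm, mul_eq_zero] at h1
    have hz := h1.resolve_right hc
    rw [hz, zero_smul, add_zero] at h
    have h3 := det3_map_plane D w !₂[0, 1] c
    have h4 := det3_map_plane D !₂[1, 0] w c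
    rw [h] at h3 h4
    have h5 : ∀ v : E3, det3 0 v c = 0 := fun v => by simp [det3_eq]
    have h6 : ∀ v : E3, det3 v 0 c = 0 := fun v => by simp [det3_eq]
    rw [h5, eq_comm, mul_eq_zero, det2_eq] at h3
    rw [h6, eq_comm, mul_eq_zero, det2_eq] at h4
    have h7 := h3.resolve_right hc
    have h8 := h4.resolve_right hc
    simp at h7 h8
    rw [Prod.mk_eq_zero]
    refine ⟨?_, hz⟩
    ext i; fin_cases i <;> simp [h7, h8]
  refine ⟨(LinearEquiv.ofInjectiveOfFinrankEq T hinj (by simp)).toContinuousLinearEquiv,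
    fun w z => ?_⟩
  exact hTa w z

/-- Coordinates adapted to an immersed half plane at a boundary point. -/
theorem exists_adapted_chart {f : E2 → E3} {V : Set E2} (hV : IsOpen V)
    (hf : ContDiffOn ℝ 1 f (halfPlane ∩ V)) {y₀ : E2} (hy₀ : y₀ ∈ V) (h0 : y₀ 0 = 0)
    {D : E2 →L[ℝ] E3} (hD : HasFDerivWithinAt f D halfPlane y₀) {c : E3}
    (hc : det3 (D !₂[1, 0]) (D !₂[0, 1]) c ≠ 0) :
    ∃ Φ : E3 → E2 × ℝ, ContDiffAt ℝ 1 Φ (f y₀) ∧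
      (∀ᶠ y in 𝓝[halfPlane] y₀, Φ (f y) = (y, 0)) ∧
      (∀ᶠ P in 𝓝 (f y₀), 0 ≤ (Φ P).1 0 → P = f (Φ P).1 + (Φ P).2 • c) ∧
      ∀ w z, fderiv ℝ Φ (f y₀) (D w + z • c) = (w, z) := by
  obtain ⟨g, hg, hgf⟩ := exists_contDiffAt_extension hV hf hy₀ h0
  obtain ⟨e, he⟩ := exists_equiv_of_det3_ne_zero hc
  have hy₀H : y₀ ∈ halfPlane := h0.ge
  have hgD : HasFDerivAt g D y₀ := by
    have h1 : HasFDerivAt g (fderiv ℝ g y₀) y₀ :=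
      (hg.differentiableAt one_ne_zero).hasFDerivAt
    have h2 : HasFDerivWithinAt g D halfPlane y₀ := hD.congr hgf (hgf _ hy₀H)
    rwa [(uniqueDiffOn_halfPlane y₀ hy₀H).eq h1.hasFDerivWithinAt h2] at h1
  -- Extending `f` across the boundary makes the inverse function theorem applicable to the surface
  -- thickened in the direction `c`. The coordinates `Φ` are its local inverse.
  set G : E2 × ℝ → E3 := fun q => g q.1 + q.2 • c with hG
  have hGc : ContDiffAt ℝ 1 G (y₀, 0) :=
    (ContDiffAt.comp (y₀, (0 : ℝ)) hg contDiffAt_fst).add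
      (contDiffAt_snd.smul contDiffAt_const)
  have hGd : HasFDerivAt G (e : E2 × ℝ →L[ℝ] E3) (y₀, 0) := by
    have h1 : HasFDerivAt G (D.comp (ContinuousLinearMap.fst ℝ E2 ℝ)
        + (ContinuousLinearMap.snd ℝ E2 ℝ).smulRight c) (y₀, (0 : ℝ)) :=
      (HasFDerivAt.comp (y₀, (0 : ℝ)) (f := Prod.fst) hgD hasFDerivAt_fst).fun_add
        (hasFDerivAt_snd.smul_const c)
    refine h1.congr_fderiv ?_
    ext q <;> simp [he]
  have hG0 : G (y₀, 0) = f y₀ := by simp [hG, hgf _ hy₀H]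
  set e' := hGc.toOpenPartialHomeomorph G hGd one_ne_zero with he'
  set Φ : E3 → E2 × ℝ := hGc.localInverse hGd one_ne_zero with hΦ
  have hΦc : ContDiffAt ℝ 1 Φ (f y₀) := by
    have := hGc.to_localInverse hGd one_ne_zero
    rwa [hG0] at this
  have hsrc : (y₀, (0 : ℝ)) ∈ e'.source :=
    hGc.mem_toOpenPartialHomeomorph_source hGd one_ne_zero
  have hl : ∀ᶠ q in 𝓝 (y₀, (0 : ℝ)), Φ (G q) = q := e'.eventually_left_inverse hsrc
  have hr : ∀ᶠ P in 𝓝 (f y₀), G (Φ P) = P := by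
    have := e'.eventually_right_inverse (e'.map_source hsrc)
    rw [show e' (y₀, 0) = f y₀ from hG0] at this
    exact this
  refine ⟨Φ, hΦc, ?_, ?_, fun w z => ?_⟩
  · have h1 : Tendsto (fun y : E2 => (y, (0 : ℝ))) (𝓝[halfPlane] y₀) (𝓝 (y₀, 0)) :=
      (Continuous.tendsto' (by fun_prop) _ _ rfl).mono_left nhdsWithin_le_nhds
    filter_upwards [h1.eventually hl, self_mem_nhdsWithin] with y hy hyH
    rw [← hgf y hyH]
    simpa [hG] using hy
  · filter_upwards [hr] with P hP h
    rw [← hgf _ h]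
    exact hP.symm
  · have h1 : HasFDerivAt Φ (fderiv ℝ Φ (f y₀)) (G (y₀, 0)) := by
      rw [hG0]; exact (hΦc.differentiableAt one_ne_zero).hasFDerivAt
    have h2 := (h1.comp (y₀, (0 : ℝ)) hGd).unique
      ((hasFDerivAt_id (y₀, (0 : ℝ))).congr_of_eventuallyEq hl)
    have h3 := congrArg (fun L : E2 × ℝ →L[ℝ] E2 × ℝ => L (w, z)) h2
    simpa [he] using h3

end AdaptedChart


/-! ### Differentials in moving and in fixed charts -/

section CoordDeriv

variable {E E' E'' H H' H'' N N' N'' : Type*}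
  [NormedAddCommGroup E] [NormedSpace ℝ E] [TopologicalSpace H]
  (I : ModelWithCorners ℝ E H) [TopologicalSpace N] [ChartedSpace H N]
  [NormedAddCommGroup E'] [NormedSpace ℝ E'] [TopologicalSpace H']
  (I' : ModelWithCorners ℝ E' H') [TopologicalSpace N'] [ChartedSpace H' N']
  [NormedAddCommGroup E''] [NormedSpace ℝ E''] [TopologicalSpace H'']
  (I'' : ModelWithCorners ℝ E'' H'') [TopologicalSpace N''] [ChartedSpace H'' N'']

/-- The differential of a map between manifolds, as a linear map between the model spaces. -/
def coordDeriv (f : N → N') (x : N) : E →L[ℝ] E' := mfderiv I I' f x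

variable {I I' I''}

theorem hasFDerivWithinAt_coordDeriv {f : N → N'} {x : N} (hf : MDifferentiableAt I I' f x) :
    HasFDerivWithinAt (fun y => extChartAt I' (f x) (f ((extChartAt I x).symm y)))
      (coordDeriv I I' f x) (range I) (extChartAt I x x) :=
  hf.hasMFDerivAt.2

theorem coordDeriv_comp {g : N' → N''} {f : N → N'} {x : N}
    (hg : MDifferentiableAt I' I'' g (f x)) (hf : MDifferentiableAt I I' f x) :
    coordDeriv I I'' (g ∘ f) x = (coordDeriv I' I'' g (f x)).comp (coordDeriv I I' f x) :=
  mfderiv_comp x hg hf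

theorem Filter.EventuallyEq.coordDeriv_eq {f g : N → N'} {x : N} (h : f =ᶠ[𝓝 x] g) :
    coordDeriv I I' f x = coordDeriv I I' g x :=
  h.mfderiv_eq

theorem coordDeriv_const {x : N} (c : N') : coordDeriv I I' (fun _ : N => c) x = 0 :=
  mfderiv_const

theorem hasDerivAt_comp_coordDeriv {h : N' → ℝ} {c : ℝ → N'} {θ : ℝ}
    (hh : MDifferentiableAt I' 𝓘(ℝ, ℝ) h (c θ)) (hc : MDifferentiableAt 𝓘(ℝ, ℝ) I' c θ) :
    HasDerivAt (fun θ' => h (c θ')) (coordDeriv I' 𝓘(ℝ, ℝ) h (c θ) (curveVelocity I' c θ)) θ := by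
  have h1 := hasDerivAt_extChartAt_comp (I := 𝓘(ℝ, ℝ)) (hh.comp θ hc)
  have h2 : curveVelocity 𝓘(ℝ, ℝ) (h ∘ c) θ
      = coordDeriv I' 𝓘(ℝ, ℝ) h (c θ) (curveVelocity I' c θ) :=
    congrArg (fun L : ℝ →L[ℝ] ℝ => L 1) (coordDeriv_comp (I := 𝓘(ℝ, ℝ)) hh hc)
  rw [h2] at h1
  exact h1

theorem curveVelocity_comp {g : N' → N''} {c : ℝ → N'} {θ : ℝ}
    (hg : MDifferentiableAt I' I'' g (c θ)) (hc : MDifferentiableAt 𝓘(ℝ, ℝ) I' c θ) :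
    curveVelocity I'' (g ∘ c) θ = coordDeriv I' I'' g (c θ) (curveVelocity I' c θ) :=
  congrArg (fun L : ℝ →L[ℝ] E'' => L 1) (coordDeriv_comp (I := 𝓘(ℝ, ℝ)) hg hc)

variable [IsManifold I ∞ N] [IsManifold I' ∞ N']

/-- The differential in the preferred charts at `x₀` and `p₀`. -/
def localDeriv (I : ModelWithCorners ℝ E H) (I' : ModelWithCorners ℝ E' H') [IsManifold I 1 N]
    [IsManifold I' 1 N'] (f : N → N') (x₀ : N) (p₀ : N') (x : N) : E →L[ℝ] E' :=
  (tangentCoordChange I' (f x) p₀ (f x)).comp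
    ((coordDeriv I I' f x).comp (tangentCoordChange I x₀ x x))

/-- `coordDeriv` is read in preferred charts that change with the point, so it need not be
continuous. Continuity can be stated only for its version in fixed charts, here with both the map
and the point depending on a parameter. -/
theorem continuousAt_localDeriv {EZ HZ Z : Type*} [NormedAddCommGroup EZ] [NormedSpace ℝ EZ]
    [TopologicalSpace HZ] {J : ModelWithCorners ℝ EZ HZ} [TopologicalSpace Z] [ChartedSpace HZ Z]
    [IsManifold J ∞ Z]
    {f : Z → N → N'} {g : Z → N} {z₀ : Z}
    (hf : ContMDiffAt (J.prod I) I' 1 (Function.uncurry f) (z₀, g z₀)) (hg : Continuous g) :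
    ContinuousAt (fun z => localDeriv I I' (f z) (g z₀) (f z₀ (g z₀)) (g z)) z₀ := by
  have h1 := (ContMDiffAt.mfderiv (m := 0) f g hf (contMDiff_zero_iff.2 hg z₀)
    (zero_add _).le).continuousAt
  have h2 : ContinuousAt (fun z => f z (g z)) z₀ :=
    ContinuousAt.comp (f := fun z => (z, g z)) hf.continuousAt (continuousAt_id.prodMk hg.continuousAt)
  refine h1.congr ?_
  filter_upwards [hg.continuousAt.eventually ((chartAt H (g z₀)).open_source.mem_nhds (mem_chart_source H _)),
    h2.eventually ((chartAt H' (f z₀ (g z₀))).open_source.mem_nhds (mem_chart_source H' _))]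
    with z hz hz'
  exact inTangentCoordinates_eq _ _ _ hz hz'

theorem tangentCoordChange_model_space (x y z : H) : tangentCoordChange I x y z
    = ContinuousLinearMap.id ℝ E :=
  tangentBundleCore_coordChange_model_space x y z

theorem tangentCoordChange_comp_self {x y z : N} (hx : z ∈ (extChartAt I x).source)
    (hy : z ∈ (extChartAt I y).source) :
    (tangentCoordChange I x y z).comp (tangentCoordChange I y x z) = ContinuousLinearMap.id ℝ E := by
  ext v
  rw [ContinuousLinearMap.comp_apply, tangentCoordChange_comp ⟨⟨hy, hx⟩, hy⟩,
    tangentCoordChange_self hy]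
  rfl

theorem localDeriv_self {f : N → N'} {x : N} :
    localDeriv I I' f x (f x) x = coordDeriv I I' f x := by
  ext v
  simp only [localDeriv, ContinuousLinearMap.comp_apply]
  rw [tangentCoordChange_self (mem_extChartAt_source _),
    tangentCoordChange_self (mem_extChartAt_source _)]

theorem IsOrientedAtlas.det_tangentCoordChange_pos (h : IsOrientedAtlas I N) {x y z : N}
    (hx : z ∈ (extChartAt I x).source) (hy : z ∈ (extChartAt I y).source) :
    0 < (tangentCoordChange I x y z).det :=
  h _ (chart_mem_atlas H x) _ (chart_mem_atlas H y) z
    ⟨by rwa [extChartAt_source] at hx, by rwa [extChartAt_source] at hy⟩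

end CoordDeriv

/-! ### Coorientation of the surface by a function -/

section Coorientation

variable {M : Type*} [TopologicalSpace M] [ChartedSpace E3 M] [IsManifold 𝓘(ℝ, E3) ∞ M]
variable {S : Type*} [TopologicalSpace S] [ChartedSpace (EuclideanHalfSpace 2) S]
  [IsManifold (𝓡∂ 2) ∞ S]

/-- The differential of `h` at `f x` vanishes on the surface and is positive on the vectors on the
negative side of the surface. -/
def Coorients (h : M → ℝ) (f : S → M) (x : S) : Prop :=
  ∃ k > 0, ∀ w, coordDeriv 𝓘(ℝ, E3) 𝓘(ℝ, ℝ) h (f x) w =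
    -k * det3 (coordDeriv (𝓡∂ 2) 𝓘(ℝ, E3) f x !₂[1, 0]) (coordDeriv (𝓡∂ 2) 𝓘(ℝ, E3) f x !₂[0, 1]) w

/-- An injective linear map of the plane has a vector on the negative side of its image. -/
theorem exists_det3_neg {D : E2 →L[ℝ] E3} (hD : Function.Injective D) :
    ∃ c, det3 (D !₂[1, 0]) (D !₂[0, 1]) c < 0 := by
  set u := D !₂[1, 0] with hu
  set v := D !₂[0, 1] with hv
  have hne : ∀ a b : ℝ, a • u + b • v = 0 → a = 0 ∧ b = 0 := fun a b h => by
    have h1 : D !₂[a, b] = D 0 := by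
      rw [E2.eq_smul_add !₂[a, b], map_add, map_smul, map_smul, map_zero]
      simpa using h
    have h2 := hD h1
    exact ⟨congrArg (fun w : E2 => w 0) h2, congrArg (fun w : E2 => w 1) h2⟩
  set n : E3 := !₂[u 1 * v 2 - u 2 * v 1, u 2 * v 0 - u 0 * v 2, u 0 * v 1 - u 1 * v 0] with hn
  refine ⟨-n, ?_⟩
  have h1 : det3 u v (-n) = -((u 1 * v 2 - u 2 * v 1) ^ 2 + (u 2 * v 0 - u 0 * v 2) ^ 2
      + (u 0 * v 1 - u 1 * v 0) ^ 2) := by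
    simp [det3_eq, hn]
    ring
  rw [h1, neg_lt_zero]
  by_contra hle
  have a0 := sq_nonneg (u 1 * v 2 - u 2 * v 1)
  have a1 := sq_nonneg (u 2 * v 0 - u 0 * v 2)
  have a2 := sq_nonneg (u 0 * v 1 - u 1 * v 0)
  have b0 : u 1 * v 2 - u 2 * v 1 = 0 := pow_eq_zero_iff two_ne_zero |>.1 (by linarith)
  have b1 : u 2 * v 0 - u 0 * v 2 = 0 := pow_eq_zero_iff two_ne_zero |>.1 (by linarith)
  have b2 : u 0 * v 1 - u 1 * v 0 = 0 := pow_eq_zero_iff two_ne_zero |>.1 (by linarith)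
  have key : ∀ i : Fin 3, u i = 0 := fun i => by
    have := hne (v i) (-u i) (by
      ext j
      fin_cases i <;> fin_cases j <;> simp <;> linarith)
    linarith [this.2]
  have h2 := hne 1 0 (by ext j; simp [key])
  exact one_ne_zero h2.1

/-- A linear form that vanishes on a plane. -/
theorem exists_eq_neg_mul_det3 {l : E3 →L[ℝ] ℝ} {D : E2 →L[ℝ] E3} (h0 : ∀ w, l (D w) = 0) {c : E3}
    (hlc : 0 < l c) (hc : det3 (D !₂[1, 0]) (D !₂[0, 1]) c < 0) :
    ∃ k > 0, ∀ w, l w = -k * det3 (D !₂[1, 0]) (D !₂[0, 1]) w := by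
  obtain ⟨e, he⟩ := exists_equiv_of_det3_ne_zero hc.ne
  refine ⟨-(l c / det3 (D !₂[1, 0]) (D !₂[0, 1]) c), neg_pos.2 (div_neg_of_pos_of_neg hlc hc),
    fun w => ?_⟩
  obtain ⟨⟨u, z⟩, rfl⟩ := e.surjective w
  rw [he, map_add, h0, map_smul, det3_add_smul_right, smul_eq_mul]
  have := hc.ne
  field_simp
  ring

theorem coordDeriv_apply_coordDeriv_eq_zero {h : M → ℝ} {f : S → M} {x : S}
    (hh : ContMDiffAt 𝓘(ℝ, E3) 𝓘(ℝ, ℝ) 1 h (f x)) (hf : MDifferentiableAt (𝓡∂ 2) 𝓘(ℝ, E3) f x)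
    (h0 : ∀ᶠ x' in 𝓝 x, h (f x') = 0) (w : E2) :
    coordDeriv 𝓘(ℝ, E3) 𝓘(ℝ, ℝ) h (f x) (coordDeriv (𝓡∂ 2) 𝓘(ℝ, E3) f x w) = 0 := by
  have h1 := coordDeriv_comp (hh.mdifferentiableAt one_ne_zero) hf
  have h2 : coordDeriv (𝓡∂ 2) 𝓘(ℝ, ℝ) (h ∘ f) x = 0 := by
    rw [Filter.EventuallyEq.coordDeriv_eq (f := h ∘ f) (g := fun _ => (0 : ℝ)) h0,
      coordDeriv_const]
  rw [h2] at h1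
  exact (congrArg (fun L : E2 →L[ℝ] ℝ => L w) h1).symm

/-- Near `x₀` the form `dh` vanishes on the surface anyway, so it suffices that its value on one
complementary vector keeps its sign. This is an open condition in fixed charts. It passes to the
preferred charts at nearby points because both atlases are oriented. -/
theorem Coorients.eventually (hM : IsOrientedAtlas 𝓘(ℝ, E3) M) (hS : IsOrientedAtlas (𝓡∂ 2) S)
    {h : M → ℝ} {f : S → M} {x₀ : S} (hf : ContMDiff (𝓡∂ 2) 𝓘(ℝ, E3) ∞ f)
    (hh : ContMDiffAt 𝓘(ℝ, E3) 𝓘(ℝ, ℝ) 1 h (f x₀)) (h0 : ∀ᶠ x in 𝓝 x₀, h (f x) = 0)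
    (hfi : Function.Injective (coordDeriv (𝓡∂ 2) 𝓘(ℝ, E3) f x₀)) (hc : Coorients h f x₀) : ∀ᶠ x in 𝓝 x₀, Coorients h f x := by
  obtain ⟨k, hk, hkw⟩ := hc
  have hfc := hf.continuous
  have hhe : ∀ᶠ x in 𝓝 x₀, ContMDiffAt 𝓘(ℝ, E3) 𝓘(ℝ, ℝ) 1 h (f x) :=
    hfc.continuousAt.eventually ((contMDiffAt_iff_contMDiffAt_nhds (by simp)).1 hh)
  set D := coordDeriv (𝓡∂ 2) 𝓘(ℝ, E3) f x₀ with hD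
  set l := coordDeriv 𝓘(ℝ, E3) 𝓘(ℝ, ℝ) h (f x₀) with hl
  have hl0 := coordDeriv_apply_coordDeriv_eq_zero hh (hf.mdifferentiableAt (by simp)) h0
  set F : S → E2 →L[ℝ] E3 := localDeriv (𝓡∂ 2) 𝓘(ℝ, E3) f x₀ (f x₀) with hF
  have hFc : ContinuousAt F x₀ := continuousAt_localDeriv (J := 𝓡∂ 2) (f := fun _ => f) (g := id)
    (ContMDiffAt.comp (x₀, x₀) (g := f) (f := Prod.snd) (hf.of_le (by simp) x₀) contMDiffAt_snd)
    continuous_id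
  have hF0 : F x₀ = D := localDeriv_self
  set G : S → E3 →L[ℝ] ℝ := fun x => localDeriv 𝓘(ℝ, E3) 𝓘(ℝ, ℝ) h (f x₀) (h (f x₀)) (f x) with hG
  have hGc : ContinuousAt G x₀ := continuousAt_localDeriv (J := 𝓡∂ 2) (f := fun _ => h) (g := f)
    (ContMDiffAt.comp (x₀, f x₀) (g := h) (f := Prod.snd) hh contMDiffAt_snd) hfc
  have hG0 : G x₀ = l := localDeriv_self
  obtain ⟨c, hc2⟩ := exists_det3_neg hfi
  have hc1 : 0 < l c := by rw [hkw, neg_mul]; exact neg_pos.2 (mul_neg_of_pos_of_neg hk hc2)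
  have e1 : ∀ᶠ x in 𝓝 x₀, 0 < G x c := by
    refine (hGc.clm_apply continuousAt_const).eventually (lt_mem_nhds ?_)
    show 0 < G x₀ c
    rw [hG0]; exact hc1
  have e2 : ∀ᶠ x in 𝓝 x₀, det3 (F x !₂[1, 0]) (F x !₂[0, 1]) c < 0 := by
    have c1 : ∀ v : E2, ∀ i, ContinuousAt (fun x => F x v i) x₀ := fun v i =>
      (EuclideanSpace.proj (𝕜 := ℝ) (i : Fin 3)).continuous.continuousAt.comp
        (hFc.clm_apply continuousAt_const)
    have c2 : ContinuousAt (fun x => det3 (F x !₂[1, 0]) (F x !₂[0, 1]) c) x₀ := by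
      simp only [det3_eq]
      fun_prop
    refine c2.eventually (gt_mem_nhds ?_)
    show det3 (F x₀ !₂[1, 0]) (F x₀ !₂[0, 1]) c < 0
    rw [hF0]; exact hc2
  filter_upwards [e1, e2, hhe, h0.eventually_nhds, extChartAt_source_mem_nhds (I := 𝓡∂ 2) x₀,
    hfc.continuousAt.preimage_mem_nhds (extChartAt_source_mem_nhds (I := 𝓘(ℝ, E3)) (f x₀))]
    with x x1 x2 x3 x4 x5 x6
  set A := tangentCoordChange 𝓘(ℝ, E3) (f x) (f x₀) (f x)
  set A' := tangentCoordChange 𝓘(ℝ, E3) (f x₀) (f x) (f x)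
  set B := tangentCoordChange (𝓡∂ 2) x₀ x x
  set D' := coordDeriv (𝓡∂ 2) 𝓘(ℝ, E3) f x
  have hA : 0 < A.det := hM.det_tangentCoordChange_pos (mem_extChartAt_source _) x6
  have hB : 0 < B.det := hS.det_tangentCoordChange_pos x5 (mem_extChartAt_source _)
  have hAA' : ∀ v, A (A' v) = v := fun v =>
    congrArg (fun L : E3 →L[ℝ] E3 => L v)
      (tangentCoordChange_comp_self (I := 𝓘(ℝ, E3)) (mem_extChartAt_source (f x)) x6)
  have x7 : 0 < coordDeriv 𝓘(ℝ, E3) 𝓘(ℝ, ℝ) h (f x) (A' c) := by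
    have e : G x = (coordDeriv 𝓘(ℝ, E3) 𝓘(ℝ, ℝ) h (f x)).comp A' := by
      simp only [hG, localDeriv, tangentCoordChange_model_space, ContinuousLinearMap.id_comp]
      rfl
    rw [e] at x1
    exact x1
  refine exists_eq_neg_mul_det3 (coordDeriv_apply_coordDeriv_eq_zero x3
    (hf.mdifferentiableAt (by simp)) x4) x7 ?_
  have x8 : det3 (A (D' (B !₂[1, 0]))) (A (D' (B !₂[0, 1]))) (A (A' c)) < 0 := by
    rw [hAA']; exact x2
  rw [det3_map, det3_map_plane, ← det_eq_det2, ← mul_assoc] at x8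
  by_contra h9
  exact absurd x8 (not_lt.2 (mul_nonneg (mul_pos hA hB).le (not_lt.1 h9)))

end Coorientation


/-! ### A function defining the surface near its boundary -/

section DefiningFunction

variable {M : Type*} [TopologicalSpace M] [ChartedSpace E3 M] [IsManifold 𝓘(ℝ, E3) ∞ M]
variable {S : Type*} [TopologicalSpace S] [ChartedSpace (EuclideanHalfSpace 2) S]
  [IsManifold (𝓡∂ 2) ∞ S]

theorem hasFDerivAt_comp_extChartAt_symm {F : Type*} [NormedAddCommGroup F] [NormedSpace ℝ F]
    {h : M → F} {p : M} (hh : MDifferentiableAt 𝓘(ℝ, E3) 𝓘(ℝ, F) h p) :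
    HasFDerivAt (fun y => h ((extChartAt 𝓘(ℝ, E3) p).symm y)) (coordDeriv 𝓘(ℝ, E3) 𝓘(ℝ, F) h p)
      (extChartAt 𝓘(ℝ, E3) p p) := by
  have h1 := hasFDerivWithinAt_coordDeriv hh
  rw [modelWithCornersSelf_coe, range_id, hasFDerivWithinAt_univ] at h1
  exact h1

theorem contDiffAt_comp_extChartAt_symm {F : Type*} [NormedAddCommGroup F] [NormedSpace ℝ F]
    {h : M → F} {p : M} (hh : ContMDiffAt 𝓘(ℝ, E3) 𝓘(ℝ, F) 1 h p) :
    ContDiffAt ℝ 1 (fun y => h ((extChartAt 𝓘(ℝ, E3) p).symm y)) (extChartAt 𝓘(ℝ, E3) p p) := by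
  have h1 := (contMDiffAt_iff.1 hh).2
  rw [modelWithCornersSelf_coe, range_id, contDiffWithinAt_univ] at h1
  exact h1

/-- The map `f` in the preferred charts at `x₀` and `f x₀`. -/
def localMap (f : S → M) (x₀ : S) (y : E2) : E3 :=
  extChartAt 𝓘(ℝ, E3) (f x₀) (f ((extChartAt (𝓡∂ 2) x₀).symm y))

theorem exists_contDiffOn_localMap {f : S → M} (hf : ContMDiff (𝓡∂ 2) 𝓘(ℝ, E3) ∞ f) (x₀ : S) :
    ∃ V, IsOpen V ∧ extChartAt (𝓡∂ 2) x₀ x₀ ∈ V ∧ halfPlane ∩ V ⊆ (extChartAt (𝓡∂ 2) x₀).target ∧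
      (∀ y ∈ halfPlane ∩ V,
        f ((extChartAt (𝓡∂ 2) x₀).symm y) ∈ (extChartAt 𝓘(ℝ, E3) (f x₀)).source) ∧
      ContDiffOn ℝ ∞ (localMap f x₀) (halfPlane ∩ V) := by
  obtain ⟨V₁, hV₁, hT⟩ := exists_isOpen_target_eq x₀
  have hc : ContinuousOn (fun y => f ((extChartAt (𝓡∂ 2) x₀).symm y))
      (extChartAt (𝓡∂ 2) x₀).target :=
    hf.continuous.comp_continuousOn (continuousOn_extChartAt_symm x₀)
  obtain ⟨V₂, hV₂, h2⟩ := continuousOn_iff'.1 hc _ (isOpen_extChartAt_source (I := 𝓘(ℝ, E3)) (f x₀))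
  have hx : extChartAt (𝓡∂ 2) x₀ x₀ ∈ (extChartAt (𝓡∂ 2) x₀).target := mem_extChartAt_target x₀
  have hsub : halfPlane ∩ (V₁ ∩ V₂) ⊆ (extChartAt (𝓡∂ 2) x₀).target := by
    rw [hT]; exact fun y hy => ⟨hy.1, hy.2.1⟩
  have hmaps : ∀ y ∈ halfPlane ∩ (V₁ ∩ V₂),
      f ((extChartAt (𝓡∂ 2) x₀).symm y) ∈ (extChartAt 𝓘(ℝ, E3) (f x₀)).source := fun y hy => by
    have : y ∈ V₂ ∩ (extChartAt (𝓡∂ 2) x₀).target := ⟨hy.2.2, hsub hy⟩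
    rw [← h2] at this
    exact this.1
  refine ⟨V₁ ∩ V₂, hV₁.inter hV₂, ⟨?_, ?_⟩, hsub, hmaps, ?_⟩
  · rw [hT] at hx; exact hx.2
  · have : extChartAt (𝓡∂ 2) x₀ x₀ ∈ (fun y => f ((extChartAt (𝓡∂ 2) x₀).symm y)) ⁻¹'
        (extChartAt 𝓘(ℝ, E3) (f x₀)).source ∩ (extChartAt (𝓡∂ 2) x₀).target := by
      refine ⟨?_, hx⟩
      rw [mem_preimage, extChartAt_to_inv]
      exact mem_extChartAt_source _
    rw [h2] at this
    exact this.1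
  · refine contMDiffOn_iff_contDiffOn.1 ?_
    refine (contMDiffOn_extChartAt (x := f x₀)).comp
      (hf.comp_contMDiffOn ((contMDiffOn_extChartAt_symm x₀).mono hsub)) fun y hy => ?_
    have := hmaps y hy
    rwa [extChartAt_source] at this

/-- Coordinates of `M` in which the surface is a half plane, near a boundary point. -/
theorem exists_surface_coordinates {f : S → M} (hf : ContMDiff (𝓡∂ 2) 𝓘(ℝ, E3) ∞ f) {x₀ : S}
    (hx₀ : extChartAt (𝓡∂ 2) x₀ x₀ 0 = 0) {c : E3}
    (hc : det3 (coordDeriv (𝓡∂ 2) 𝓘(ℝ, E3) f x₀ !₂[1, 0])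
      (coordDeriv (𝓡∂ 2) 𝓘(ℝ, E3) f x₀ !₂[0, 1]) c < 0) :
    ∃ Ψ : M → E2 × ℝ, ContMDiffAt 𝓘(ℝ, E3) 𝓘(ℝ, E2 × ℝ) 1 Ψ (f x₀) ∧
      (∀ᶠ x in 𝓝 x₀, Ψ (f x) = (extChartAt (𝓡∂ 2) x₀ x, 0)) ∧
      (∀ w z, coordDeriv 𝓘(ℝ, E3) 𝓘(ℝ, E2 × ℝ) Ψ (f x₀)
        (coordDeriv (𝓡∂ 2) 𝓘(ℝ, E3) f x₀ w + z • c) = (w, z)) ∧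
      ∀ h : M → ℝ, ContMDiffAt 𝓘(ℝ, E3) 𝓘(ℝ, ℝ) 1 h (f x₀) → (∀ x, h (f x) = 0) →
        Coorients h f x₀ → ∀ᶠ P in 𝓝 (f x₀), h P = 0 → 0 ≤ (Ψ P).1 0 → P ∈ range f := by
  obtain ⟨V, hV, hxV, hVT, hVs, hVc⟩ := exists_contDiffOn_localMap hf x₀
  set D := coordDeriv (𝓡∂ 2) 𝓘(ℝ, E3) f x₀ with hDdef
  set y₀ := extChartAt (𝓡∂ 2) x₀ x₀ with hy₀
  set ψ := extChartAt 𝓘(ℝ, E3) (f x₀) with hψ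
  have hD : HasFDerivWithinAt (localMap f x₀) D halfPlane y₀ := by
    rw [← range_model_eq]
    exact hasFDerivWithinAt_coordDeriv (hf.mdifferentiableAt (by simp))
  obtain ⟨Φ, hΦc, hΦl, hΦr, hΦd⟩ := exists_adapted_chart hV (hVc.of_le (by simp)) hxV hx₀ hD hc.ne
  have hf0 : localMap f x₀ y₀ = ψ (f x₀) := by rw [localMap, hy₀, extChartAt_to_inv]
  rw [hf0] at hΦc hΦr hΦd
  set Ψ : M → E2 × ℝ := fun P => Φ (ψ P) with hΨ
  have hψc : ContMDiffAt 𝓘(ℝ, E3) 𝓘(ℝ, E3) 1 ψ (f x₀) := contMDiffAt_extChartAt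
  have hψt : Tendsto ψ (𝓝 (f x₀)) (𝓝 (ψ (f x₀))) := hψc.continuousAt
  have hΨc : ContMDiffAt 𝓘(ℝ, E3) 𝓘(ℝ, E2 × ℝ) 1 Ψ (f x₀) :=
    ContMDiffAt.comp (f x₀) hΦc.contMDiffAt hψc
  have hΦ0 : Φ (ψ (f x₀)) = (y₀, 0) := by
    rw [← hf0]; exact hΦl.self_of_nhdsWithin hx₀.ge
  have hφt : Tendsto (extChartAt (𝓡∂ 2) x₀) (𝓝 x₀) (𝓝[halfPlane] y₀) := by
    refine tendsto_nhdsWithin_iff.2 ⟨continuousAt_extChartAt x₀, ?_⟩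
    filter_upwards [extChartAt_source_mem_nhds (I := 𝓡∂ 2) x₀] with x hx
    exact target_subset_halfPlane x₀ ((extChartAt (𝓡∂ 2) x₀).map_source hx)
  refine ⟨Ψ, hΨc, ?_, fun w z => ?_, fun h hh h0 hco => ?_⟩
  · filter_upwards [hφt.eventually hΦl, extChartAt_source_mem_nhds (I := 𝓡∂ 2) x₀] with x hx hxs
    rw [localMap, (extChartAt (𝓡∂ 2) x₀).left_inv hxs] at hx
    exact hx
  · have h1 := hasFDerivAt_comp_extChartAt_symm (hΨc.mdifferentiableAt one_ne_zero)
    have h2 : (fun y => Ψ (ψ.symm y)) =ᶠ[𝓝 (ψ (f x₀))] Φ := by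
      filter_upwards [extChartAt_target_mem_nhds (I := 𝓘(ℝ, E3)) (f x₀)] with y hy
      simp only [hΨ]
      rw [ψ.right_inv hy]
    rw [(h1.congr_of_eventuallyEq h2.symm).fderiv.symm]
    exact hΦd w z
  · set g : E3 → ℝ := fun y => h (ψ.symm y) with hg
    set l := coordDeriv 𝓘(ℝ, E3) 𝓘(ℝ, ℝ) h (f x₀) with hl
    have hlc : 0 < l c := by
      obtain ⟨k, hk, hkw⟩ := hco
      rw [hkw, neg_mul]
      exact neg_pos.2 (mul_neg_of_pos_of_neg hk hc)
    have hgs : HasStrictFDerivAt g l (ψ (f x₀)) :=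
      (contDiffAt_comp_extChartAt_symm hh).hasStrictFDerivAt'
        (hasFDerivAt_comp_extChartAt_symm (hh.mdifferentiableAt one_ne_zero)) one_ne_zero
    have hΦt : Tendsto Φ (𝓝 (ψ (f x₀))) (𝓝 (y₀, 0)) := hΦ0 ▸ hΦc.continuousAt.tendsto
    have hQ : Tendsto (fun P => (P, P - (Φ P).2 • c)) (𝓝 (ψ (f x₀)))
        (𝓝 (ψ (f x₀), ψ (f x₀))) := by
      refine Tendsto.prodMk_nhds tendsto_id ?_
      have h2 : Tendsto (fun P => (Φ P).2) (𝓝 (ψ (f x₀))) (𝓝 0) :=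
        (continuous_snd.tendsto _).comp hΦt
      simpa using tendsto_id.sub (h2.smul_const c)
    -- Near the boundary point, `P` and the surface point `q` with the same plane coordinates differ
    -- by a multiple of `c`, and `h` vanishes at both. Strict differentiability with an error
    -- constant `ε` such that `ε ‖c‖ < dh(c)` excludes this unless `P = q`.
    have hε : 0 < l c / (2 * (‖c‖ + 1)) := by positivity
    have hlo := hgs.isLittleO.def hε
    have hV1 : ∀ᶠ P in 𝓝 (ψ (f x₀)), (Φ P).1 ∈ V :=
      ((continuous_fst.tendsto _).comp hΦt).eventually (hV.mem_nhds hxV)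
    filter_upwards [hψt.eventually (hQ.eventually hlo), hψt.eventually hΦr, hψt.eventually hV1,
      extChartAt_source_mem_nhds (I := 𝓘(ℝ, E3)) (f x₀)] with P h1 h2 h3 h4 h5 h6
    have h7 := h2 h6
    have hmem : (Φ (ψ P)).1 ∈ halfPlane ∩ V := ⟨h6, h3⟩
    set q := f ((extChartAt (𝓡∂ 2) x₀).symm (Φ (ψ P)).1) with hq
    have hqs : q ∈ ψ.source := hVs _ hmem
    have h8 : ψ P - (Φ (ψ P)).2 • c = ψ q := by
      rw [sub_eq_iff_eq_add]; exact h7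
    rw [h8] at h1
    have e1 : g (ψ P) = 0 := by simp only [hg]; rw [ψ.left_inv h4, h5]
    have e2 : g (ψ q) = 0 := by simp only [hg]; rw [ψ.left_inv hqs, hq, h0]
    have e3 : ψ P - ψ q = (Φ (ψ P)).2 • c := by rw [← h8]; abel
    rw [e1, e2, e3, map_smul, sub_zero, zero_sub, norm_neg, norm_smul, norm_smul,
      Real.norm_of_nonneg hlc.le] at h1
    have hz : (Φ (ψ P)).2 = 0 := by
      by_contra hne
      have hp : 0 < ‖(Φ (ψ P)).2‖ := norm_pos_iff.2 hne
      have h9 : l c ≤ l c / (2 * (‖c‖ + 1)) * ‖c‖ := by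
        refine le_of_mul_le_mul_left ?_ hp
        linarith
      have h10 : l c / (2 * (‖c‖ + 1)) * ‖c‖ < l c := by
        rw [div_mul_eq_mul_div, div_lt_iff₀ (by positivity)]
        nlinarith [norm_nonneg c]
      linarith
    rw [hz, zero_smul, sub_eq_zero] at e3
    exact ⟨_, (ψ.injOn h4 hqs e3).symm⟩

/-- An injective continuous map from a compact space to a Hausdorff space is an embedding: surface
points close to `f x₀` in `M` come from points close to `x₀` in `S`. So no other sheet of the
surface comes near. -/
theorem eventually_of_eventually_comp [CompactSpace S] [T2Space M] {f : S → M} (hf : Continuous f)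
    (hinj : Function.Injective f) {x₀ : S} {p : S → Prop} (h : ∀ᶠ x in 𝓝 x₀, p x) :
    ∀ᶠ P in 𝓝 (f x₀), ∀ x, f x = P → p x := by
  rw [(hf.isClosedEmbedding hinj).isInducing.nhds_eq_comap, eventually_comap] at h
  filter_upwards [h] with P hP x hx using hP x hx

/-- The transverse coordinate of the straightening chart works. The statement quantifies over all
`x` with `f x ∈ U`, so that a partition of unity on `M` can glue such functions. -/
theorem exists_local_coorienting [CompactSpace S] [T2Space M] (hM : IsOrientedAtlas 𝓘(ℝ, E3) M)
    (hS : IsOrientedAtlas (𝓡∂ 2) S) {f : S → M} (hf : ContMDiff (𝓡∂ 2) 𝓘(ℝ, E3) ∞ f)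
    (hinj : Function.Injective f) {x₀ : S}
    (himm : Function.Injective (coordDeriv (𝓡∂ 2) 𝓘(ℝ, E3) f x₀))
    (hx₀ : extChartAt (𝓡∂ 2) x₀ x₀ 0 = 0) :
    ∃ U, IsOpen U ∧ f x₀ ∈ U ∧ ∃ k : M → ℝ, ContMDiffOn 𝓘(ℝ, E3) 𝓘(ℝ, ℝ) 1 k U ∧
      ∀ x, f x ∈ U → k (f x) = 0 ∧ Coorients k f x := by
  obtain ⟨c, hc⟩ := exists_det3_neg himm
  obtain ⟨Ψ, hΨ, hΨ0, hΨd, -⟩ := exists_surface_coordinates hf hx₀ hc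
  set k : M → ℝ := fun P => (Ψ P).2 with hk
  have hkc : ContMDiffAt 𝓘(ℝ, E3) 𝓘(ℝ, ℝ) 1 k (f x₀) :=
    ContMDiffAt.comp (f x₀) (contDiff_snd.contMDiff (Ψ (f x₀))) hΨ
  have h0 : ∀ᶠ x in 𝓝 x₀, k (f x) = 0 := by
    filter_upwards [hΨ0] with x hx
    simp only [hk, hx]
  have hkd : coordDeriv 𝓘(ℝ, E3) 𝓘(ℝ, ℝ) k (f x₀) c = 1 := by
    have h1 := hasFDerivAt_comp_extChartAt_symm (hΨ.mdifferentiableAt one_ne_zero)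
    have h2 := hasFDerivAt_comp_extChartAt_symm (hkc.mdifferentiableAt one_ne_zero)
    rw [h2.unique h1.snd]
    have h3 := hΨd 0 1
    rw [map_zero, zero_add, one_smul] at h3
    rw [ContinuousLinearMap.comp_apply, h3]
    rfl
  have hco : Coorients k f x₀ := exists_eq_neg_mul_det3
    (coordDeriv_apply_coordDeriv_eq_zero hkc (hf.mdifferentiableAt (by simp)) h0)
    (hkd.symm ▸ one_pos) hc
  have hev := eventually_of_eventually_comp hf.continuous hinj
    (h0.and (hco.eventually hM hS hf hkc h0 himm))
  obtain ⟨U, hU, hUo, hUx⟩ := eventually_nhds_iff.1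
    (hev.and ((contMDiffAt_iff_contMDiffAt_nhds (by simp)).1 hkc))
  exact ⟨U, hUo, hUx, k, fun P hP => (hU P hP).2.contMDiffWithinAt,
    fun x hx => (hU _ hx).1 x rfl⟩

/-- A function that vanishes on the surface and defines it transversally along its boundary. -/
theorem IsBoundaryCurve.exists_coorienting [CompactSpace S] [T2Space M] [SecondCountableTopology M]
    (hM : IsOrientedAtlas 𝓘(ℝ, E3) M) (hS : IsOrientedAtlas (𝓡∂ 2) S) {f : S → M}
    (hf : ContMDiff (𝓡∂ 2) 𝓘(ℝ, E3) ∞ f) (hinj : Function.Injective f)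
    (himm : ∀ x, Function.Injective (coordDeriv (𝓡∂ 2) 𝓘(ℝ, E3) f x)) {b : ℝ → S}
    (hb : IsBoundaryCurve b) :
    ∃ h : M → ℝ, ContMDiff 𝓘(ℝ, E3) 𝓘(ℝ, ℝ) 1 h ∧ (∀ x, h (f x) = 0) ∧
      ∀ θ, Coorients h f (b θ) := by
  have hbd : ∀ θ, extChartAt (𝓡∂ 2) (b θ) (b θ) 0 = 0 := fun θ =>
    (mem_boundary_iff (mem_extChartAt_source (b θ))).1 (hb.range_eq ▸ mem_range_self θ)
  choose U hUo hUx k hkc hk using fun θ : ℝ =>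
    exists_local_coorienting hM hS hf hinj (himm (b θ)) (hbd θ)
  have hbc := hb.smooth.continuous
  have hKc : IsClosed ((fun θ => f (b θ)) '' Icc 0 1) :=
    (isCompact_Icc.image (hf.continuous.comp hbc)).isClosed
  have : LocallyCompactSpace M := ChartedSpace.locallyCompactSpace E3 M
  obtain ⟨ρ, hρ⟩ := SmoothPartitionOfUnity.exists_isSubordinate 𝓘(ℝ, E3) hKc U hUo (by
    rintro _ ⟨θ, -, rfl⟩
    exact mem_iUnion.2 ⟨θ, hUx θ⟩)
  set h : M → ℝ := fun P => ∑ᶠ i, ρ i P • k i P with hh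
  have hhc : ContMDiff 𝓘(ℝ, E3) 𝓘(ℝ, ℝ) 1 h := hρ.contMDiff_finsum_smul hUo hkc
  have hρk : ∀ i x, ρ i (f x) • k i (f x) = 0 := fun i x => by
    by_cases hx : f x ∈ U i
    · rw [(hk i x hx).1, smul_zero]
    · rw [image_eq_zero_of_notMem_tsupport fun h' => hx (hρ i h'), zero_smul]
  refine ⟨h, hhc, fun x => ?_, fun θ => ?_⟩
  · simp only [hh, hρk, finsum_zero]
  obtain ⟨θ', hθ', hbθ⟩ := hb.exists_mem_Ico (hb.range_eq ▸ mem_range_self θ)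
  set p := f (b θ) with hp
  have hpK : p ∈ (fun θ => f (b θ)) '' Icc 0 1 := ⟨θ', Ico_subset_Icc_self hθ', by simp only [hbθ, hp]⟩
  set J := ρ.fintsupport p with hJ
  have hJU : ∀ i ∈ J, p ∈ U i := fun i hi => hρ i ((ρ.mem_fintsupport_iff p i).1 hi)
  have hsupp : ∀ᶠ P in 𝓝 p, h P = ∑ i ∈ J, ρ i P * k i P := by
    filter_upwards [ρ.eventually_finsupport_subset p] with P hP
    simp only [hh, smul_eq_mul]
    refine finsum_eq_sum_of_support_subset _ fun i hi => ?_
    refine hP ((ρ.mem_finsupport P).2 fun h0 => hi ?_)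
    simp only [h0, zero_mul]
  have hsum : ∑ i ∈ J, ρ i p = 1 :=
    ρ.sum_finsupport' p hpK (ρ.finsupport_subset_fintsupport p)
  have hex : ∀ i, ∃ a > 0, i ∈ J → ∀ w, coordDeriv 𝓘(ℝ, E3) 𝓘(ℝ, ℝ) (k i) p w =
    -a * det3 (coordDeriv (𝓡∂ 2) 𝓘(ℝ, E3) f (b θ) !₂[1, 0])
      (coordDeriv (𝓡∂ 2) 𝓘(ℝ, E3) f (b θ) !₂[0, 1]) w := fun i => by
    by_cases hi : i ∈ J
    · obtain ⟨a, ha, h1⟩ := (hk i _ (hJU i hi)).2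
      exact ⟨a, ha, fun _ => h1⟩
    · exact ⟨1, one_pos, fun h' => absurd h' hi⟩
  choose a ha hadk using hex
  -- The local functions vanish on the surface, so the derivatives of the weights do not contribute.
  -- Then `dh` is a convex combination of forms that coorient the surface.
  have hder : coordDeriv 𝓘(ℝ, E3) 𝓘(ℝ, ℝ) h p
      = ∑ i ∈ J, ρ i p • coordDeriv 𝓘(ℝ, E3) 𝓘(ℝ, ℝ) (k i) p := by
    have h1 := hasFDerivAt_comp_extChartAt_symm ((hhc p).mdifferentiableAt one_ne_zero)
    have h2 : HasFDerivAt (fun y => ∑ i ∈ J, ρ i ((extChartAt 𝓘(ℝ, E3) p).symm y)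
        * k i ((extChartAt 𝓘(ℝ, E3) p).symm y))
        (∑ i ∈ J, ρ i p • coordDeriv 𝓘(ℝ, E3) 𝓘(ℝ, ℝ) (k i) p) (extChartAt 𝓘(ℝ, E3) p p) := by
      refine HasFDerivAt.fun_sum fun i hi => ?_
      have h3 := hasFDerivAt_comp_extChartAt_symm
        (((ρ i).contMDiff p).mdifferentiableAt (by simp))
      have h4 := hasFDerivAt_comp_extChartAt_symm
        (((hkc i).contMDiffAt ((hUo i).mem_nhds (hJU i hi))).mdifferentiableAt one_ne_zero)
      refine (h3.mul h4).congr_fderiv ?_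
      rw [extChartAt_to_inv, (hk i _ (hJU i hi)).1, zero_smul, add_zero]
    refine h1.unique (h2.congr_of_eventuallyEq ?_)
    have h5 := continuousAt_extChartAt_symm (I := 𝓘(ℝ, E3)) p
    rw [ContinuousAt, extChartAt_to_inv] at h5
    exact h5.eventually hsupp
  refine ⟨∑ i ∈ J, ρ i p * a i, ?_, fun w => ?_⟩
  · have hnn : ∀ i ∈ J, 0 ≤ ρ i p * a i := fun i _ => mul_nonneg (ρ.nonneg i p) (ha i).le
    refine lt_of_le_of_ne (Finset.sum_nonneg hnn) fun h0 => ?_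
    have h1 := (Finset.sum_eq_zero_iff_of_nonneg hnn).1 h0.symm
    rw [Finset.sum_eq_zero fun i hi => (mul_eq_zero.1 (h1 i hi)).resolve_right (ha i).ne'] at hsum
    exact zero_ne_one hsum
  · rw [hder, sum_apply, ← Finset.sum_neg_distrib, Finset.sum_mul]
    refine Finset.sum_congr rfl fun i hi => ?_
    rw [smul_apply, hadk i hi, smul_eq_mul]
    ring

end DefiningFunction


/-! ### Linking number of a push-off as a winding number -/

section SelfLinking

/-- Blow-up along `u = 0`: strict differentiability compares `G (θ, u)` with `G (θ, 0) = 0`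
uniformly for `θ` near `θ₀`, so the limit is joint in both variables. -/
theorem tendsto_div_snd_of_contDiffAt {G : ℝ × ℝ → ℝ} {θ₀ m : ℝ} (hG : ContDiffAt ℝ 1 G (θ₀, 0))
    (h0 : ∀ᶠ θ in 𝓝 θ₀, G (θ, 0) = 0) (hm : HasDerivAt (fun u => G (θ₀, u)) m 0) :
    Tendsto (fun z : ℝ × ℝ => G z / z.2) (𝓝 θ₀ ×ˢ 𝓝[>] 0) (𝓝 m) := by
  set L := fderiv ℝ G (θ₀, 0) with hL
  have hs : HasStrictFDerivAt G L (θ₀, 0) := hG.hasStrictFDerivAt one_ne_zero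
  have hLm : L (0, 1) = m := by
    have h1 : HasDerivAt (fun u : ℝ => (θ₀, u)) ((0 : ℝ), (1 : ℝ)) 0 :=
      (hasDerivAt_const (0 : ℝ) θ₀).prodMk (hasDerivAt_id (0 : ℝ))
    exact (hs.hasFDerivAt.comp_hasDerivAt (0 : ℝ) h1).unique hm
  have hle : 𝓝 θ₀ ×ˢ 𝓝[>] (0 : ℝ) ≤ 𝓝 (θ₀, 0) := by
    rw [nhds_prod_eq]; exact prod_mono le_rfl nhdsWithin_le_nhds
  have ht : Tendsto (fun z : ℝ × ℝ => (z, (z.1, (0 : ℝ)))) (𝓝 θ₀ ×ˢ 𝓝[>] 0)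
      (𝓝 ((θ₀, 0), (θ₀, 0))) :=
    (Continuous.tendsto' (by fun_prop) (θ₀, (0 : ℝ)) _ rfl).mono_left hle
  have hpos : ∀ᶠ z : ℝ × ℝ in 𝓝 θ₀ ×ˢ 𝓝[>] 0, 0 < z.2 :=
    tendsto_snd.eventually self_mem_nhdsWithin
  have hz : ∀ᶠ z : ℝ × ℝ in 𝓝 θ₀ ×ˢ 𝓝[>] 0, G (z.1, 0) = 0 := tendsto_fst.eventually h0
  rw [Metric.tendsto_nhds]
  intro ε hε
  filter_upwards [ht.eventually (hs.isLittleO.def (half_pos hε)), hpos, hz] with z h1 h2 h3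
  have e1 : z - (z.1, (0 : ℝ)) = z.2 • ((0 : ℝ), (1 : ℝ)) := by
    ext <;> simp
  simp only [h3, e1, map_smul, hLm, sub_zero, smul_eq_mul] at h1
  have e2 : ‖z.2 • ((0 : ℝ), (1 : ℝ))‖ = z.2 := by
    rw [norm_smul, Prod.norm_mk]; simp [abs_of_pos h2]
  rw [e2, Real.norm_eq_abs] at h1
  rw [Real.dist_eq, show G z / z.2 - m = (G z - z.2 * m) / z.2 by field_simp, abs_div,
    abs_of_pos h2, div_lt_iff₀ h2]
  nlinarith

variable {M : Type*} [TopologicalSpace M] [ChartedSpace E3 M] [IsManifold 𝓘(ℝ, E3) ∞ M]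
variable {S : Type*} [TopologicalSpace S] [ChartedSpace (EuclideanHalfSpace 2) S]
  [IsManifold (𝓡∂ 2) ∞ S]

theorem contDiffAt_comp_of_contMDiff {F : Type*} [NormedAddCommGroup F] [NormedSpace ℝ F]
    {H : ℝ → ℝ → M}
    (hH : ContMDiff (𝓘(ℝ, ℝ).prod 𝓘(ℝ, ℝ)) 𝓘(ℝ, E3) ∞ (fun z : ℝ × ℝ => H z.1 z.2)) {g : M → F}
    {z : ℝ × ℝ} (hg : ContMDiffAt 𝓘(ℝ, E3) 𝓘(ℝ, F) 1 g (H z.1 z.2)) :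
    ContDiffAt ℝ 1 (fun z : ℝ × ℝ => g (H z.1 z.2)) z := by
  have h1 : ContMDiffAt (𝓘(ℝ, ℝ).prod 𝓘(ℝ, ℝ)) 𝓘(ℝ, F) 1 (fun z : ℝ × ℝ => g (H z.1 z.2)) z :=
    ContMDiffAt.comp (g := g) (f := fun z : ℝ × ℝ => H z.1 z.2) z hg (hH.of_le (by simp) z)
  rw [← modelWithCornersSelf_prod, chartedSpaceSelf_prod] at h1
  exact h1.contDiffAt

theorem contMDiff_partial_left {H : ℝ → ℝ → M}
    (hH : ContMDiff (𝓘(ℝ, ℝ).prod 𝓘(ℝ, ℝ)) 𝓘(ℝ, E3) ∞ (fun z : ℝ × ℝ => H z.1 z.2)) (u : ℝ) :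
    ContMDiff 𝓘(ℝ, ℝ) 𝓘(ℝ, E3) ∞ (fun θ => H θ u) :=
  hH.comp (contMDiff_id.prodMk contMDiff_const)

theorem contMDiff_partial_right {H : ℝ → ℝ → M}
    (hH : ContMDiff (𝓘(ℝ, ℝ).prod 𝓘(ℝ, ℝ)) 𝓘(ℝ, E3) ∞ (fun z : ℝ × ℝ => H z.1 z.2)) (θ : ℝ) :
    ContMDiff 𝓘(ℝ, ℝ) 𝓘(ℝ, E3) ∞ (fun u => H θ u) :=
  hH.comp (contMDiff_const.prodMk contMDiff_id)

/-- Behaviour of a push-off of the boundary of a surface near a point of the boundary. -/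
theorem IsBoundaryCurve.eventually_pushOff [CompactSpace S] [T2Space M]
    (hM : IsOrientedAtlas 𝓘(ℝ, E3) M) (hS : IsOrientedAtlas (𝓡∂ 2) S)
    {f : S → M} (hf : ContMDiff (𝓡∂ 2) 𝓘(ℝ, E3) ∞ f) (hinj : Function.Injective f)
    (himm : ∀ x, Function.Injective (coordDeriv (𝓡∂ 2) 𝓘(ℝ, E3) f x)) {b : ℝ → S}
    (hb : IsBoundaryCurve b) {H : ℝ → ℝ → M}
    (hH : ContMDiff (𝓘(ℝ, ℝ).prod 𝓘(ℝ, ℝ)) 𝓘(ℝ, E3) ∞ (fun z : ℝ × ℝ => H z.1 z.2))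
    (hH0 : ∀ θ, H θ 0 = f (b θ)) {h : M → ℝ} (hh : ContMDiff 𝓘(ℝ, E3) 𝓘(ℝ, ℝ) 1 h)
    (h0 : ∀ x, h (f x) = 0) {θ₀ : ℝ} (hco : Coorients h f (b θ₀)) {p q : ℝ → ℝ}
    (hp : Continuous p) (hq : Continuous q) {a : E2} (ha : IsOutward a) {r : ℝ} {c : E3}
    (hc : 0 < det3 (coordDeriv (𝓡∂ 2) 𝓘(ℝ, E3) f (b θ₀) (surfaceVelocity b θ₀))
      (coordDeriv (𝓡∂ 2) 𝓘(ℝ, E3) f (b θ₀) a) c)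
    (hv : curveVelocity 𝓘(ℝ, E3) (fun u => H θ₀ u) 0 =
      p θ₀ • coordDeriv (𝓡∂ 2) 𝓘(ℝ, E3) f (b θ₀) a + q θ₀ • c
        + r • coordDeriv (𝓡∂ 2) 𝓘(ℝ, E3) f (b θ₀) (surfaceVelocity b θ₀))
    (hne : p θ₀ ≠ 0 ∨ q θ₀ ≠ 0) :
    ∀ᶠ z : ℝ × ℝ in 𝓝 θ₀ ×ˢ 𝓝[>] 0,
      0 < p z.1 * p z.1 + q z.1 * (h (H z.1 z.2) / z.2) ∧
      (h (H z.1 z.2) = 0 → p z.1 < 0 → H z.1 z.2 ∈ range f) ∧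
      ∀ x, f x = H z.1 z.2 → p z.1 < 0 ∧ Coorients h f x := by
  set D := coordDeriv (𝓡∂ 2) 𝓘(ℝ, E3) f (b θ₀) with hD
  set b' := surfaceVelocity b θ₀ with hb'
  have hbd : extChartAt (𝓡∂ 2) (b θ₀) (b θ₀) 0 = 0 :=
    (mem_boundary_iff (mem_extChartAt_source (b θ₀))).1 (hb.range_eq ▸ mem_range_self θ₀)
  have hbc := hb.smooth.continuous
  have hc' : det3 (D !₂[1, 0]) (D !₂[0, 1]) c < 0 := by
    rw [det3_map_plane] at hc
    have h1 := hb.orientation θ₀ a ha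
    have h2 : det2 b' a < 0 := by
      rw [det2_eq] at h1 ⊢; linarith
    by_contra h3
    exact absurd hc (not_lt.2 (mul_nonpos_of_nonpos_of_nonneg h2.le (not_lt.1 h3)))
  have hv' : curveVelocity 𝓘(ℝ, E3) (fun u => H θ₀ u) 0 = D (p θ₀ • a + r • b') + q θ₀ • c := by
    rw [hv, map_add, map_smul, map_smul]; abel
  have hle : 𝓝 θ₀ ×ˢ 𝓝[>] (0 : ℝ) ≤ 𝓝 (θ₀, 0) := by
    rw [nhds_prod_eq]; exact prod_mono le_rfl nhdsWithin_le_nhds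
  have hHt : Tendsto (fun z : ℝ × ℝ => H z.1 z.2) (𝓝 θ₀ ×ˢ 𝓝[>] 0) (𝓝 (f (b θ₀))) := by
    rw [← hH0]; exact (hH.continuous.tendsto (θ₀, 0)).mono_left hle
  have hHd : MDifferentiableAt 𝓘(ℝ, ℝ) 𝓘(ℝ, E3) (fun u => H θ₀ u) 0 :=
    (contMDiff_partial_right hH θ₀).mdifferentiableAt (by simp)
  have hpos : ∀ᶠ z : ℝ × ℝ in 𝓝 θ₀ ×ˢ 𝓝[>] 0, 0 < z.2 :=
    tendsto_snd.eventually self_mem_nhdsWithin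
  have hpt : Tendsto (fun z : ℝ × ℝ => p z.1) (𝓝 θ₀ ×ˢ 𝓝[>] 0) (𝓝 (p θ₀)) :=
    (hp.tendsto θ₀).comp tendsto_fst
  have hqt : Tendsto (fun z : ℝ × ℝ => q z.1) (𝓝 θ₀ ×ˢ 𝓝[>] 0) (𝓝 (q θ₀)) :=
    (hq.tendsto θ₀).comp tendsto_fst
  obtain ⟨k, hk, hkw⟩ := id hco
  have hlc : 0 < -k * det3 (D !₂[1, 0]) (D !₂[0, 1]) c := by nlinarith
  set μ := -k * det3 (D !₂[1, 0]) (D !₂[0, 1]) c with hμ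
  -- Here `μ = dh(c) > 0`: to first order the height of the push-off above the surface is a positive
  -- multiple of `q`.
  have hgt : Tendsto (fun z : ℝ × ℝ => h (H z.1 z.2) / z.2) (𝓝 θ₀ ×ˢ 𝓝[>] 0)
      (𝓝 (q θ₀ * μ)) := by
    refine tendsto_div_snd_of_contDiffAt (G := fun z => h (H z.1 z.2))
      (contDiffAt_comp_of_contMDiff hH (hh _)) (Eventually.of_forall fun θ => ?_) ?_
    · simp only [hH0, h0]
    · have h1 := hasDerivAt_comp_coordDeriv (I' := 𝓘(ℝ, E3)) (h := h) (c := fun u => H θ₀ u)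
        (θ := 0) ((hh _).mdifferentiableAt one_ne_zero) hHd
      rw [hv', hH0, hkw, det3_add_smul_right] at h1
      refine h1.congr_deriv ?_
      rw [hμ]; ring
  have hcoev := hHt.eventually (eventually_of_eventually_comp hf.continuous hinj
    (hco.eventually hM hS hf (hh _) (Eventually.of_forall h0) (himm _)))
  have hpos1 : ∀ᶠ z : ℝ × ℝ in 𝓝 θ₀ ×ˢ 𝓝[>] 0,
      0 < p z.1 * p z.1 + q z.1 * (h (H z.1 z.2) / z.2) := by
    refine ((hpt.mul hpt).add (hqt.mul hgt)).eventually (lt_mem_nhds ?_)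
    have h1 : p θ₀ * p θ₀ + q θ₀ * (q θ₀ * μ) = p θ₀ ^ 2 + q θ₀ ^ 2 * μ := by ring
    rw [h1]
    rcases hne with h2 | h2 <;> positivity
  -- If `q θ₀ ≠ 0`, the height is not zero near `θ₀` and the push-off does not meet the surface
  -- there. Otherwise `p θ₀ ≠ 0`, and its sign decides on which side of the boundary the push-off
  -- lies.
  by_cases hq0 : q θ₀ = 0
  swap
  · have hgne : ∀ᶠ z : ℝ × ℝ in 𝓝 θ₀ ×ˢ 𝓝[>] 0, h (H z.1 z.2) / z.2 ≠ 0 :=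
      hgt.eventually_ne (mul_ne_zero hq0 hlc.ne')
    filter_upwards [hpos1, hgne] with z h1 h2
    have h3 : h (H z.1 z.2) ≠ 0 := fun h4 => h2 (by rw [h4, zero_div])
    exact ⟨h1, fun h4 => absurd h4 h3, fun x hx => absurd (by rw [← hx, h0]) h3⟩
  have hp0 : p θ₀ ≠ 0 := hne.resolve_right (not_not.2 hq0)
  obtain ⟨Ψ, hΨ, hΨ0, hΨd, hΨr⟩ := exists_surface_coordinates hf hbd hc'
  set Y : M → ℝ := fun P => (Ψ P).1 0 with hY
  have hYc : ContMDiffAt 𝓘(ℝ, E3) 𝓘(ℝ, ℝ) 1 Y (f (b θ₀)) := by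
    have h1 : ContDiff ℝ 1 fun w : E2 × ℝ => w.1 0 :=
      (EuclideanSpace.proj (𝕜 := ℝ) (0 : Fin 2)).contDiff.comp contDiff_fst
    exact ContMDiffAt.comp (f (b θ₀)) (h1.contMDiff (Ψ (f (b θ₀)))) hΨ
  have hYd : ∀ (w : E2) (z : ℝ), coordDeriv 𝓘(ℝ, E3) 𝓘(ℝ, ℝ) Y (f (b θ₀)) (D w + z • c) = w 0 := by
    intro w z
    have h1 := hasFDerivAt_comp_extChartAt_symm (hΨ.mdifferentiableAt one_ne_zero)
    have h2 := hasFDerivAt_comp_extChartAt_symm (hYc.mdifferentiableAt one_ne_zero)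
    have h3 := (EuclideanSpace.proj (𝕜 := ℝ) (0 : Fin 2)).hasFDerivAt.comp _ h1.fst
    rw [h2.unique h3]
    exact congrArg (fun v : E2 × ℝ => v.1 0) (hΨd w z)
  -- `Y` is the inward coordinate, nonnegative on the surface. As `a` points outward, `Y` along the
  -- push-off has the sign opposite to `p`.
  have hYt : Tendsto (fun z : ℝ × ℝ => Y (H z.1 z.2) / z.2) (𝓝 θ₀ ×ˢ 𝓝[>] 0)
      (𝓝 (p θ₀ * a 0)) := by
    refine tendsto_div_snd_of_contDiffAt (G := fun z => Y (H z.1 z.2))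
      (contDiffAt_comp_of_contMDiff hH (by simp only [hH0]; exact hYc)) ?_ ?_
    · filter_upwards [hbc.continuousAt.eventually hΨ0, hbc.continuousAt.eventually
        (extChartAt_source_mem_nhds (I := 𝓡∂ 2) (b θ₀))] with θ h1 h2
      simp only [hY, hH0, h1]
      exact (mem_boundary_iff h2).1 (hb.range_eq ▸ mem_range_self θ)
    · have h1 := hasDerivAt_comp_coordDeriv (I' := 𝓘(ℝ, E3)) (h := Y) (c := fun u => H θ₀ u)
        (θ := 0) (by simp only [hH0]; exact hYc.mdifferentiableAt one_ne_zero) hHd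
      rw [hv', hH0, hYd] at h1
      refine h1.congr_deriv ?_
      rw [PiLp.add_apply, PiLp.smul_apply, PiLp.smul_apply, hb.surfaceVelocity_zero]
      simp
  have hYx : ∀ᶠ P in 𝓝 (f (b θ₀)), ∀ x, f x = P → 0 ≤ Y (f x) := by
    refine eventually_of_eventually_comp hf.continuous hinj ?_
    filter_upwards [hΨ0, extChartAt_source_mem_nhds (I := 𝓡∂ 2) (b θ₀)] with x h1 h2
    simp only [hY, h1]
    exact target_subset_halfPlane _ ((extChartAt (𝓡∂ 2) (b θ₀)).map_source h2)
  have ha0 : a 0 < 0 := ha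
  rcases lt_or_gt_of_ne hp0 with hneg | hpos'
  · have e1 := hYt.eventually (lt_mem_nhds (mul_pos_of_neg_of_neg hneg ha0))
    filter_upwards [hpos1, hpos, e1, hpt.eventually (gt_mem_nhds hneg), hcoev,
      hHt.eventually (hΨr h (hh _) h0 hco)] with z h1 h2 h3 h4 h5 h6
    exact ⟨h1, fun h7 _ => h6 h7 ((div_pos_iff_of_pos_right h2).1 h3).le,
      fun x hx => ⟨h4, h5 x hx⟩⟩
  · have e1 := hYt.eventually (gt_mem_nhds (mul_neg_of_pos_of_neg hpos' ha0))
    filter_upwards [hpos1, hpos, e1, hpt.eventually (lt_mem_nhds hpos'),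
      hHt.eventually hYx] with z h1 h2 h3 h4 h5
    refine ⟨h1, fun _ h7 => absurd h7 h4.not_gt, fun x hx => ?_⟩
    have h6 := h5 x hx
    rw [hx] at h6
    exact absurd h3 (not_lt.2 (div_nonneg h6 h2.le))

/-- The linking number with the boundary of a surface of a push-off in the direction of a normal
field is the winding number of the field in the framing of the normal bundle given by the surface. -/
theorem IsBoundaryCurve.linkingNumber_eq [CompactSpace S] [T2Space M] [SecondCountableTopology M]
    (hM : IsOrientedAtlas 𝓘(ℝ, E3) M) (hS : IsOrientedAtlas (𝓡∂ 2) S)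
    {f : S → M} (hf : ContMDiff (𝓡∂ 2) 𝓘(ℝ, E3) ∞ f) (hinj : Function.Injective f)
    (himm : ∀ x, Function.Injective (coordDeriv (𝓡∂ 2) 𝓘(ℝ, E3) f x)) {b : ℝ → S}
    (hb : IsBoundaryCurve b) {K : ℝ → M} {H : ℝ → ℝ → M}
    (hH : ContMDiff (𝓘(ℝ, ℝ).prod 𝓘(ℝ, ℝ)) 𝓘(ℝ, E3) ∞ (fun z : ℝ × ℝ => H z.1 z.2))
    (hHp : ∀ u, Function.Periodic (fun θ => H θ u) 1)
    (hH0 : ∀ θ, H θ 0 = f (b θ)) {p q r : ℝ → ℝ} (hp : Continuous p) (hq : Continuous q)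
    (hpp : Function.Periodic p 1) (hqp : Function.Periodic q 1) {a : ℝ → E2}
    (ha : ∀ θ, IsOutward (a θ)) {c : ℝ → E3}
    (hc : ∀ θ, 0 < det3 (coordDeriv (𝓡∂ 2) 𝓘(ℝ, E3) f (b θ) (surfaceVelocity b θ))
      (coordDeriv (𝓡∂ 2) 𝓘(ℝ, E3) f (b θ) (a θ)) (c θ))
    (hv : ∀ θ, curveVelocity 𝓘(ℝ, E3) (fun u => H θ u) 0 =
      p θ • coordDeriv (𝓡∂ 2) 𝓘(ℝ, E3) f (b θ) (a θ) + q θ • c θ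
        + r θ • coordDeriv (𝓡∂ 2) 𝓘(ℝ, E3) f (b θ) (surfaceVelocity b θ)) {n sl : ℤ}
    (hn : HasWindingNumber (fun θ => (p θ : ℂ) + (q θ : ℂ) * Complex.I) n)
    (hsl : ∀ᶠ u in 𝓝[>] (0 : ℝ), IsLinkingNumber K f (fun θ => H θ u) sl) : sl = n := by
  obtain ⟨h, hh, h0, hco⟩ := hb.exists_coorienting hM hS hf hinj himm
  have hloc : ∀ᶠ u in 𝓝[>] (0 : ℝ), ∀ θ ∈ Icc (0 : ℝ) 1,
      0 < p θ * p θ + q θ * (h (H θ u) / u) ∧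
      (h (H θ u) = 0 → p θ < 0 → H θ u ∈ range f) ∧
      ∀ x, f x = H θ u → p θ < 0 ∧ Coorients h f x := by
    -- Compactness of a period yields one `u` that is small enough for all `θ`.
    have hswap : ∀ {Q : ℝ → ℝ → Prop},
        (∀ θ ∈ Icc (0 : ℝ) 1, ∀ᶠ z : ℝ × ℝ in 𝓝 θ ×ˢ 𝓝[>] 0, Q z.1 z.2) →
        ∀ᶠ u in 𝓝[>] (0 : ℝ), ∀ θ ∈ Icc (0 : ℝ) 1, Q θ u := fun {Q} h1 => by
      have h2 := isCompact_Icc.eventually_forall_of_forall_eventually (x₀ := (0 : ℝ))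
        (K := Icc (0 : ℝ) 1) (P := fun u θ => 0 < u → Q θ u) fun θ hθ => by
          have h3 := h1 θ hθ
          rw [← nhdsWithin_univ, ← nhdsWithin_prod_eq, eventually_nhdsWithin_iff] at h3
          have h4 : Tendsto (fun z : ℝ × ℝ => (z.2, z.1)) (𝓝 (0, θ)) (𝓝 (θ, 0)) :=
            Continuous.tendsto' (by fun_prop) _ _ rfl
          filter_upwards [h4.eventually h3] with z hz h5
          exact hz ⟨mem_univ _, h5⟩
      rw [eventually_nhdsWithin_iff]
      filter_upwards [h2] with u hu h5 θ hθ using hu θ hθ h5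
    refine hswap fun θ _ => ?_
    have hne : p θ ≠ 0 ∨ q θ ≠ 0 := by
      by_contra hcon
      rw [not_or, not_not, not_not] at hcon
      exact hn.1 θ (by simp [hcon.1, hcon.2])
    exact hb.eventually_pushOff hM hS hf hinj himm hH hH0 hh h0 (hco θ) hp hq (ha θ) (hc θ)
      (hv θ) hne
  obtain ⟨u, ⟨hlink, hu⟩, hu0⟩ := ((hsl.and hloc).and self_mem_nhdsWithin).exists
  have hu0 : 0 < u := hu0
  obtain ⟨-, htr, P, hP, hsum⟩ := hlink
  replace hP : ∀ z : ℝ × S, z ∈ P ↔ z.1 ∈ Ico (0 : ℝ) 1 ∧ f z.2 = H z.1 u := hP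
  set g : ℝ → ℝ := fun θ => h (H θ u) / u with hg
  have hHu := contMDiff_partial_left hH u
  have hgp : Function.Periodic g 1 := fun θ =>
    congrArg (fun P => h P / u) (hHp u θ)
  have hgc : Continuous g := (hh.continuous.comp hHu.continuous).div_const _
  set z : ℝ → ℂ := fun θ => (p θ : ℂ) + (g θ : ℂ) * Complex.I with hz
  have hzp : Function.Periodic z 1 := fun θ => by simp only [hz, hpp θ, hgp θ]
  have hwp : Function.Periodic (fun θ => (p θ : ℂ) + (q θ : ℂ) * Complex.I) 1 := fun θ => by
    simp only [hpp θ, hqp θ]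
  have hpos : ∀ θ, 0 < p θ * p θ + q θ * g θ := fun θ => by
    have h1 := (hu (Int.fract θ) ⟨Int.fract_nonneg _, (Int.fract_lt_one _).le⟩).1
    have h2 : ∀ w : ℝ → ℝ, Function.Periodic w 1 → w (Int.fract θ) = w θ := fun w hw => by
      have := hw.sub_int_mul_eq (x := θ) ⌊θ⌋
      rwa [mul_one] at this
    rw [h2 p hpp, h2 q hqp, show h (H (Int.fract θ) u) / u = g θ from h2 g hgp] at h1
    exact h1
  -- By `hpos` the loops `p + i q` and `p + i h(H)/u` have positive scalar product at every `θ`, so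
  -- they are never antiparallel.
  have hzn : HasWindingNumber z n := by
    refine hn.of_forall_add_ne (by fun_prop) (by fun_prop) hwp hzp fun θ k hk hk0 => ?_
    have h1 := congrArg Complex.re hk0
    have h2 := congrArg Complex.im hk0
    simp [hz] at h1 h2
    have h3 := hpos θ
    have h4 : p θ * p θ + q θ * g θ = -k * (q θ * q θ + p θ * p θ) := by
      linear_combination (p θ) * h1 + (q θ) * h2
    nlinarith [mul_nonneg hk (add_nonneg (mul_self_nonneg (q θ)) (mul_self_nonneg (p θ)))]
  have hPf : ∀ y ∈ P, ∀ y' ∈ P, y.1 = y'.1 → y = y' := fun y hy y' hy' e => by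
    refine Prod.ext e (hinj ?_)
    rw [((hP y).1 hy).2, ((hP y').1 hy').2, e]
  have hd : ∀ θ, HasDerivAt (fun θ => (z θ).im)
      (coordDeriv 𝓘(ℝ, E3) 𝓘(ℝ, ℝ) h (H θ u) (velocity (fun θ => H θ u) θ) / u) θ := fun θ => by
    have e : (fun θ => (z θ).im) = fun θ => h (H θ u) / u := by
      funext θ; simp [hz, hg]
    rw [e]
    exact (hasDerivAt_comp_coordDeriv (I' := 𝓘(ℝ, E3)) (h := h) (c := fun θ => H θ u)
      ((hh _).mdifferentiableAt one_ne_zero) (hHu.mdifferentiableAt (by simp))).div_const u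
  -- `h` increases towards the negative side of the surface. This sign cancels the one in
  -- `HasWindingNumber.eq_neg_sum_crossings`.
  have hsgn : ∀ y ∈ P, (SignType.sign (coordDeriv 𝓘(ℝ, E3) 𝓘(ℝ, ℝ) h (H y.1 u)
      (velocity (fun θ => H θ u) y.1) / u) : SignType) =
      -SignType.sign (det3 (surfaceDeriv f y.2 !₂[1, 0]) (surfaceDeriv f y.2 !₂[0, 1])
        (velocity (fun θ => H θ u) y.1)) := fun y hy => by
    obtain ⟨h1, h2⟩ := (hP y).1 hy
    obtain ⟨k, hk, hkw⟩ := ((hu y.1 (Ico_subset_Icc_self h1)).2.2 y.2 h2).2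
    rw [← h2, hkw, ← Left.sign_neg]
    have e : ∀ d : ℝ, SignType.sign (-k * d / u) = SignType.sign (-d) := fun d => by
      rw [show -k * d / u = (k / u) * (-d) by ring, sign_mul, sign_pos (div_pos hk hu0), one_mul]
    exact e _
  -- Crossings of `z` with the negative real axis, that is, `h = 0` and `p < 0`, correspond to the
  -- intersections of the push-off with the surface. Projection to the parameter is injective on
  -- these, as `f` is.
  have key := hzn.eq_neg_sum_crossings hzp (P.image Prod.fst) (fun θ => ?_) (fun θ _ => hd θ)
    fun θ hθ => ?_
  · rw [key, hsum, Finset.sum_image hPf, ← Finset.sum_neg_distrib]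
    refine Finset.sum_congr rfl fun y hy => ?_
    rw [hsgn y hy]
    simp
  · rw [Finset.mem_image]
    have e1 : (z θ).im = h (H θ u) / u := by simp [hz, hg]
    have e2 : (z θ).re = p θ := by simp [hz]
    rw [e1, e2, div_eq_zero_iff, or_iff_left hu0.ne']
    constructor
    · rintro ⟨y, hy, rfl⟩
      obtain ⟨h1, h2⟩ := (hP y).1 hy
      refine ⟨h1, ?_, ((hu y.1 (Ico_subset_Icc_self h1)).2.2 y.2 h2).1⟩
      rw [← h2, h0]
    · rintro ⟨h1, h2, h3⟩
      obtain ⟨x, hx⟩ := (hu θ (Ico_subset_Icc_self h1)).2.1 h2 h3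
      exact ⟨(θ, x), (hP _).2 ⟨h1, hx⟩, rfl⟩
  · obtain ⟨y, hy, rfl⟩ := Finset.mem_image.1 hθ
    obtain ⟨h1, h2⟩ := (hP y).1 hy
    have h3 := hsgn y hy
    intro h4
    rw [h4, sign_zero, eq_comm, ← Left.sign_neg, sign_eq_zero_iff, neg_eq_zero] at h3
    exact htr y.1 y.2 h2 h3

end SelfLinking


/-! ### Continuous vector fields along maps -/

section Fields

variable {M : Type*} [TopologicalSpace M] [ChartedSpace E3 M] [IsManifold 𝓘(ℝ, E3) ∞ M]
variable {Z Z' : Type*} [TopologicalSpace Z] [TopologicalSpace Z']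

/-- A vector field `X` along `g`, in the chart at `g z₀`. -/
def localField (g : Z → M) (X : Z → E3) (z₀ z : Z) : E3 :=
  tangentCoordChange 𝓘(ℝ, E3) (g z) (g z₀) (g z) (X z)

/-- A continuous vector field along a continuous map. -/
def IsContField (g : Z → M) (X : Z → E3) : Prop :=
  Continuous g ∧ ∀ z₀, ContinuousAt (localField g X z₀) z₀

theorem isContField_iff {g : Z → M} {X : Z → E3} :
    IsContField g X ↔ Continuous fun z => (⟨g z, X z⟩ : TangentBundle 𝓘(ℝ, E3) M) := by
  constructor
  · rintro ⟨h1, h2⟩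
    exact continuous_iff_continuousAt.2 fun z₀ =>
      (FiberBundle.continuousAt_totalSpace _ _).2 ⟨h1.continuousAt, h2 z₀⟩
  · intro h
    have h1 := fun z₀ => (FiberBundle.continuousAt_totalSpace _ _).1 (continuous_iff_continuousAt.1 h z₀)
    exact ⟨continuous_iff_continuousAt.2 fun z₀ => (h1 z₀).1, fun z₀ => (h1 z₀).2⟩

theorem IsContField.comp {g : Z → M} {X : Z → E3} (h : IsContField g X) {w : Z' → Z}
    (hw : Continuous w) : IsContField (fun z => g (w z)) (fun z => X (w z)) :=
  isContField_iff.2 ((isContField_iff.1 h).comp hw)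

theorem IsContField.eventually_mem {g : Z → M} {X : Z → E3} (hX : IsContField g X) (z₀ : Z) :
    ∀ᶠ z in 𝓝 z₀, g z ∈ (extChartAt 𝓘(ℝ, E3) (g z₀)).source :=
  hX.1.continuousAt.eventually (extChartAt_source_mem_nhds (I := 𝓘(ℝ, E3)) (g z₀))

theorem continuousAt_det3 {X Y V : Z → E3} {z₀ : Z} (hX : ContinuousAt X z₀)
    (hY : ContinuousAt Y z₀) (hV : ContinuousAt V z₀) :
    ContinuousAt (fun z => det3 (X z) (Y z) (V z)) z₀ := by
  have c : ∀ {X : Z → E3}, ContinuousAt X z₀ → ∀ i : Fin 3, ContinuousAt (fun z => X z i) z₀ :=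
    fun hX i => (EuclideanSpace.proj (𝕜 := ℝ) (i : Fin 3)).continuous.continuousAt.comp hX
  have := c hX; have := c hY; have := c hV
  simp only [det3_eq]
  fun_prop

/-- A single determinant depends on the preferred chart at the moving point. In a quotient the
Jacobian of the change to a fixed chart cancels. -/
theorem IsContField.continuous_det3_div (hM : IsOrientedAtlas 𝓘(ℝ, E3) M) {g : Z → M}
    {X Y V X' Y' V' : Z → E3} (hX : IsContField g X) (hY : IsContField g Y) (hV : IsContField g V)
    (hX' : IsContField g X') (hY' : IsContField g Y') (hV' : IsContField g V')
    (hne : ∀ z, det3 (X' z) (Y' z) (V' z) ≠ 0) :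
    Continuous fun z => det3 (X z) (Y z) (V z) / det3 (X' z) (Y' z) (V' z) := by
  refine continuous_iff_continuousAt.2 fun z₀ => ?_
  have hloc : ∀ X : Z → E3, localField g X z₀ z₀ = X z₀ := fun X =>
    tangentCoordChange_self (mem_extChartAt_source _)
  refine ((continuousAt_det3 (hX.2 z₀) (hY.2 z₀) (hV.2 z₀)).div
    (continuousAt_det3 (hX'.2 z₀) (hY'.2 z₀) (hV'.2 z₀)) ?_).congr ?_
  · rw [hloc, hloc, hloc]; exact hne z₀
  · filter_upwards [hX.eventually_mem z₀] with z hz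
    have hA := hM.det_tangentCoordChange_pos (mem_extChartAt_source (g z)) hz
    simp only [localField, Pi.div_apply, det3_map]
    exact mul_div_mul_left _ _ hA.ne'

theorem IsContactForm.continuous_apply {α : (p : M) → TangentSpace 𝓘(ℝ, E3) p →L[ℝ] ℝ}
    (hα : IsContactForm α) {g : Z → M} {X : Z → E3} (hX : IsContField g X) :
    Continuous fun z => (α (g z) (X z) : ℝ) :=
  hα.smooth.continuous.comp (isContField_iff.1 hX)

theorem isContField_of_contMDiff {E H N : Type*} [NormedAddCommGroup E] [NormedSpace ℝ E]
    [TopologicalSpace H] {I : ModelWithCorners ℝ E H} [TopologicalSpace N] [ChartedSpace H N]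
    {g : N → M} {X : N → E3} (h : ContMDiff I 𝓘(ℝ, E3).tangent ∞
      (fun x => (⟨g x, X x⟩ : TangentBundle 𝓘(ℝ, E3) M))) : IsContField g X :=
  isContField_iff.2 h.continuous

theorem continuousAt_tangentCoordChange_apply {i p : M}
    (hp : p ∈ (extChartAt 𝓘(ℝ, E3) i).source) {j : M} (hj : p ∈ (extChartAt 𝓘(ℝ, E3) j).source) :
    ContinuousAt (tangentCoordChange 𝓘(ℝ, E3) i j) p :=
  (continuousOn_tangentCoordChange i j).continuousAt
    (((isOpen_extChartAt_source i).inter (isOpen_extChartAt_source j)).mem_nhds ⟨hp, hj⟩)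

theorem continuousOn_constField (p₀ : M) (r : E3) :
    ContinuousOn (fun p => (⟨p, tangentCoordChange 𝓘(ℝ, E3) p₀ p p r⟩ : TangentBundle 𝓘(ℝ, E3) M))
      (extChartAt 𝓘(ℝ, E3) p₀).source := by
  intro p hp
  refine ContinuousAt.continuousWithinAt ((FiberBundle.continuousAt_totalSpace _ _).2
    ⟨continuousAt_id, ?_⟩)
  have h1 := (continuousAt_tangentCoordChange_apply hp (mem_extChartAt_source p)).clm_apply
    (continuousAt_const (y := r))
  refine h1.congr ?_
  filter_upwards [(isOpen_extChartAt_source (I := 𝓘(ℝ, E3)) p₀).mem_nhds hp,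
    extChartAt_source_mem_nhds (I := 𝓘(ℝ, E3)) p] with p' h2 h3
  exact (tangentCoordChange_comp ⟨⟨h2, mem_extChartAt_source p'⟩, h3⟩).symm

/-- Every contact form is positive on some continuous vector field. -/
theorem IsContactForm.exists_pos_field [T2Space M] [SecondCountableTopology M]
    {α : (p : M) → TangentSpace 𝓘(ℝ, E3) p →L[ℝ] ℝ} (hα : IsContactForm α) :
    ∃ R : M → E3, IsContField id R ∧ ∀ p, 0 < α p (R p) := by
  have : LocallyCompactSpace M := ChartedSpace.locallyCompactSpace E3 M
  -- The contact condition prevents `α` from vanishing at a point.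
  have hex : ∀ p, ∃ r : E3, 0 < α p r := fun p => by
    have h1 := hα.contact p !₂[1, 0, 0] !₂[0, 1, 0] !₂[0, 0, 1] (by simp [det3_eq])
    by_contra! hle
    have h2 : ∀ r : E3, α p r = 0 := fun r => by
      have h3 := hle (-r)
      have h4 : α p (-r) = -α p r := map_neg (α p) r
      rw [h4] at h3
      exact le_antisymm (hle r) (by linarith)
    simp only [wedgeForm, h2, zero_mul, add_zero, lt_irrefl] at h1
  have hloc : ∀ p₀ : M, ∃ U ∈ 𝓝 p₀, ∃ X : (p : M) → TangentSpace 𝓘(ℝ, E3) p,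
      ContMDiffOn 𝓘(ℝ, E3) 𝓘(ℝ, E3).tangent ((0 : ℕ∞) : ℕ∞ω)
        (fun p => (⟨p, X p⟩ : TangentBundle 𝓘(ℝ, E3) M)) U ∧
      ∀ p ∈ U, X p ∈ {v | 0 < α p v} := fun p₀ => by
    obtain ⟨r, hr⟩ := hex p₀
    have hc := continuousOn_constField p₀ r
    have hs := (isOpen_extChartAt_source (I := 𝓘(ℝ, E3)) p₀)
    have hm := mem_extChartAt_source (I := 𝓘(ℝ, E3)) p₀
    have h1 : ContinuousAt (fun p => (α p (tangentCoordChange 𝓘(ℝ, E3) p₀ p p r) : ℝ)) p₀ :=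
      ContinuousAt.comp (g := fun z : TangentBundle 𝓘(ℝ, E3) M => α z.proj z.snd)
        (f := fun p => (⟨p, tangentCoordChange 𝓘(ℝ, E3) p₀ p p r⟩ : TangentBundle 𝓘(ℝ, E3) M))
        hα.smooth.continuous.continuousAt (hc.continuousAt (hs.mem_nhds hm))
    have h2 : ∀ᶠ p in 𝓝 p₀, 0 < (α p (tangentCoordChange 𝓘(ℝ, E3) p₀ p p r) : ℝ) := by
      refine h1.eventually (lt_mem_nhds ?_)
      show 0 < (α p₀ (tangentCoordChange 𝓘(ℝ, E3) p₀ p₀ p₀ r) : ℝ)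
      rw [tangentCoordChange_self hm]; exact hr
    refine ⟨_, inter_mem (hs.mem_nhds hm) h2,
      fun p => tangentCoordChange 𝓘(ℝ, E3) p₀ p p r, ?_, fun p hp => hp.2⟩
    exact contMDiffOn_zero_iff.2 (hc.mono fun p hp => hp.1)
  -- Positivity of `α` is a convex condition in each fibre, so local fields can be glued.
  obtain ⟨R, hR⟩ := exists_contMDiffSection_forall_mem_convex_of_local (n := 0) 𝓘(ℝ, E3)
    (fun p : M => TangentSpace 𝓘(ℝ, E3) p) (fun p => {v | 0 < α p v})
    (fun p => (convex_Ioi (0 : ℝ)).linear_preimage (α p).toLinearMap) hloc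
  exact ⟨fun p => R p, isContField_iff.2 R.contMDiff.continuous, hR⟩

end Fields


/-! ### Transport of tangent vectors between nearby points -/

section Transport

variable {M : Type*} [TopologicalSpace M] [ChartedSpace E3 M] [IsManifold 𝓘(ℝ, E3) ∞ M]

theorem continuousAt_tangentBundle {Z : Type*} [TopologicalSpace Z] {g : Z → M} {X : Z → E3}
    {z₀ : Z} : ContinuousAt (fun z => (⟨g z, X z⟩ : TangentBundle 𝓘(ℝ, E3) M)) z₀ ↔
      ContinuousAt g z₀ ∧ ContinuousAt (localField g X z₀) z₀ :=
  FiberBundle.continuousAt_totalSpace _ _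

theorem continuousAt_trivialization_snd {i : M} {y : TangentBundle 𝓘(ℝ, E3) M}
    (hy : y.proj ∈ (extChartAt 𝓘(ℝ, E3) i).source) :
    ContinuousAt (fun y : TangentBundle 𝓘(ℝ, E3) M =>
      tangentCoordChange 𝓘(ℝ, E3) y.proj i y.proj y.snd) y := by
  have h1 : y ∈ (trivializationAt E3 (TangentSpace 𝓘(ℝ, E3)) i).source := by
    rw [(trivializationAt E3 (TangentSpace 𝓘(ℝ, E3)) i).mem_source, TangentBundle.trivializationAt_baseSet]
    rwa [extChartAt_source] at hy
  exact continuous_snd.continuousAt.comp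
    ((trivializationAt E3 (TangentSpace 𝓘(ℝ, E3)) i).continuousAt h1)

/-- A transport of tangent vectors from `p` to `p'`, with the expected continuity properties when
`p` and `p'` are close to each other. -/
def TransportContinuousAt (P : M → M → E3 →L[ℝ] E3) (z : M × M) : Prop :=
  ∀ w : E3, ContinuousAt (fun y : TangentBundle 𝓘(ℝ, E3) M × M =>
    (⟨y.2, P y.1.proj y.2 y.1.snd⟩ : TangentBundle 𝓘(ℝ, E3) M)) (⟨z.1, w⟩, z.2)

/-- The coordinate change of the tangent bundle between the preferred charts at `i` and `j`. -/
def chartChange (i j p : M) : E3 →L[ℝ] E3 := tangentCoordChange 𝓘(ℝ, E3) i j p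

theorem chartChange_comp_self {x y z : M} (hx : z ∈ (extChartAt 𝓘(ℝ, E3) x).source)
    (hy : z ∈ (extChartAt 𝓘(ℝ, E3) y).source) :
    (chartChange x y z).comp (chartChange y x z) = ContinuousLinearMap.id ℝ E3 :=
  tangentCoordChange_comp_self hx hy

theorem chartChange_chartChange {w x y z : M} {v : E3}
    (h : z ∈ (extChartAt 𝓘(ℝ, E3) w).source ∩ (extChartAt 𝓘(ℝ, E3) x).source
      ∩ (extChartAt 𝓘(ℝ, E3) y).source) :
    chartChange x y z (chartChange w x z v) = chartChange w y z v :=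
  tangentCoordChange_comp h

theorem localField_eq {Z : Type*} (g : Z → M) (X : Z → E3) (z₀ z : Z) :
    localField g X z₀ z = chartChange (g z) (g z₀) (g z) (X z) := rfl

section Sums

variable {ι V W : Type*} [NormedAddCommGroup V] [NormedSpace ℝ V] [NormedAddCommGroup W]
  [NormedSpace ℝ W]

theorem finsum_smul_eq_of_sum_one {r : ι → ℝ} {T : ι → V →L[ℝ] W} {T₀ : V →L[ℝ] W}
    (hr : (Function.support r).Finite) (h1 : ∑ᶠ i, r i = 1) (h : ∀ i, r i ≠ 0 → T i = T₀) :
    ∑ᶠ i, r i • T i = T₀ := by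
  have h2 : ∀ i, r i • T i = r i • T₀ := fun i => by
    by_cases h0 : r i = 0
    · rw [h0, zero_smul, zero_smul]
    · rw [h i h0]
  simp only [h2]
  rw [← finsum_smul' hr, h1, one_smul]

theorem finsum_smul_eq_sum {r : ι → ℝ} {T : ι → V →L[ℝ] W} {J : Finset ι}
    (h : ∀ i, r i ≠ 0 → i ∈ J) : ∑ᶠ i, r i • T i = ∑ i ∈ J, r i • T i :=
  finsum_eq_sum_of_support_subset _ fun i hi => h i fun h0 => hi (by simp only [h0, zero_smul])

theorem map_sum_smul_apply {U : Type*} [NormedAddCommGroup U] [NormedSpace ℝ U] (A : W →L[ℝ] U)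
    (J : Finset ι) (r : ι → ℝ) (T : ι → V →L[ℝ] W) (v : V) :
    A ((∑ i ∈ J, r i • T i) v) = ∑ i ∈ J, r i • A (T i v) := by
  simp [sum_apply]

theorem map_add_smulRight_apply {U : Type*} [NormedAddCommGroup U] [NormedSpace ℝ U]
    (A : W →L[ℝ] U) (T : V →L[ℝ] W) (c : ℝ) (l : V →L[ℝ] ℝ) (m : W →L[ℝ] ℝ) (r : W) (v : V) :
    A ((T + (c • (l - m.comp T)).smulRight r) v) = A (T v) + (c * (l v - m (T v))) • A r := by
  simp

end Sums

/-- Transport through the chart at `i`. -/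
def chartTransport (i p p' : M) : E3 →L[ℝ] E3 := (chartChange i p' p').comp (chartChange p i p)

variable [T2Space M] [SecondCountableTopology M]

/-- A connection-free parallel transport: the transports through charts are averaged with a
partition of unity at the target point. On the diagonal each chart with nonzero weight contributes
the identity. Far from the diagonal nothing is claimed. -/
theorem exists_transport : ∃ P : M → M → E3 →L[ℝ] E3,
    (∀ p, P p p = ContinuousLinearMap.id ℝ E3) ∧
      ∀ p₀, ∀ᶠ z : M × M in 𝓝 (p₀, p₀), TransportContinuousAt P z := by
  have : LocallyCompactSpace M := ChartedSpace.locallyCompactSpace E3 M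
  obtain ⟨ρ, hρ⟩ := SmoothPartitionOfUnity.exists_isSubordinate_chartAt_source 𝓘(ℝ, E3) M
  have hρs : ∀ i p, p ∈ tsupport (ρ i) → p ∈ (extChartAt 𝓘(ℝ, E3) i).source := fun i p hp => by
    rw [extChartAt_source]; exact hρ i hp
  set P : M → M → E3 →L[ℝ] E3 := fun p p' => ∑ᶠ i, (ρ i p' : ℝ) • chartTransport i p p' with hP
  refine ⟨P, fun p => ?_, fun p₀ => ?_⟩
  · exact finsum_smul_eq_of_sum_one
      ((ρ.locallyFinite.point_finite p).subset fun i hi => hi) (ρ.sum_eq_one (mem_univ p))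
      fun i hi => chartChange_comp_self (hρs i p (subset_tsupport _ hi)) (mem_extChartAt_source p)
  set J := ρ.fintsupport p₀ with hJ
  have hJs : ∀ᶠ p in 𝓝 p₀, ∀ i ∈ J, p ∈ (extChartAt 𝓘(ℝ, E3) i).source := by
    rw [Finset.eventually_all]
    exact fun i hi => (isOpen_extChartAt_source i).mem_nhds
      (hρs i p₀ ((ρ.mem_fintsupport_iff p₀ i).1 hi))
  have hev : ∀ᶠ z : M × M in 𝓝 (p₀, p₀), ((∀ i ∈ J, z.1 ∈ (extChartAt 𝓘(ℝ, E3) i).source) ∧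
      (∀ i ∈ J, z.2 ∈ (extChartAt 𝓘(ℝ, E3) i).source)) ∧ ρ.finsupport z.2 ⊆ J := by
    rw [nhds_prod_eq]
    exact ((tendsto_fst.eventually hJs).and (tendsto_snd.eventually hJs)).and
      (tendsto_snd.eventually (ρ.eventually_finsupport_subset p₀))
  filter_upwards [hev.eventually_nhds] with z hz w
  refine continuousAt_tangentBundle.2 ⟨continuousAt_snd, ?_⟩
  have hzs := hz.self_of_nhds.1
  have hproj : ContinuousAt (fun y : TangentBundle 𝓘(ℝ, E3) M × M => (y.1.proj, y.2))
      (⟨z.1, w⟩, z.2) :=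
    ((FiberBundle.continuous_proj E3 (TangentSpace 𝓘(ℝ, E3))).comp continuous_fst).prodMk
      continuous_snd |>.continuousAt
  have hc : ContinuousAt (fun y : TangentBundle 𝓘(ℝ, E3) M × M => ∑ i ∈ J, ρ i y.2 •
      chartChange i z.2 y.2
        (chartChange y.1.proj i y.1.proj y.1.snd)) (⟨z.1, w⟩, z.2) := by
    refine tendsto_finsetSum _ fun i hi => ?_
    have c1 : ContinuousAt (fun y : TangentBundle 𝓘(ℝ, E3) M × M => ρ i y.2) (⟨z.1, w⟩, z.2) :=
      ((ρ i).contMDiff.continuous.comp continuous_snd).continuousAt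
    have c2 : ContinuousAt (fun y : TangentBundle 𝓘(ℝ, E3) M × M =>
        chartChange i z.2 y.2) (⟨z.1, w⟩, z.2) :=
      ContinuousAt.comp (x := ((⟨z.1, w⟩ : TangentBundle 𝓘(ℝ, E3) M), z.2)) (f := Prod.snd)
        (continuousAt_tangentCoordChange_apply (hzs.2 i hi) (mem_extChartAt_source z.2))
        continuousAt_snd
    have c3 : ContinuousAt (fun y : TangentBundle 𝓘(ℝ, E3) M × M =>
        chartChange y.1.proj i y.1.proj y.1.snd) (⟨z.1, w⟩, z.2) :=
      ContinuousAt.comp (x := ((⟨z.1, w⟩ : TangentBundle 𝓘(ℝ, E3) M), z.2)) (f := Prod.fst)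
        (continuousAt_trivialization_snd (hzs.1 i hi)) continuousAt_fst
    exact c1.smul (c2.clm_apply c3)
  refine hc.congr ?_
  filter_upwards [hproj.eventually hz, continuousAt_snd.eventually
    (extChartAt_source_mem_nhds (I := 𝓘(ℝ, E3)) z.2)] with y hy hys
  have e1 : P y.1.proj y.2 = ∑ i ∈ J, (ρ i y.2 : ℝ) • chartTransport i y.1.proj y.2 :=
    finsum_smul_eq_sum fun i hi => hy.2 ((ρ.mem_finsupport y.2).2 hi)
  rw [localField_eq, e1]
  refine Eq.trans ?_ (map_sum_smul_apply _ J _ _ _).symm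
  refine Finset.sum_congr rfl fun i hi => ?_
  exact congrArg (fun w : E3 => (ρ i y.2 : ℝ) • w)
    (chartChange_chartChange ⟨⟨hy.1.2 i hi, mem_extChartAt_source y.2⟩, hys⟩).symm

/-- The transport is conjugated into the fixed chart at `p₀`, where its determinant is continuous at
`(p₀, p₀)` with value one. The coordinate changes have positive determinant and do not affect the
sign. -/
theorem eventually_det_pos (hM : IsOrientedAtlas 𝓘(ℝ, E3) M) {P : M → M → E3 →L[ℝ] E3} {p₀ : M}
    (h0 : P p₀ p₀ = ContinuousLinearMap.id ℝ E3) (hP : TransportContinuousAt P (p₀, p₀)) :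
    ∀ᶠ z : M × M in 𝓝 (p₀, p₀), 0 < (P z.1 z.2).det := by
  have hs := mem_extChartAt_source (I := 𝓘(ℝ, E3)) p₀
  set X : E3 → M × M → E3 := fun w z => P z.1 z.2 (tangentCoordChange 𝓘(ℝ, E3) p₀ z.1 z.1 w) with hX
  have hc : ∀ w, ContinuousAt (localField (fun z : M × M => z.2) (X w) (p₀, p₀)) (p₀, p₀) :=
    fun w => by
    have c0 : ContinuousAt (fun z : M × M =>
        ((⟨z.1, tangentCoordChange 𝓘(ℝ, E3) p₀ z.1 z.1 w⟩ : TangentBundle 𝓘(ℝ, E3) M), z.2))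
        (p₀, p₀) :=
      (ContinuousAt.comp (x := (p₀, p₀)) (f := Prod.fst) ((continuousOn_constField p₀ w).continuousAt
        ((isOpen_extChartAt_source p₀).mem_nhds hs)) continuousAt_fst).prodMk continuousAt_snd
    have c1 := ContinuousAt.comp_of_eq (hP w) c0 (by rw [tangentCoordChange_self hs])
    exact (continuousAt_tangentBundle.1 c1).2
  have h1 : ∀ w, localField (fun z : M × M => z.2) (X w) (p₀, p₀) (p₀, p₀) = w := fun w => by
    simp only [localField, hX, h0]
    rw [tangentCoordChange_self hs, ContinuousLinearMap.id_apply, tangentCoordChange_self hs]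
  have h2 : ∀ᶠ z in 𝓝 (p₀, p₀), 0 < det3 (localField (fun z : M × M => z.2) (X !₂[1, 0, 0]) (p₀, p₀) z)
      (localField (fun z : M × M => z.2) (X !₂[0, 1, 0]) (p₀, p₀) z)
      (localField (fun z : M × M => z.2) (X !₂[0, 0, 1]) (p₀, p₀) z) :=
    (continuousAt_det3 (hc !₂[1, 0, 0]) (hc !₂[0, 1, 0]) (hc !₂[0, 0, 1])).eventually
    (lt_mem_nhds (a := 0) (by
      simp only [h1]; simp [det3_eq]))
  have hs0 := extChartAt_source_mem_nhds (I := 𝓘(ℝ, E3)) p₀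
  have hs1 := (continuous_fst (X := M) (Y := M)).continuousAt.preimage_mem_nhds (x := (p₀, p₀)) hs0
  have hs2 := (continuous_snd (X := M) (Y := M)).continuousAt.preimage_mem_nhds (x := (p₀, p₀)) hs0
  filter_upwards [h2, hs1, hs2] with z h3 h4 h5
  simp only [localField, hX, det3_map] at h3
  have d1 := hM.det_tangentCoordChange_pos (mem_extChartAt_source z.2) h5
  have d2 := hM.det_tangentCoordChange_pos h4 (mem_extChartAt_source z.1)
  have d3 : det3 (!₂[1, 0, 0] : E3) !₂[0, 1, 0] !₂[0, 0, 1] = 1 := by simp [det3_eq]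
  rw [d3, mul_one] at h3
  by_contra hle
  have := mul_nonpos_of_nonpos_of_nonneg (not_lt.1 hle) d2.le
  exact absurd h3 (not_lt.2 (mul_nonpos_of_nonneg_of_nonpos d1.le this))

/-- A transport that preserves the contact form. -/
theorem IsContactForm.exists_transport {α : (p : M) → TangentSpace 𝓘(ℝ, E3) p →L[ℝ] ℝ}
    (hα : IsContactForm α) : ∃ P : M → M → E3 →L[ℝ] E3,
    (∀ p, P p p = ContinuousLinearMap.id ℝ E3) ∧ (∀ p p' w, α p' (P p p' w) = (α p w : ℝ)) ∧
      ∀ p₀, ∀ᶠ z : M × M in 𝓝 (p₀, p₀), TransportContinuousAt P z := by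
  obtain ⟨P, hP, hPc⟩ := _root_.exists_transport (M := M)
  obtain ⟨R, hR, hRp⟩ := hα.exists_pos_field
  set a : M → E3 →L[ℝ] ℝ := fun p => α p with ha
  have hRp' : ∀ p, a p (R p) ≠ 0 := fun p => (hRp p).ne'
  -- A multiple of the positive field `R` corrects the value of `α`. On the diagonal the correction
  -- is zero.
  refine ⟨fun p p' => P p p' + ((a p' (R p'))⁻¹ • (a p - (a p').comp (P p p'))).smulRight (R p'),
    fun p => ?_, fun p p' w => ?_, fun p₀ => ?_⟩
  · beta_reduce; rw [hP]; ext w; simp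
  · show a p' _ = a p w
    simp only [add_apply, ContinuousLinearMap.smulRight_apply, smul_apply, map_add, map_smul,
      smul_eq_mul, sub_apply, ContinuousLinearMap.comp_apply]
    have := hRp' p'
    field_simp
    ring
  · filter_upwards [hPc p₀] with z hz w
    have c1 := hz w
    have hac := hα.smooth.continuous
    have c2 : ContinuousAt (fun y : TangentBundle 𝓘(ℝ, E3) M × M =>
        a y.2 (P y.1.proj y.2 y.1.snd)) (⟨z.1, w⟩, z.2) :=
      ContinuousAt.comp (g := fun z : TangentBundle 𝓘(ℝ, E3) M => α z.proj z.snd)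
        hac.continuousAt c1
    have c3 : Continuous (fun y : TangentBundle 𝓘(ℝ, E3) M × M => a y.1.proj y.1.snd) :=
      hac.comp continuous_fst
    have hR2 : IsContField (fun y : TangentBundle 𝓘(ℝ, E3) M × M => y.2) (fun y => R y.2) :=
      hR.comp continuous_snd
    have c4 : Continuous (fun y : TangentBundle 𝓘(ℝ, E3) M × M => a y.2 (R y.2)) :=
      hα.continuous_apply hR2
    refine continuousAt_tangentBundle.2 ⟨continuousAt_snd, ?_⟩
    have c5 := (continuousAt_tangentBundle.1 c1).2.add
      (((c4.continuousAt.inv₀ (hRp' _)).mul (c3.continuousAt.sub c2)).smul (hR2.2 (⟨z.1, w⟩, z.2)))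
    refine c5.congr (Eventually.of_forall fun y => ?_)
    exact (map_add_smulRight_apply _ _ _ _ _ _ _).symm

end Transport


/-! ### Transport of contact frames along a homotopy -/

section FrameTransport

variable {M : Type*} [TopologicalSpace M] [ChartedSpace E3 M] [IsManifold 𝓘(ℝ, E3) ∞ M]
variable {Z Z' : Type*} [TopologicalSpace Z] [TopologicalSpace Z']
variable {α : (p : M) → TangentSpace 𝓘(ℝ, E3) p →L[ℝ] ℝ}

theorem IsPositiveFrame.map {p p' : M} {u v : E3} (h : IsPositiveFrame α p u v) {A : E3 →L[ℝ] E3}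
    (hA : 0 < A.det) (hAα : ∀ w : E3, (α p' (A w) : ℝ) = α p w) :
    IsPositiveFrame α p' (A u) (A v) := by
  refine ⟨(hAα u).trans h.1, (hAα v).trans h.2.1, fun R hR => ?_⟩
  obtain ⟨R, rfl⟩ := (A.toContinuousLinearEquivOfDetNeZero hA.ne').surjective R
  have hR' : (0 : ℝ) < α p R := by rw [← hAα R]; exact hR
  exact (det3_map A u v R).symm ▸ mul_pos hA (h.2.2 R hR')

theorem IsContField.transport {P : M → M → E3 →L[ℝ] E3} {g : Z → M} {X : Z → E3}
    (hX : IsContField g X) {w : Z' → Z} (hw : Continuous w) {g' : Z' → M} (hg' : Continuous g')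
    (hP : ∀ z, TransportContinuousAt P (g (w z), g' z)) :
    IsContField g' (fun z => P (g (w z)) (g' z) (X (w z))) := by
  refine isContField_iff.2 (continuous_iff_continuousAt.2 fun z => ?_)
  have h1 : ContinuousAt (fun z => ((⟨g (w z), X (w z)⟩ : TangentBundle 𝓘(ℝ, E3) M), g' z)) z :=
    ((isContField_iff.1 (hX.comp hw)).prodMk hg').continuousAt
  exact ContinuousAt.comp (x := z) (f := fun z => ((⟨g (w z), X (w z)⟩ : TangentBundle 𝓘(ℝ, E3) M), g' z)) (g := fun y : TangentBundle 𝓘(ℝ, E3) M × M =>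
    (⟨y.2, P y.1.proj y.2 y.1.snd⟩ : TangentBundle 𝓘(ℝ, E3) M)) (hP z (X (w z))) h1

variable [T2Space M] [SecondCountableTopology M]

/-- Frames of the contact structure can be transported along a homotopy for a short time. -/
theorem IsContactForm.exists_frame_transport [CompactSpace Z] (hM : IsOrientedAtlas 𝓘(ℝ, E3) M)
    (hα : IsContactForm α) {F : ℝ → Z → M} (hF : Continuous (Function.uncurry F)) (t₀ : ℝ) :
    ∃ δ > 0, ∀ t t' : ℝ, |t - t₀| < δ → |t' - t₀| < δ → ∀ X Y : Z → E3,
      IsContField (F t) X → IsContField (F t) Y → (∀ x, IsPositiveFrame α (F t x) (X x) (Y x)) →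
      ∃ X' Y' : unitInterval → Z → E3,
        IsContField (fun z : unitInterval × Z => F (t + z.1 * (t' - t)) z.2) (Function.uncurry X') ∧
        IsContField (fun z : unitInterval × Z => F (t + z.1 * (t' - t)) z.2) (Function.uncurry Y') ∧
        (∀ (s : unitInterval) x, IsPositiveFrame α (F (t + s * (t' - t)) x) (X' s x) (Y' s x)) ∧
        X' 0 = X ∧ Y' 0 = Y := by
  obtain ⟨P, hP1, hPα, hPc⟩ := hα.exists_transport
  have hgood : ∀ p₀, ∀ᶠ z : M × M in 𝓝 (p₀, p₀), TransportContinuousAt P z ∧ 0 < (P z.1 z.2).det :=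
    fun p₀ => (hPc p₀).and (eventually_det_pos hM (hP1 p₀) (hPc p₀).self_of_nhds)
  -- The transport is well behaved only near the diagonal. Compactness of `Z` gives one time
  -- interval that is short enough for all points.
  have hev : ∀ᶠ s : ℝ × ℝ in 𝓝 (t₀, t₀), ∀ x ∈ (univ : Set Z),
      TransportContinuousAt P (F s.1 x, F s.2 x) ∧ 0 < (P (F s.1 x) (F s.2 x)).det := by
    refine isCompact_univ.eventually_forall_of_forall_eventually fun x _ => ?_
    have hc : Continuous (fun z : (ℝ × ℝ) × Z => (F z.1.1 z.2, F z.1.2 z.2)) :=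
      (hF.comp (continuous_fst.fst.prodMk continuous_snd)).prodMk
        (hF.comp (continuous_fst.snd.prodMk continuous_snd))
    exact hc.continuousAt (x := ((t₀, t₀), x)) |>.eventually (hgood (F t₀ x))
  obtain ⟨δ, hδ, h⟩ := Metric.eventually_nhds_iff.1 hev
  refine ⟨δ, hδ, fun t t' ht ht' X Y hX hY hXY => ?_⟩
  have hs : ∀ s : unitInterval, |t + s * (t' - t) - t₀| < δ := fun s => by
    have e : t + s * (t' - t) - t₀ = (1 - s) * (t - t₀) + s * (t' - t₀) := by ring
    rw [abs_lt] at ht ht' ⊢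
    rw [e]
    have h0 := s.2.1
    have h1 := s.2.2
    rcases eq_or_lt_of_le h0 with h2 | h2
    · rw [← h2]; constructor <;> linarith
    · constructor <;> nlinarith
  have hgs : ∀ (s : unitInterval) x, TransportContinuousAt P (F t x, F (t + s * (t' - t)) x) ∧
      0 < (P (F t x) (F (t + s * (t' - t)) x)).det := fun s x =>
    h (y := (t, t + s * (t' - t))) (by
      rw [Prod.dist_eq, max_lt_iff]
      exact ⟨ht, hs s⟩) x (mem_univ x)
  have hFc : Continuous (fun z : unitInterval × Z => F (t + z.1 * (t' - t)) z.2) :=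
    hF.comp ((by fun_prop : Continuous fun z : unitInterval × Z => t + z.1 * (t' - t)).prodMk
      continuous_snd)
  refine ⟨fun s x => P (F t x) (F (t + s * (t' - t)) x) (X x),
    fun s x => P (F t x) (F (t + s * (t' - t)) x) (Y x),
    hX.transport continuous_snd hFc fun z => (hgs z.1 z.2).1,
    hY.transport continuous_snd hFc fun z => (hgs z.1 z.2).1,
    fun s x => (hXY x).map (hgs s x).2 (hPα _ _), ?_, ?_⟩ <;>
  · ext1 x
    simp only [Icc.coe_zero, zero_mul, add_zero, hP1]
    rfl

end FrameTransport


/-! ### Fields along the boundary of a moving surface -/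

section BoundaryFields

variable {M : Type*} [TopologicalSpace M] [ChartedSpace E3 M] [IsManifold 𝓘(ℝ, E3) ∞ M]
variable {S : Type*} [TopologicalSpace S] [ChartedSpace (EuclideanHalfSpace 2) S]
  [IsManifold (𝓡∂ 2) ∞ S]

theorem curveVelocity_periodic {E H N : Type*} [NormedAddCommGroup E] [NormedSpace ℝ E]
    [TopologicalSpace H] {I : ModelWithCorners ℝ E H} [TopologicalSpace N] [ChartedSpace H N]
    {c : ℝ → N} (hc : MDifferentiable 𝓘(ℝ, ℝ) I c) (hp : Function.Periodic c 1) :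
    Function.Periodic (curveVelocity I c) 1 := fun θ => by
  have h1 : MDifferentiableAt 𝓘(ℝ, ℝ) 𝓘(ℝ, ℝ) (fun θ : ℝ => θ + 1) θ :=
    (differentiableAt_id.add_const 1).mdifferentiableAt
  have h2 : curveVelocity 𝓘(ℝ, ℝ) (fun θ : ℝ => θ + 1) θ = 1 :=
    (hasDerivAt_extChartAt_comp h1).unique ((hasDerivAt_id θ).add_const 1)
  have h3 := curveVelocity_comp (g := c) (c := fun θ : ℝ => θ + 1) (hc (θ + 1)) h1
  rw [h2, show c ∘ (fun θ : ℝ => θ + 1) = c from funext hp] at h3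
  exact h3.symm

/-- A continuous field of tangent vectors of a surface along a curve. -/
def IsContSurfaceField (b : ℝ → S) (u : ℝ → E2) : Prop :=
  ∀ θ₀, ContinuousAt (fun θ => tangentCoordChange (𝓡∂ 2) (b θ) (b θ₀) (b θ) (u θ)) θ₀

/-- The velocities of the curves `F t ∘ b` form a continuous field. -/
theorem isContField_velocity {F : ℝ → S → M}
    (hF : ContMDiff (𝓘(ℝ, ℝ).prod (𝓡∂ 2)) 𝓘(ℝ, E3) ∞ (fun z : ℝ × S => F z.1 z.2)) {b : ℝ → S}
    (hb : ContMDiff 𝓘(ℝ, ℝ) (𝓡∂ 2) ∞ b) :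
    IsContField (fun z : ℝ × ℝ => F z.1 (b z.2))
      (fun z => velocity (fun θ => F z.1 (b θ)) z.2) := by
  refine ⟨hF.continuous.comp (continuous_fst.prodMk (hb.continuous.comp continuous_snd)),
    fun z₀ => ?_⟩
  have h1 : ContMDiff ((𝓘(ℝ, ℝ).prod 𝓘(ℝ, ℝ)).prod 𝓘(ℝ, ℝ)) 𝓘(ℝ, E3) ∞
      (Function.uncurry fun (z : ℝ × ℝ) (θ : ℝ) => F z.1 (b θ)) :=
    hF.comp ((contMDiff_fst.comp contMDiff_fst).prodMk (hb.comp contMDiff_snd))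
  have h2 := (continuousAt_localDeriv (J := 𝓘(ℝ, ℝ).prod 𝓘(ℝ, ℝ)) (I := 𝓘(ℝ, ℝ)) (I' := 𝓘(ℝ, E3))
    (f := fun (z : ℝ × ℝ) (θ : ℝ) => F z.1 (b θ)) (g := Prod.snd) (z₀ := z₀)
    (h1.of_le (by simp) (z₀, z₀.2)) continuous_snd).clm_apply (continuousAt_const (y := (1 : ℝ)))
  refine h2.congr (Eventually.of_forall fun z => ?_)
  simp only [localDeriv, tangentCoordChange_model_space, ContinuousLinearMap.comp_id]
  rfl

/-- One tangent field on the boundary in `S`, pushed forward by `F t`, supplies the Seifert framing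
at all times of the isotopy. -/
theorem IsContSurfaceField.isContField {F : ℝ → S → M}
    (hF : ContMDiff (𝓘(ℝ, ℝ).prod (𝓡∂ 2)) 𝓘(ℝ, E3) ∞ (fun z : ℝ × S => F z.1 z.2)) {b : ℝ → S}
    (hb : ContMDiff 𝓘(ℝ, ℝ) (𝓡∂ 2) ∞ b) {u : ℝ → E2} (hu : IsContSurfaceField b u) :
    IsContField (fun z : ℝ × ℝ => F z.1 (b z.2))
      (fun z => coordDeriv (𝓡∂ 2) 𝓘(ℝ, E3) (F z.1) (b z.2) (u z.2)) := by
  refine ⟨hF.continuous.comp (continuous_fst.prodMk (hb.continuous.comp continuous_snd)),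
    fun z₀ => ?_⟩
  have h1 : ContMDiff ((𝓘(ℝ, ℝ).prod 𝓘(ℝ, ℝ)).prod (𝓡∂ 2)) 𝓘(ℝ, E3) ∞
      (Function.uncurry fun (z : ℝ × ℝ) (x : S) => F z.1 x) :=
    hF.comp ((contMDiff_fst.comp contMDiff_fst).prodMk contMDiff_snd)
  have hbc : Continuous fun z : ℝ × ℝ => b z.2 := hb.continuous.comp continuous_snd
  have h2 := (continuousAt_localDeriv (J := 𝓘(ℝ, ℝ).prod 𝓘(ℝ, ℝ)) (I := 𝓡∂ 2) (I' := 𝓘(ℝ, E3))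
    (f := fun (z : ℝ × ℝ) (x : S) => F z.1 x) (g := fun z => b z.2) (z₀ := z₀)
    (h1.of_le (by simp) (z₀, b z₀.2)) hbc).clm_apply
      (ContinuousAt.comp (x := z₀) (f := Prod.snd) (hu z₀.2) continuous_snd.continuousAt)
  refine h2.congr ?_
  filter_upwards [hbc.continuousAt.preimage_mem_nhds
    (extChartAt_source_mem_nhds (I := 𝓡∂ 2) (b z₀.2))] with z hz
  have h3 : tangentCoordChange (𝓡∂ 2) (b z₀.2) (b z.2) (b z.2)
      (tangentCoordChange (𝓡∂ 2) (b z.2) (b z₀.2) (b z.2) (u z.2)) = u z.2 :=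
    congrArg (fun L : E2 →L[ℝ] E2 => L (u z.2))
      (tangentCoordChange_comp_self (I := 𝓡∂ 2) hz (mem_extChartAt_source (b z.2)))
  simp only [localDeriv, Function.comp_apply, ContinuousLinearMap.comp_apply]
  rw [h3]
  rfl

theorem E2.eq_cramer {D : E2 →L[ℝ] E3} {c : E3} (hc : det3 (D !₂[1, 0]) (D !₂[0, 1]) c ≠ 0) (u : E2) :
    u = !₂[det3 (D u) (D !₂[0, 1]) c / det3 (D !₂[1, 0]) (D !₂[0, 1]) c,
      det3 (D !₂[1, 0]) (D u) c / det3 (D !₂[1, 0]) (D !₂[0, 1]) c] := by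
  rw [det3_map_plane D u, det3_map_plane D _ u, mul_div_cancel_right₀ _ hc,
    mul_div_cancel_right₀ _ hc]
  ext i
  fin_cases i <;> simp [det2_eq]

/-- A field tangent to an immersed surface that is continuous as a field of the ambient manifold is
continuous. -/
theorem isContSurfaceField_of_isContField {f : S → M} (hf : ContMDiff (𝓡∂ 2) 𝓘(ℝ, E3) ∞ f)
    {b : ℝ → S} (hb : Continuous b)
    (himm : ∀ x, Function.Injective (coordDeriv (𝓡∂ 2) 𝓘(ℝ, E3) f x)) {u : ℝ → E2}
    (h : IsContField (fun θ => f (b θ)) (fun θ => coordDeriv (𝓡∂ 2) 𝓘(ℝ, E3) f (b θ) (u θ))) :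
    IsContSurfaceField b u := fun θ₀ => by
  set D : ℝ → E2 →L[ℝ] E3 := fun θ => localDeriv (𝓡∂ 2) 𝓘(ℝ, E3) f (b θ₀) (f (b θ₀)) (b θ) with hD
  have hDc : ContinuousAt D θ₀ := continuousAt_localDeriv (J := 𝓘(ℝ, ℝ)) (f := fun _ => f) (g := b)
    (ContMDiffAt.comp (θ₀, b θ₀) (g := f) (f := Prod.snd) (hf.of_le (by simp) (b θ₀))
      contMDiffAt_snd) hb
  have hD0 : D θ₀ = coordDeriv (𝓡∂ 2) 𝓘(ℝ, E3) f (b θ₀) := localDeriv_self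
  obtain ⟨c, hc⟩ := exists_det3_neg (himm (b θ₀))
  set û : ℝ → E2 := fun θ => tangentCoordChange (𝓡∂ 2) (b θ) (b θ₀) (b θ) (u θ) with hû
  have e1 : ContinuousAt (fun θ => D θ !₂[1, 0]) θ₀ := hDc.clm_apply continuousAt_const
  have e2 : ContinuousAt (fun θ => D θ !₂[0, 1]) θ₀ := hDc.clm_apply continuousAt_const
  have ec : ContinuousAt (fun _ : ℝ => c) θ₀ := continuousAt_const
  have hmem : ∀ᶠ θ in 𝓝 θ₀, b θ ∈ (extChartAt (𝓡∂ 2) (b θ₀)).source :=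
    hb.continuousAt.preimage_mem_nhds (extChartAt_source_mem_nhds (I := 𝓡∂ 2) (b θ₀))
  have hDu : ∀ᶠ θ in 𝓝 θ₀, localField (fun θ => f (b θ))
      (fun θ => coordDeriv (𝓡∂ 2) 𝓘(ℝ, E3) f (b θ) (u θ)) θ₀ θ = D θ (û θ) := by
    filter_upwards [hmem] with θ hθ
    have h3 : tangentCoordChange (𝓡∂ 2) (b θ₀) (b θ) (b θ) (û θ) = u θ :=
      congrArg (fun L : E2 →L[ℝ] E2 => L (u θ))
        (tangentCoordChange_comp_self (I := 𝓡∂ 2) hθ (mem_extChartAt_source (b θ)))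
    simp only [hD, localDeriv, ContinuousLinearMap.comp_apply]
    rw [h3]
    rfl
  have eu : ContinuousAt (fun θ => D θ (û θ)) θ₀ := (h.2 θ₀).congr hDu
  have c0 := continuousAt_det3 e1 e2 ec
  have hne : det3 (D θ₀ !₂[1, 0]) (D θ₀ !₂[0, 1]) c ≠ 0 := by rw [hD0]; exact hc.ne
  have c1 := (continuousAt_det3 eu e2 ec).div c0 hne
  have c2 := (continuousAt_det3 e1 eu ec).div c0 hne
  have c3 : ContinuousAt (fun θ => (!₂[det3 (D θ (û θ)) (D θ !₂[0, 1]) c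
      / det3 (D θ !₂[1, 0]) (D θ !₂[0, 1]) c, det3 (D θ !₂[1, 0]) (D θ (û θ)) c
      / det3 (D θ !₂[1, 0]) (D θ !₂[0, 1]) c] : E2)) θ₀ := by
    refine (PiLp.continuous_toLp 2 _).continuousAt.comp (continuousAt_pi.2 fun i => ?_)
    fin_cases i
    · exact c1
    · exact c2
  refine c3.congr ?_
  filter_upwards [c0.eventually_ne hne] with θ hθ
  exact (E2.eq_cramer hθ _).symm

end BoundaryFields


/-! ### Coordinates in a frame, and the class of a vector modulo a line -/

section FrameCoordinates

/-- The linear map with columns `a`, `b`, `c`. -/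
def frameMap (a b c : E3) : E3 →L[ℝ] E3 :=
  (EuclideanSpace.proj (𝕜 := ℝ) (0 : Fin 3)).smulRight a
    + (EuclideanSpace.proj (𝕜 := ℝ) (1 : Fin 3)).smulRight b
    + (EuclideanSpace.proj (𝕜 := ℝ) (2 : Fin 3)).smulRight c

theorem frameMap_apply (a b c x : E3) : frameMap a b c x = x 0 • a + x 1 • b + x 2 • c := rfl

theorem det_frameMap (a b c : E3) : (frameMap a b c).det = det3 a b c := by
  rw [det_eq_det3]; simp [frameMap_apply]

/-- The coordinates of `v` in the basis `a`, `b`, `c`. -/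
def frameCoord (a b c v : E3) : E3 :=
  !₂[det3 v b c / det3 a b c, det3 a v c / det3 a b c, det3 a b v / det3 a b c]

theorem frameCoord_frameMap {a b c : E3} (h : det3 a b c ≠ 0) (x : E3) :
    frameCoord a b c (frameMap a b c x) = x := by
  have e0 : det3 (frameMap a b c x) b c = x 0 * det3 a b c := by
    simp only [frameMap_apply, det3_eq, PiLp.add_apply, PiLp.smul_apply, smul_eq_mul]; ring
  have e1 : det3 a (frameMap a b c x) c = x 1 * det3 a b c := by
    simp only [frameMap_apply, det3_eq, PiLp.add_apply, PiLp.smul_apply, smul_eq_mul]; ring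
  have e2 : det3 a b (frameMap a b c x) = x 2 * det3 a b c := by
    simp only [frameMap_apply, det3_eq, PiLp.add_apply, PiLp.smul_apply, smul_eq_mul]; ring
  rw [frameCoord, e0, e1, e2, mul_div_cancel_right₀ _ h, mul_div_cancel_right₀ _ h,
    mul_div_cancel_right₀ _ h]
  ext i; fin_cases i <;> rfl

theorem frameMap_frameCoord {a b c : E3} (h : det3 a b c ≠ 0) (v : E3) :
    frameMap a b c (frameCoord a b c v) = v := by
  obtain ⟨x, rfl⟩ := ((frameMap a b c).toContinuousLinearEquivOfDetNeZero
    (by rwa [det_frameMap])).surjective v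
  exact congrArg (frameMap a b c) (frameCoord_frameMap h x)

theorem det3_frameCoord {a b c : E3} (h : det3 a b c ≠ 0) (u v w : E3) :
    det3 u v w = det3 a b c * det3 (frameCoord a b c u) (frameCoord a b c v) (frameCoord a b c w) := by
  conv_lhs => rw [← frameMap_frameCoord h u, ← frameMap_frameCoord h v, ← frameMap_frameCoord h w]
  rw [det3_map, det_frameMap]

theorem frameCoord_eq {a b c : E3} (h : det3 a b c ≠ 0) {v : E3} {p q r : ℝ}
    (hv : v = p • a + q • b + r • c) : frameCoord a b c v = !₂[p, q, r] := by
  rw [← frameCoord_frameMap h !₂[p, q, r], hv]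
  rfl

theorem continuous_E3 {Z : Type*} [TopologicalSpace Z] {f g h : Z → ℝ} (hf : Continuous f)
    (hg : Continuous g) (hh : Continuous h) : Continuous fun z => (!₂[f z, g z, h z] : E3) := by
  refine (PiLp.continuous_toLp 2 _).comp (continuous_pi fun i => ?_)
  fin_cases i
  exacts [hf, hg, hh]

theorem continuous_frameCoord {M : Type*} [TopologicalSpace M] [ChartedSpace E3 M]
    [IsManifold 𝓘(ℝ, E3) ∞ M] (hM : IsOrientedAtlas 𝓘(ℝ, E3) M) {Z : Type*} [TopologicalSpace Z]
    {g : Z → M} {a b c v : Z → E3} (ha : IsContField g a) (hb : IsContField g b)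
    (hc : IsContField g c) (hv : IsContField g v) (h : ∀ z, det3 (a z) (b z) (c z) ≠ 0) :
    Continuous fun z => frameCoord (a z) (b z) (c z) (v z) :=
  continuous_E3 (hv.continuous_det3_div hM hb hc ha hb hc h)
    (ha.continuous_det3_div hM hv hc ha hb hc h) (ha.continuous_det3_div hM hb hv ha hb hc h)

/-- The scalar product. -/
def dot3 (u v : E3) : ℝ := u 0 * v 0 + u 1 * v 1 + u 2 * v 2

/-- The vector product. -/
def cross3 (u v : E3) : E3 :=
  !₂[u 1 * v 2 - u 2 * v 1, u 2 * v 0 - u 0 * v 2, u 0 * v 1 - u 1 * v 0]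

/-- The Gram determinant of two vectors. -/
def gram3 (u v : E3) : ℝ := dot3 u u * dot3 v v - dot3 u v ^ 2

theorem gram3_eq (u v : E3) : gram3 u v = (u 1 * v 2 - u 2 * v 1) ^ 2 + (u 2 * v 0 - u 0 * v 2) ^ 2
    + (u 0 * v 1 - u 1 * v 0) ^ 2 := by
  simp only [gram3, dot3]; ring

theorem det3_cross3 (u v : E3) : det3 u v (cross3 u v) = gram3 u v := by
  rw [gram3_eq]; simp [det3_eq, cross3]; ring

theorem gram3_pos {u v w : E3} (h : det3 u v w ≠ 0) : 0 < gram3 u v := by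
  rw [gram3_eq]
  by_contra hle
  have a0 := sq_nonneg (u 1 * v 2 - u 2 * v 1)
  have a1 := sq_nonneg (u 2 * v 0 - u 0 * v 2)
  have a2 := sq_nonneg (u 0 * v 1 - u 1 * v 0)
  have b0 : u 1 * v 2 - u 2 * v 1 = 0 := pow_eq_zero_iff two_ne_zero |>.1 (by linarith)
  have b1 : u 2 * v 0 - u 0 * v 2 = 0 := pow_eq_zero_iff two_ne_zero |>.1 (by linarith)
  have b2 : u 0 * v 1 - u 1 * v 0 = 0 := pow_eq_zero_iff two_ne_zero |>.1 (by linarith)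
  refine h ?_
  rw [det3_eq]
  linear_combination w 0 * b0 + w 1 * b1 + w 2 * b2

/-- The class of `y` in the oriented plane `ℝ³ / ℝ x`, in a frame with first vector a positive
multiple of `s`. -/
def twist (x s y : E3) : ℂ := ⟨dot3 x x * dot3 s y - dot3 x s * dot3 x y, det3 x s y⟩

theorem twist_re (x s y : E3) : (twist x s y).re = dot3 x x * dot3 s y - dot3 x s * dot3 x y := rfl

theorem twist_im (x s y : E3) : (twist x s y).im = det3 x s y := rfl

theorem twist_add (x s y y' : E3) : twist x s (y + y') = twist x s y + twist x s y' := by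
  apply Complex.ext <;> simp [twist, det3_eq, dot3] <;> ring

theorem twist_smul (x s y : E3) (k : ℝ) : twist x s (k • y) = k * twist x s y := by
  apply Complex.ext <;> simp [twist, det3_eq, dot3] <;> ring

theorem twist_self (x s : E3) : twist x s x = 0 := by
  apply Complex.ext <;> simp [twist, det3_eq, dot3] <;> ring

theorem twist_right (x s : E3) : twist x s s = gram3 x s := by
  apply Complex.ext
  · rw [twist_re, Complex.ofReal_re, gram3]; ring
  · rw [twist_im, Complex.ofReal_im, det3_eq]; ring

/-- This justifies `twist`: modulo `x`, its real and imaginary parts are, up to the common factor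
`gram3 x s`, the coordinates of `y` along `s` and `x × s`. The polynomial form avoids denominators.
-/
theorem smul_eq_twist (x s y : E3) : (dot3 x x * gram3 x s) • y =
    (dot3 x x * (twist x s y).re) • s + (dot3 x x * (twist x s y).im) • cross3 x s
      + (gram3 x s * dot3 x y - (twist x s y).re * dot3 x s) • x := by
  ext i
  fin_cases i <;> simp [twist, det3_eq, dot3, gram3, cross3] <;> ring

theorem dot3_self_pos {x : E3} (h : x ≠ 0) : 0 < dot3 x x := by
  by_contra hle
  simp only [dot3] at hle
  have h0 : x 0 = 0 := by nlinarith [mul_self_nonneg (x 0), mul_self_nonneg (x 1), mul_self_nonneg (x 2)]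
  have h1 : x 1 = 0 := by nlinarith [mul_self_nonneg (x 0), mul_self_nonneg (x 1), mul_self_nonneg (x 2)]
  have h2 : x 2 = 0 := by nlinarith [mul_self_nonneg (x 0), mul_self_nonneg (x 1), mul_self_nonneg (x 2)]
  exact h (by ext i; fin_cases i <;> simp [h0, h1, h2])

theorem left_ne_zero_of_det3 {u v w : E3} (h : det3 u v w ≠ 0) : u ≠ 0 := by
  rintro rfl
  exact h (by simp [det3_eq])

/-- The expansion of `y` in the frame `(s, x × s, x)`. -/
theorem eq_twist_expansion {x s c : E3} (h : det3 x s c ≠ 0) (y : E3) :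
    y = ((twist x s y).re / gram3 x s) • s + ((twist x s y).im / gram3 x s) • cross3 x s
      + ((gram3 x s * dot3 x y - (twist x s y).re * dot3 x s) / (dot3 x x * gram3 x s)) • x := by
  have h1 := gram3_pos h
  have h2 := dot3_self_pos (left_ne_zero_of_det3 h)
  have h3 := congrArg (fun v : E3 => (dot3 x x * gram3 x s)⁻¹ • v) (smul_eq_twist x s y)
  simp only [smul_add, smul_smul] at h3
  rw [inv_mul_cancel₀ (mul_pos h2 h1).ne', one_smul] at h3
  conv_lhs => rw [h3]
  congr 1
  · congr 1 <;> congr 1 <;> field_simp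
  · congr 1; field_simp

/-- The class of `y` vanishes only if `y` is a multiple of `x`. The plane of vectors with third
coordinate zero, which stands for `ξ`, meets the line of `x` trivially. -/
theorem twist_ne_zero {x s c y : E3} (h : det3 x s c ≠ 0) (hx : x 2 ≠ 0) (hy : y 2 = 0)
    (hy0 : y ≠ 0) : twist x s y ≠ 0 := fun h0 => by
  have h1 := gram3_pos h
  have h2 := dot3_self_pos (left_ne_zero_of_det3 h)
  have h3 := eq_twist_expansion h y
  rw [h0] at h3
  simp only [Complex.zero_re, Complex.zero_im, zero_div, zero_smul, zero_add] at h3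
  set k := (gram3 x s * dot3 x y - 0 * dot3 x s) / (dot3 x x * gram3 x s)
  have h4 : y 2 = k * x 2 := congrArg (fun v : E3 => v 2) h3
  have h5 : k = 0 := by
    rw [hy] at h4
    exact (mul_eq_zero.1 h4.symm).resolve_right hx
  exact hy0 (by rw [h3, h5, zero_smul])

/-- This is the origin of the sign `ε`: the projection of the coordinate plane to `ℝ³ / ℝ x`
preserves or reverses orientation according to the sign of `x 2`. -/
theorem twist_det (x s : E3) : (twist x s !₂[1, 0, 0]).re * (twist x s !₂[0, 1, 0]).im
    - (twist x s !₂[1, 0, 0]).im * (twist x s !₂[0, 1, 0]).re = gram3 x s * x 2 := by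
  simp [twist, det3_eq, dot3, gram3]; ring

theorem continuous_twist {Z : Type*} [TopologicalSpace Z] {x s y : Z → E3} (hx : Continuous x)
    (hs : Continuous s) (hy : Continuous y) : Continuous fun z => twist (x z) (s z) (y z) := by
  have c : ∀ {x : Z → E3}, Continuous x → ∀ i : Fin 3, Continuous fun z => x z i := fun hx i =>
    (EuclideanSpace.proj (𝕜 := ℝ) (i : Fin 3)).continuous.comp hx
  have := c hx; have := c hs; have := c hy
  refine Complex.equivRealProdCLM.symm.continuous.comp
    (f := fun z => ((twist (x z) (s z) (y z)).re, (twist (x z) (s z) (y z)).im)) ?_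
  simp only [twist_re, twist_im, dot3, det3_eq]
  fun_prop

/-- Two vectors spanning the same oriented line modulo `x` have non-antiparallel classes. -/
theorem twist_add_mul_ne_zero {x s c : E3} (h : 0 < det3 x s c) {p q r k : ℝ} (hk : 0 ≤ k)
    (hpq : (p : ℂ) + q * Complex.I ≠ 0) :
    twist x s (p • s + q • c + r • x) + k * ((p : ℂ) + q * Complex.I) ≠ 0 := fun h0 => by
  have h1 := gram3_pos h.ne'
  rw [twist_add, twist_add, twist_smul, twist_smul, twist_smul, twist_self, twist_right] at h0
  have hi := congrArg Complex.im h0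
  have hr := congrArg Complex.re h0
  simp [twist_im] at hi hr
  have hq : q = 0 := by
    have : q * (det3 x s c + k) = 0 := by linarith
    exact (mul_eq_zero.1 this).resolve_right (by linarith)
  have hp : p = 0 := by
    rw [hq] at hr
    have : p * (gram3 x s + k) = 0 := by linarith
    exact (mul_eq_zero.1 this).resolve_right (by linarith)
  exact hpq (by simp [hp, hq])

end FrameCoordinates


/-! ### Winding numbers carried along the isotopy of surfaces -/

section TransverseIsotopy

variable {M : Type*} [TopologicalSpace M] [ChartedSpace E3 M] [IsManifold 𝓘(ℝ, E3) ∞ M]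
variable {S : Type*} [TopologicalSpace S] [ChartedSpace (EuclideanHalfSpace 2) S]
  [IsManifold (𝓡∂ 2) ∞ S]
variable {α : (p : M) → TangentSpace 𝓘(ℝ, E3) p →L[ℝ] ℝ}

/-- An isotopy of surfaces, immersed for `0 ≤ t ≤ 1`, whose boundary is transverse to `ker α` for
`0 < t ≤ 1` with sign `ε`, together with an outward vector field `u` along the boundary. -/
structure IsTransverseIsotopy (α : (p : M) → TangentSpace 𝓘(ℝ, E3) p →L[ℝ] ℝ) (ε : ℤ)
    (F : ℝ → S → M) (b : ℝ → S) (u : ℝ → E2) : Prop where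
  smooth : ContMDiff (𝓘(ℝ, ℝ).prod (𝓡∂ 2)) 𝓘(ℝ, E3) ∞ (fun z : ℝ × S => F z.1 z.2)
  boundary : IsBoundaryCurve b
  immersion : ∀ t ∈ Icc (0 : ℝ) 1, ∀ x, Function.Injective (coordDeriv (𝓡∂ 2) 𝓘(ℝ, E3) (F t) x)
  transverse : ∀ t ∈ Ioc (0 : ℝ) 1, ∀ θ,
    0 < ε * (α (F t (b θ)) (velocity (fun θ' => F t (b θ')) θ) : ℝ)
  field : IsContSurfaceField b u
  periodic : Function.Periodic u 1
  outward : ∀ θ, IsOutward (u θ)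

/-- A continuous positive frame of `ker α` along `f`. -/
structure IsContFrame (α : (p : M) → TangentSpace 𝓘(ℝ, E3) p →L[ℝ] ℝ) (f : S → M) (X Y : S → E3) :
    Prop where
  left : IsContField f X
  right : IsContField f Y
  positive : ∀ x, IsPositiveFrame α (f x) (X x) (Y x)

/-- The class modulo the velocity of the boundary of the vector field with coordinates `y` in the
frame `(X, Y, R)`, in a framing that starts with the outward field `u`. -/
def boundaryTwist (R : M → E3) (f : S → M) (b : ℝ → S) (u : ℝ → E2) (X Y : S → E3) (θ : ℝ)
    (y : E3) : ℂ :=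
  twist (frameCoord (X (b θ)) (Y (b θ)) (R (f (b θ))) (velocity (fun θ' => f (b θ')) θ))
    (frameCoord (X (b θ)) (Y (b θ)) (R (f (b θ))) (coordDeriv (𝓡∂ 2) 𝓘(ℝ, E3) f (b θ) (u θ))) y

variable {ε : ℤ} {F : ℝ → S → M} {b : ℝ → S} {u : ℝ → E2}

theorem IsTransverseIsotopy.contMDiff (h : IsTransverseIsotopy α ε F b u) (t : ℝ) :
    ContMDiff (𝓡∂ 2) 𝓘(ℝ, E3) ∞ (F t) :=
  h.smooth.comp (contMDiff_const.prodMk contMDiff_id)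

theorem velocity_comp_boundary {f : S → M} (hf : ContMDiff (𝓡∂ 2) 𝓘(ℝ, E3) ∞ f)
    (hb : ContMDiff 𝓘(ℝ, ℝ) (𝓡∂ 2) ∞ b) (θ : ℝ) :
    velocity (fun θ' => f (b θ')) θ = coordDeriv (𝓡∂ 2) 𝓘(ℝ, E3) f (b θ) (surfaceVelocity b θ) :=
  curveVelocity_comp (I' := 𝓡∂ 2) (I'' := 𝓘(ℝ, E3)) (hf.mdifferentiableAt (by simp))
    (hb.mdifferentiableAt (by simp))

theorem velocity_comp_boundary_periodic {f : S → M} (hf : ContMDiff (𝓡∂ 2) 𝓘(ℝ, E3) ∞ f)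
    (hb : IsBoundaryCurve b) : Function.Periodic (velocity fun θ' => f (b θ')) 1 :=
  curveVelocity_periodic (I := 𝓘(ℝ, E3)) ((hf.comp hb.smooth).mdifferentiable (by simp))
    fun θ => congrArg f (hb.periodic θ)

/-- The velocity of the boundary and an outward vector are linearly independent. -/
theorem exists_det3_velocity_pos {f : S → M} (hf : ContMDiff (𝓡∂ 2) 𝓘(ℝ, E3) ∞ f)
    (himm : ∀ x, Function.Injective (coordDeriv (𝓡∂ 2) 𝓘(ℝ, E3) f x)) (hb : IsBoundaryCurve b)
    {θ : ℝ} {a : E2} (ha : IsOutward a) : ∃ c, 0 < det3 (velocity (fun θ' => f (b θ')) θ)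
      (coordDeriv (𝓡∂ 2) 𝓘(ℝ, E3) f (b θ) a) c := by
  obtain ⟨c, hc⟩ := exists_det3_neg (himm (b θ))
  refine ⟨c, ?_⟩
  rw [velocity_comp_boundary hf hb.smooth, det3_map_plane]
  refine mul_pos_of_neg_of_neg ?_ hc
  have h1 := hb.orientation θ a ha
  rw [det2_eq] at h1 ⊢
  linarith

/-- The third frame coordinate detects `α`: it is zero for vectors of `ξ`, and for the velocity of
the boundary it has the sign of the crossing. -/
theorem IsPositiveFrame.apply_eq {p : M} {X Y R v : E3} (h : IsPositiveFrame α p X Y)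
    (hR : (0 : ℝ) < α p R) : (α p v : ℝ) = frameCoord X Y R v 2 * (α p R : ℝ) := by
  have h1 := frameMap_frameCoord (h.2.2 R hR).ne' v
  set l : E3 →L[ℝ] ℝ := α p with hl
  have hX : l X = 0 := h.1
  have hY : l Y = 0 := h.2.1
  show l v = _ * l R
  conv_lhs => rw [← h1]
  rw [frameMap_apply, map_add, map_add, map_smul, map_smul, map_smul, hX, hY]
  simp

variable {R : M → E3}

theorem boundaryTwist_ne_zero (h : IsTransverseIsotopy α ε F b u) (hR : ∀ p, (0 : ℝ) < α p (R p))
    {t : ℝ} (ht : t ∈ Ioc (0 : ℝ) 1) {X Y : S → E3}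
    (hXY : ∀ x, IsPositiveFrame α (F t x) (X x) (Y x)) (θ : ℝ) {y : E3} (hy : y 2 = 0)
    (hy0 : y ≠ 0) : boundaryTwist R (F t) b u X Y θ y ≠ 0 := by
  obtain ⟨c, hc⟩ := exists_det3_velocity_pos (h.contMDiff t) (h.immersion t (Ioc_subset_Icc_self ht))
    h.boundary (h.outward θ) (θ := θ)
  have hd := (hXY (b θ)).2.2 _ (hR _)
  rw [det3_frameCoord hd.ne'] at hc
  refine twist_ne_zero (pos_of_mul_pos_right hc hd.le).ne' (fun h0 => ?_) hy hy0
  have h1 := h.transverse t ht θ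
  rw [(hXY (b θ)).apply_eq (hR _), h0] at h1
  simp at h1

theorem boundaryTwist_periodic {f : S → M} (hf : ContMDiff (𝓡∂ 2) 𝓘(ℝ, E3) ∞ f)
    (hb : IsBoundaryCurve b) (hu : Function.Periodic u 1) (X Y : S → E3) {y : ℝ → E3}
    (hy : Function.Periodic y 1) :
    Function.Periodic (fun θ => boundaryTwist R f b u X Y θ (y θ)) 1 := fun θ => by
  simp only [boundaryTwist, hb.periodic θ, hu θ, hy θ, velocity_comp_boundary_periodic hf hb θ]

theorem continuous_boundaryTwist (hM : IsOrientedAtlas 𝓘(ℝ, E3) M)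
    (h : IsTransverseIsotopy α ε F b u) (hR : IsContField id R) (hRp : ∀ p, (0 : ℝ) < α p (R p))
    {Z : Type*} [TopologicalSpace Z] {t : Z → ℝ} (ht : Continuous t)
    {X Y : Z → S → E3} (hX : IsContField (fun z : Z × S => F (t z.1) z.2) (Function.uncurry X))
    (hY : IsContField (fun z : Z × S => F (t z.1) z.2) (Function.uncurry Y))
    (hXY : ∀ z x, IsPositiveFrame α (F (t z) x) (X z x) (Y z x)) {y : ℝ → E3} (hy : Continuous y) :
    Continuous fun z : Z × ℝ => boundaryTwist R (F (t z.1)) b u (X z.1) (Y z.1) z.2 (y z.2) := by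
  have hb := h.boundary.smooth.continuous
  have c1 : Continuous fun z : Z × ℝ => (z.1, b z.2) :=
    continuous_fst.prodMk (hb.comp continuous_snd)
  have c2 : Continuous fun z : Z × ℝ => (t z.1, z.2) :=
    (ht.comp continuous_fst).prodMk continuous_snd
  have f1 := hX.comp c1
  have f2 := hY.comp c1
  have f3 : IsContField (fun z : Z × ℝ => F (t z.1) (b z.2)) (fun z => R (F (t z.1) (b z.2))) :=
    hR.comp f1.1
  have f4 := (isContField_velocity h.smooth h.boundary.smooth).comp c2
  have f5 := (h.field.isContField h.smooth h.boundary.smooth).comp c2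
  have hd : ∀ z : Z × ℝ, det3 (X z.1 (b z.2)) (Y z.1 (b z.2)) (R (F (t z.1) (b z.2))) ≠ 0 :=
    fun z => ((hXY z.1 (b z.2)).2.2 _ (hRp _)).ne'
  exact continuous_twist (continuous_frameCoord hM f1 f2 f3 f4 hd)
    (continuous_frameCoord hM f1 f2 f3 f5 hd) (hy.comp continuous_snd)

theorem IsContFrame.uncurry_const {t : ℝ} {X Y : S → E3} (h : IsContFrame α (F t) X Y) :
    IsContField (fun z : Unit × S => F t z.2) (Function.uncurry fun _ => X) ∧
      IsContField (fun z : Unit × S => F t z.2) (Function.uncurry fun _ => Y) :=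
  ⟨h.left.comp continuous_snd, h.right.comp continuous_snd⟩

theorem IsContFrame.continuous_boundaryTwist (hM : IsOrientedAtlas 𝓘(ℝ, E3) M)
    (h : IsTransverseIsotopy α ε F b u) (hR : IsContField id R) (hRp : ∀ p, (0 : ℝ) < α p (R p))
    {t : ℝ} {X Y : S → E3} (hXY : IsContFrame α (F t) X Y) {y : ℝ → E3} (hy : Continuous y) :
    Continuous fun θ => boundaryTwist R (F t) b u X Y θ (y θ) := by
  have h1 : Continuous fun z : Unit × ℝ => boundaryTwist R (F t) b u X Y z.2 (y z.2) :=
    _root_.continuous_boundaryTwist (Z := Unit) (X := fun _ => X) (Y := fun _ => Y) hM h hR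
      hRp (t := fun _ => t) continuous_const hXY.uncurry_const.1 hXY.uncurry_const.2
      (fun _ => hXY.positive) hy
  have h2 : Continuous fun θ : ℝ => ((), θ) := by fun_prop
  have h3 := h1.comp h2
  simp only [Function.comp_def] at h3
  exact h3

variable [T2Space M] [SecondCountableTopology M] [CompactSpace S]

/-- There is a contact frame along `F t` in which the section with coordinates `y` winds `n` times. -/
def HasContFrame (α : (p : M) → TangentSpace 𝓘(ℝ, E3) p →L[ℝ] ℝ) (F : ℝ → S → M) (b : ℝ → S)
    (u : ℝ → E2) (R : M → E3) (y : ℝ → E3) (n : ℤ) (t : ℝ) : Prop :=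
  ∃ X Y : S → E3, IsContFrame α (F t) X Y ∧
    HasWindingNumber (fun θ => boundaryTwist R (F t) b u X Y θ (y θ)) n

/-- Contact frames with a given winding number propagate for a short time. -/
theorem IsTransverseIsotopy.exists_step (hM : IsOrientedAtlas 𝓘(ℝ, E3) M) (hα : IsContactForm α)
    (h : IsTransverseIsotopy α ε F b u) (hR : IsContField id R) (hRp : ∀ p, (0 : ℝ) < α p (R p))
    {y : ℝ → E3} (hy : Continuous y) (hyp : Function.Periodic y 1) (hy2 : ∀ θ, y θ 2 = 0)
    (hy0 : ∀ θ, y θ ≠ 0) (n : ℤ) (t₀ : ℝ) : ∃ δ > 0, ∀ t ∈ Icc (0 : ℝ) 1, ∀ t' ∈ Ioc (0 : ℝ) 1,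
      |t - t₀| < δ → |t' - t₀| < δ → HasContFrame α F b u R y n t → HasContFrame α F b u R y n t' := by
  obtain ⟨δ, hδ, hP⟩ := hα.exists_frame_transport hM h.smooth.continuous t₀
  refine ⟨δ, hδ, fun t ht t' ht' h1 h2 ⟨X, Y, hXY, hw⟩ => ?_⟩
  obtain ⟨X', Y', hX', hY', hXY', hX0, hY0⟩ :=
    hP t t' h1 h2 X Y hXY.left hXY.right hXY.positive
  have hc : Continuous fun s : unitInterval => t + s * (t' - t) := by fun_prop
  set Z : unitInterval → ℝ → ℂ := fun s θ =>
    boundaryTwist R (F (t + s * (t' - t))) b u (X' s) (Y' s) θ (y θ) with hZ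
  have hZ0 : Z 0 = fun θ => boundaryTwist R (F t) b u X Y θ (y θ) := by
    simp only [hZ, hX0, hY0, Icc.coe_zero, zero_mul, add_zero]
  have hw0 : HasWindingNumber (Z 0) n := by rw [hZ0]; exact hw
  have hw1 := hasWindingNumber_of_homotopy (Z := Z)
    (continuous_boundaryTwist hM h hR hRp hc hX' hY' hXY' hy)
    (fun s => boundaryTwist_periodic (h.contMDiff _) h.boundary h.periodic _ _ hyp)
    (fun s θ => ?_) hw0 1
  · have e1 : t + (1 : unitInterval) * (t' - t) = t' := by simp
    have c1 : Continuous fun x : S => ((1 : unitInterval), x) := by fun_prop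
    refine ⟨X' 1, Y' 1, ⟨?_, ?_, ?_⟩, ?_⟩
    · have := hX'.comp c1
      simp only [e1] at this
      exact this
    · have := hY'.comp c1
      simp only [e1] at this
      exact this
    · have := hXY' 1
      simp only [e1] at this
      exact this
    · simp only [hZ, e1] at hw1
      exact hw1
  -- At `s = 0` the section has nonzero class because it is assumed to have a winding number, which
  -- covers the Legendrian time `t = 0`. For `s > 0` the time is positive, as `t'` is, and
  -- transversality applies.
  · rcases eq_or_ne s 0 with rfl | hs
    · exact hw0.1 θ
    · have hs0 : (0 : ℝ) < s := lt_of_le_of_ne s.2.1 fun h0 => hs (Subtype.ext h0.symm)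
      have hs1 : (s : ℝ) ≤ 1 := s.2.2
      refine boundaryTwist_ne_zero h hRp ⟨?_, ?_⟩ (hXY' s) θ (hy2 θ) (hy0 θ)
      · have e : t + s * (t' - t) = (1 - s) * t + s * t' := by ring
        rw [e]
        exact add_pos_of_nonneg_of_pos (mul_nonneg (by linarith) ht.1) (mul_pos hs0 ht'.1)
      · nlinarith [ht.2, ht'.2]

/-- The winding number of a section of the contact structure with given coordinates is carried along
the isotopy. -/
theorem IsTransverseIsotopy.exists_frame (hM : IsOrientedAtlas 𝓘(ℝ, E3) M) (hα : IsContactForm α)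
    (h : IsTransverseIsotopy α ε F b u) (hR : IsContField id R) (hRp : ∀ p, (0 : ℝ) < α p (R p))
    {y : ℝ → E3} (hy : Continuous y) (hyp : Function.Periodic y 1) (hy2 : ∀ θ, y θ 2 = 0)
    (hy0 : ∀ θ, y θ ≠ 0) {X Y : S → E3} (hXY : IsContFrame α (F 0) X Y) {n : ℤ}
    (hn : HasWindingNumber (fun θ => boundaryTwist R (F 0) b u X Y θ (y θ)) n) :
    HasContFrame α F b u R y n 1 := by
  set Q : Set ℝ := {t | HasContFrame α F b u R y n t} with hQ
  have step := h.exists_step hM hα hR hRp hy hyp hy2 hy0 n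
  -- Continuous induction: each `t₀` has its own step size, within which the property passes from
  -- any time in the interval to any positive time. This gives both closedness and progress to the
  -- right.
  have hsub : Icc (0 : ℝ) 1 ⊆ Q := by
    refine IsClosed.Icc_subset_of_forall_exists_gt ?_ ⟨X, Y, hXY, hn⟩ ?_
    · refine isClosed_of_closure_subset fun t ht => ?_
      have ht1 : t ∈ Icc (0 : ℝ) 1 :=
        isClosed_Icc.closure_subset (closure_mono inter_subset_right ht)
      refine ⟨?_, ht1⟩
      rcases eq_or_lt_of_le ht1.1 with h0 | h0
      · rw [← h0]; exact ⟨X, Y, hXY, hn⟩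
      · obtain ⟨δ, hδ, hs⟩ := step t
        obtain ⟨t', ht', hd⟩ := Metric.mem_closure_iff.1 ht δ hδ
        rw [Real.dist_eq, abs_sub_comm] at hd
        exact hs t' ht'.2 t ⟨h0, ht1.2⟩ hd (by simpa using hδ) ht'.1
    · rintro t ⟨htQ, ht⟩ y' hy'
      obtain ⟨δ, hδ, hs⟩ := step t
      have hlt : t < min y' (min (t + δ / 2) 1) :=
        lt_min hy' (lt_min (by linarith) ht.2)
      refine ⟨min y' (min (t + δ / 2) 1), hs t ⟨ht.1, ht.2.le⟩ _ ⟨ht.1.trans_lt hlt, ?_⟩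
        (by simpa using hδ) ?_ htQ, hlt, min_le_left _ _⟩
      · exact (min_le_right _ _).trans (min_le_right _ _)
      · rw [abs_of_pos (sub_pos.2 hlt)]
        have : min y' (min (t + δ / 2) 1) ≤ t + δ / 2 := (min_le_right _ _).trans (min_le_left _ _)
        linarith
  exact hsub (right_mem_Icc.2 zero_le_one)

end TransverseIsotopy


/-! ### The winding numbers at the two ends of the isotopy -/

section Endpoints

variable {M : Type*} [TopologicalSpace M] [ChartedSpace E3 M] [IsManifold 𝓘(ℝ, E3) ∞ M]
variable {S : Type*} [TopologicalSpace S] [ChartedSpace (EuclideanHalfSpace 2) S]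
  [IsManifold (𝓡∂ 2) ∞ S]
variable {α : (p : M) → TangentSpace 𝓘(ℝ, E3) p →L[ℝ] ℝ}
variable {ε : ℤ} {F : ℝ → S → M} {b : ℝ → S} {u : ℝ → E2} {R : M → E3}

theorem E3.ext_coords {v w : E3} (h0 : v 0 = w 0) (h1 : v 1 = w 1) (h2 : v 2 = w 2) : v = w := by
  ext i; fin_cases i; exacts [h0, h1, h2]

theorem boundaryTwist_add (R : M → E3) (f : S → M) (b : ℝ → S) (u : ℝ → E2) (X Y : S → E3) (θ : ℝ)
    (y y' : E3) : boundaryTwist R f b u X Y θ (y + y')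
      = boundaryTwist R f b u X Y θ y + boundaryTwist R f b u X Y θ y' :=
  twist_add _ _ _ _

theorem boundaryTwist_smul (R : M → E3) (f : S → M) (b : ℝ → S) (u : ℝ → E2) (X Y : S → E3) (θ : ℝ)
    (k : ℝ) (y : E3) : boundaryTwist R f b u X Y θ (k • y) = k * boundaryTwist R f b u X Y θ y :=
  twist_smul _ _ _ _

theorem frameCoord_periodic {a b c v : ℝ → E3} (ha : Function.Periodic a 1)
    (hb : Function.Periodic b 1) (hc : Function.Periodic c 1) (hv : Function.Periodic v 1) :
    Function.Periodic (fun θ => frameCoord (a θ) (b θ) (c θ) (v θ)) 1 := fun θ => by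
  simp only [ha θ, hb θ, hc θ, hv θ]

theorem continuous_coord {Z : Type*} [TopologicalSpace Z] {x : Z → E3} (hx : Continuous x)
    (i : Fin 3) : Continuous fun z => x z i :=
  (EuclideanSpace.proj (𝕜 := ℝ) (i : Fin 3)).continuous.comp hx

/-- The framing of the normal bundle by the contact planes, in terms of a frame of the contact
structure along the surface. -/
theorem hasWindingNumber_boundaryTwist_of_twisting (hM : IsOrientedAtlas 𝓘(ℝ, E3) M)
    (h : IsTransverseIsotopy α ε F b u) (hR : IsContField id R) (hRp : ∀ p, (0 : ℝ) < α p (R p))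
    {X Y : S → E3} (hXY : IsContFrame α (F 0) X Y) {w c : ℝ → E3}
    (hw : IsContField (fun θ => F 0 (b θ)) w) (hwp : Function.Periodic w 1)
    (hc : IsContField (fun θ => F 0 (b θ)) c) (hcp : Function.Periodic c 1)
    (hpos : ∀ θ, 0 < det3 (velocity (fun θ' => F 0 (b θ')) θ)
      (coordDeriv (𝓡∂ 2) 𝓘(ℝ, E3) (F 0) (b θ) (u θ)) (c θ))
    {p q r : ℝ → ℝ} (hpqr : ∀ θ, w θ = p θ • coordDeriv (𝓡∂ 2) 𝓘(ℝ, E3) (F 0) (b θ) (u θ)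
      + q θ • c θ + r θ • velocity (fun θ' => F 0 (b θ')) θ) {n : ℤ}
    (hn : HasWindingNumber (fun θ => (p θ : ℂ) + (q θ : ℂ) * Complex.I) n) :
    HasWindingNumber (fun θ => boundaryTwist R (F 0) b u X Y θ
      (frameCoord (X (b θ)) (Y (b θ)) (R (F 0 (b θ))) (w θ))) n := by
  have hb := h.boundary.smooth.continuous
  set T : ℝ → E3 := velocity (fun θ' => F 0 (b θ')) with hT
  set s : ℝ → E3 := fun θ => coordDeriv (𝓡∂ 2) 𝓘(ℝ, E3) (F 0) (b θ) (u θ) with hs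
  have c0 : Continuous fun θ : ℝ => ((0 : ℝ), θ) := by fun_prop
  have fT : IsContField (fun θ => F 0 (b θ)) T := (isContField_velocity h.smooth h.boundary.smooth).comp c0
  have fs : IsContField (fun θ => F 0 (b θ)) s := (h.field.isContField h.smooth h.boundary.smooth).comp c0
  have pT : Function.Periodic T 1 := velocity_comp_boundary_periodic (h.contMDiff 0) h.boundary
  have ps : Function.Periodic s 1 := fun θ => by simp only [hs, h.boundary.periodic θ, h.periodic θ]
  have hd : ∀ θ, det3 (s θ) (c θ) (T θ) ≠ 0 := fun θ => by
    have e : det3 (s θ) (c θ) (T θ) = det3 (T θ) (s θ) (c θ) := by simp only [det3_eq]; ring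
    rw [e]; exact (hpos θ).ne'
  -- The definition of twisting does not ask `p` and `q` to be continuous or periodic. They are,
  -- being coordinates in a continuous periodic frame.
  have hco : ∀ θ, frameCoord (s θ) (c θ) (T θ) (w θ) = !₂[p θ, q θ, r θ] := fun θ =>
    frameCoord_eq (hd θ) (hpqr θ)
  have kc := continuous_frameCoord hM fs hc fT hw hd
  have kp := frameCoord_periodic ps hcp pT hwp
  simp only [hco] at kc kp
  have pc : Continuous p := continuous_coord kc 0
  have qc : Continuous q := continuous_coord kc 1
  have pp : Function.Periodic p 1 := fun θ => congrArg (fun v : E3 => v 0) (kp θ)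
  have qp : Function.Periodic q 1 := fun θ => congrArg (fun v : E3 => v 1) (kp θ)
  have fX : IsContField (fun θ => F 0 (b θ)) (fun θ => X (b θ)) := hXY.left.comp hb
  have fY : IsContField (fun θ => F 0 (b θ)) (fun θ => Y (b θ)) := hXY.right.comp hb
  have fR : IsContField (fun θ => F 0 (b θ)) (fun θ => R (F 0 (b θ))) := hR.comp fX.1
  have hd' : ∀ θ, 0 < det3 (X (b θ)) (Y (b θ)) (R (F 0 (b θ))) := fun θ =>
    (hXY.positive (b θ)).2.2 _ (hRp _)
  have yc := continuous_frameCoord hM fX fY fR hw fun θ => (hd' θ).ne'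
  have yp : Function.Periodic (fun θ => frameCoord (X (b θ)) (Y (b θ)) (R (F 0 (b θ))) (w θ)) 1 :=
    frameCoord_periodic (fun θ => by simp only [h.boundary.periodic θ])
      (fun θ => by simp only [h.boundary.periodic θ]) (fun θ => by simp only [h.boundary.periodic θ])
      hwp
  refine hn.of_forall_add_ne (by fun_prop) (hXY.continuous_boundaryTwist hM h hR hRp yc)
    (fun θ => by simp only [pp θ, qp θ])
    (boundaryTwist_periodic (h.contMDiff 0) h.boundary h.periodic _ _ yp) fun θ k hk => ?_
  have e : frameCoord (X (b θ)) (Y (b θ)) (R (F 0 (b θ))) (w θ)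
      = p θ • frameCoord (X (b θ)) (Y (b θ)) (R (F 0 (b θ))) (s θ)
      + q θ • frameCoord (X (b θ)) (Y (b θ)) (R (F 0 (b θ))) (c θ)
      + r θ • frameCoord (X (b θ)) (Y (b θ)) (R (F 0 (b θ))) (T θ) := by
    have hne := (hd' θ).ne'
    conv_lhs => rw [hpqr θ]
    rw [← frameCoord_frameMap hne (p θ • frameCoord (X (b θ)) (Y (b θ)) (R (F 0 (b θ))) (s θ) + _ + _)]
    rw [map_add, map_add, map_smul, map_smul, map_smul, frameMap_frameCoord hne,
      frameMap_frameCoord hne, frameMap_frameCoord hne]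
  rw [e]
  have hpos' := hpos θ
  rw [det3_frameCoord (hd' θ).ne'] at hpos'
  exact twist_add_mul_ne_zero (pos_of_mul_pos_right hpos' (hd' θ).le) hk (hn.1 θ)

variable [T2Space M] [SecondCountableTopology M] [CompactSpace S]

theorem boundaryTwist_eq_of_coord_two_eq_zero (R : M → E3) (f : S → M) (b : ℝ → S) (u : ℝ → E2)
    (X Y : S → E3) (θ : ℝ) {y : E3} (hy : y 2 = 0) : boundaryTwist R f b u X Y θ y =
      (y 0 : ℝ) * boundaryTwist R f b u X Y θ !₂[1, 0, 0]
        + (y 1 : ℝ) * boundaryTwist R f b u X Y θ !₂[0, 1, 0] := by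
  rw [← boundaryTwist_smul, ← boundaryTwist_smul, ← boundaryTwist_add]
  congr 1
  conv_lhs => rw [E3.eq_smul_add y, hy, zero_smul, add_zero]

/-- By `twist_det` the orientation of the projection from `ξ` to the normal bundle is governed by
the transverse component of the velocity, which has sign `ε`. -/
theorem boundaryTwist_det_pos (h : IsTransverseIsotopy α ε F b u) (hRp : ∀ p, (0 : ℝ) < α p (R p))
    {t : ℝ} (ht : t ∈ Ioc (0 : ℝ) 1) {X Y : S → E3}
    (hXY : ∀ x, IsPositiveFrame α (F t x) (X x) (Y x)) (θ : ℝ) : 0 < (ε : ℝ) *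
      ((boundaryTwist R (F t) b u X Y θ !₂[1, 0, 0]).re * (boundaryTwist R (F t) b u X Y θ !₂[0, 1, 0]).im
      - (boundaryTwist R (F t) b u X Y θ !₂[1, 0, 0]).im
        * (boundaryTwist R (F t) b u X Y θ !₂[0, 1, 0]).re) := by
  obtain ⟨c, hc⟩ := exists_det3_velocity_pos (h.contMDiff t) (h.immersion t (Ioc_subset_Icc_self ht))
    h.boundary (h.outward θ) (θ := θ)
  have hd := (hXY (b θ)).2.2 _ (hRp _)
  rw [det3_frameCoord hd.ne'] at hc
  have hg := gram3_pos (pos_of_mul_pos_right hc hd.le).ne'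
  have h1 := h.transverse t ht θ
  rw [(hXY (b θ)).apply_eq (hRp _), ← mul_assoc] at h1
  have h2 := pos_of_mul_pos_left h1 (hRp _).le
  rw [boundaryTwist, boundaryTwist, twist_det, mul_left_comm]
  exact mul_pos hg h2

/-- The winding number of a nowhere zero section of the contact structure over the surface. -/
theorem hasWindingNumber_boundaryTwist_section (hM : IsOrientedAtlas 𝓘(ℝ, E3) M)
    (hS : IsOrientedAtlas (𝓡∂ 2) S) [T2Space S]
    (h : IsTransverseIsotopy α ε F b u) (hε : ε = 1 ∨ ε = -1) (hR : IsContField id R)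
    (hRp : ∀ p, (0 : ℝ) < α p (R p)) {y : ℝ → E3} (hy : Continuous y)
    (hyp : Function.Periodic y 1) (hy2 : ∀ θ, y θ 2 = 0) {X Y : S → E3}
    (hXY : IsContFrame α (F 1) X Y) {n r : ℤ}
    (hn : HasWindingNumber (fun θ => boundaryTwist R (F 1) b u X Y θ (y θ)) n)
    (hr : HasWindingNumber (fun θ => ((y θ 0 : ℝ) : ℂ) + (y θ 1 : ℝ) * Complex.I) r)
    {v : S → E3} (hv : IsContField (F 1) v) (hv0 : ∀ x, α (F 1 x) (v x) = 0 ∧ v x ≠ 0) :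
    HasWindingNumber (fun θ => boundaryTwist R (F 1) b u X Y θ
      (frameCoord (X (b θ)) (Y (b θ)) (R (F 1 (b θ))) (v (b θ)))) (n - ε * r) := by
  have hb := h.boundary.smooth.continuous
  have h1 : (1 : ℝ) ∈ Ioc (0 : ℝ) 1 := ⟨one_pos, le_rfl⟩
  have cont : ∀ {y : ℝ → E3}, Continuous y →
      Continuous fun θ => boundaryTwist R (F 1) b u X Y θ (y θ) := fun hy =>
    hXY.continuous_boundaryTwist hM h hR hRp hy
  have per : ∀ {y : ℝ → E3}, Function.Periodic y 1 →
      Function.Periodic (fun θ => boundaryTwist R (F 1) b u X Y θ (y θ)) 1 := fun hy =>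
    boundaryTwist_periodic (h.contMDiff 1) h.boundary h.periodic X Y hy
  have hdet := boundaryTwist_det_pos (R := R) h hRp h1 hXY.positive
  -- First the comparison is made for the frame vector `X`, against which `y` winds `r` times.
  have w1 : HasWindingNumber (fun θ => boundaryTwist R (F 1) b u X Y θ !₂[1, 0, 0]) (n - ε * r) := by
    refine HasWindingNumber.linear_image (x₁ := fun θ => y θ 0) (x₂ := fun θ => y θ 1)
      (m₂ := fun θ => boundaryTwist R (F 1) b u X Y θ !₂[0, 1, 0])
      (continuous_coord hy 0) (continuous_coord hy 1) (cont continuous_const)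
      (cont continuous_const) (fun θ => by simp only [hyp θ]) (fun θ => by simp only [hyp θ])
      (per fun θ => rfl) (per fun θ => rfl) hε hdet hr ?_
    simp only [fun θ => boundaryTwist_eq_of_coord_two_eq_zero R (F 1) b u X Y θ (hy2 θ)] at hn
    exact hn
  have hd : ∀ x, det3 (X x) (Y x) (R (F 1 x)) ≠ 0 := fun x =>
    ((hXY.positive x).2.2 _ (hRp _)).ne'
  set k : S → E3 := fun x => frameCoord (X x) (Y x) (R (F 1 x)) (v x) with hk
  have kc : Continuous k := continuous_frameCoord hM hXY.left hXY.right (hR.comp hv.1) hv hd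
  have k2 : ∀ x, k x 2 = 0 := fun x => by
    have := (hXY.positive x).apply_eq (v := v x) (hRp (F 1 x))
    rw [(hv0 x).1] at this
    exact (mul_eq_zero.1 this.symm).resolve_right (hRp _).ne'
  set G : S → ℂ := fun x => ((k x 0 : ℝ) : ℂ) + (k x 1 : ℝ) * Complex.I with hG
  have Gre : ∀ x, (G x).re = k x 0 := fun x => by simp [hG]
  have Gim : ∀ x, (G x).im = k x 1 := fun x => by simp [hG]
  have Gc : Continuous G := by
    have := continuous_coord kc 0
    have := continuous_coord kc 1
    fun_prop
  have G0 : ∀ x, G x ≠ 0 := fun x h0 => by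
    have e0 := Gre x
    have e1 := Gim x
    rw [h0] at e0 e1
    have e2 : k x = 0 := E3.ext_coords e0.symm e1.symm (k2 x)
    have e3 := frameMap_frameCoord (hd x) (v x)
    rw [show frameCoord (X x) (Y x) (R (F 1 x)) (v x) = 0 from e2, map_zero] at e3
    exact (hv0 x).2 e3.symm
  -- `G`, the coordinate function of `v` in the frame, is nowhere zero on all of the surface, so it
  -- does not wind around the boundary.
  have wG := (h.boundary.hasWindingNumber_zero hS Gc G0).inv
  set g : ℝ → ℂ := fun θ => (G (b θ))⁻¹ with hg
  have gc : Continuous g := (Gc.comp hb).inv₀ fun θ => G0 _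
  have gp : Function.Periodic g 1 := fun θ => by simp only [hg, h.boundary.periodic θ]
  set k' : ℝ → E3 := fun θ => !₂[-k (b θ) 1, k (b θ) 0, 0] with hk'
  have kbc : Continuous fun θ => k (b θ) := kc.comp hb
  have k'c : Continuous k' :=
    continuous_E3 (continuous_coord kbc 1).neg (continuous_coord kbc 0) continuous_const
  have kbp : Function.Periodic (fun θ => k (b θ)) 1 := fun θ => by
    simp only [h.boundary.periodic θ]
  have k'p : Function.Periodic k' 1 := fun θ => by simp only [hk', h.boundary.periodic θ]
  -- The same comparison from `X` to `v`: with `k'` the coordinates of `v` rotated by a right angle,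
  -- `X` has coordinates `g = 1 / G` in the basis `(k, k')`. These wind zero times.
  have key := HasWindingNumber.linear_image (x₁ := fun θ => (g θ).re) (x₂ := fun θ => (g θ).im)
    (m₁ := fun θ => boundaryTwist R (F 1) b u X Y θ (k (b θ)))
    (m₂ := fun θ => boundaryTwist R (F 1) b u X Y θ (k' θ)) (r := -0) (N := n - ε * r)
    (Complex.continuous_re.comp gc) (Complex.continuous_im.comp gc) (cont kbc) (cont k'c)
    (fun θ => by simp only [gp θ]) (fun θ => by simp only [gp θ]) (per kbp) (per k'p) hε
    (fun θ => ?_) (by simpa only [Complex.re_add_im] using wG) ?_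
  · simpa using key
  · have e1 := boundaryTwist_eq_of_coord_two_eq_zero R (F 1) b u X Y θ (k2 (b θ))
    have e2 := boundaryTwist_eq_of_coord_two_eq_zero R (F 1) b u X Y θ (y := k' θ) rfl
    have e3 : k' θ 0 = -k (b θ) 1 := rfl
    have e4 : k' θ 1 = k (b θ) 0 := rfl
    rw [e3, e4] at e2
    rw [e1, e2]
    set m₁ := boundaryTwist R (F 1) b u X Y θ !₂[1, 0, 0]
    set m₂ := boundaryTwist R (F 1) b u X Y θ !₂[0, 1, 0]
    have hp : 0 < k (b θ) 0 ^ 2 + k (b θ) 1 ^ 2 := by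
      have := Complex.normSq_pos.2 (G0 (b θ))
      rw [Complex.normSq_apply, Gre, Gim] at this
      nlinarith
    have := mul_pos hp (hdet θ)
    simp only [Complex.add_re, Complex.add_im, Complex.re_ofReal_mul, Complex.im_ofReal_mul]
    linarith
  · convert w1 using 2 with θ
    rw [← boundaryTwist_smul, ← boundaryTwist_smul, ← boundaryTwist_add]
    congr 1
    have e : g θ * G (b θ) = 1 := inv_mul_cancel₀ (G0 _)
    have er := congrArg Complex.re e
    have ei := congrArg Complex.im e
    rw [Complex.mul_re, Complex.one_re, Gre, Gim] at er
    rw [Complex.mul_im, Complex.one_im, Gre, Gim] at ei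
    refine E3.ext_coords ?_ ?_ ?_
    · simp [hk']; linarith
    · simp [hk']; linarith
    · simp [hk', k2]

end Endpoints


/-! ### Self-linking numbers of the push-offs -/

section SelfLinking

variable {M : Type*} [TopologicalSpace M] [ChartedSpace E3 M] [IsManifold 𝓘(ℝ, E3) ∞ M]
variable {S : Type*} [TopologicalSpace S] [ChartedSpace (EuclideanHalfSpace 2) S]
  [IsManifold (𝓡∂ 2) ∞ S]
variable {α : (p : M) → TangentSpace 𝓘(ℝ, E3) p →L[ℝ] ℝ}
variable {ε : ℤ} {F : ℝ → S → M} {b : ℝ → S} {u : ℝ → E2} {R : M → E3}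

theorem IsSeifertSurface.isBoundaryCurve {K : ℝ → M} {f : S → M} (h : IsSeifertSurface K f b) :
    IsBoundaryCurve b where
  smooth := h.smooth_bdry
  periodic := h.periodic_bdry
  injOn := fun x hx y hy hxy => h.knot.injOn hx hy (by rw [← h.bdry_eq, ← h.bdry_eq, hxy])
  range_eq := h.range_bdry
  orientation := h.orientation

variable [T2Space M] [SecondCountableTopology M] [CompactSpace S]

/-- The linking number of the boundary with its push-off along a field whose class in the normal
bundle has winding number `n`. -/
theorem linkingNumber_eq_of_boundaryTwist (hM : IsOrientedAtlas 𝓘(ℝ, E3) M)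
    (hS : IsOrientedAtlas (𝓡∂ 2) S) (h : IsTransverseIsotopy α ε F b u) (hR : IsContField id R)
    (hRp : ∀ p, (0 : ℝ) < α p (R p)) {X Y : S → E3} (hXY : IsContFrame α (F 1) X Y)
    (hinj : Function.Injective (F 1)) {v : S → E3} (hv : IsContField (F 1) v) {n : ℤ}
    (hn : HasWindingNumber (fun θ => boundaryTwist R (F 1) b u X Y θ
      (frameCoord (X (b θ)) (Y (b θ)) (R (F 1 (b θ))) (v (b θ)))) n) {K : ℝ → M} {H : ℝ → ℝ → M}
    (hH : ContMDiff (𝓘(ℝ, ℝ).prod 𝓘(ℝ, ℝ)) 𝓘(ℝ, E3) ∞ (fun z : ℝ × ℝ => H z.1 z.2))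
    (hHp : ∀ u, Function.Periodic (fun θ => H θ u) 1) (hH0 : ∀ θ, H θ 0 = F 1 (b θ))
    (hHv : ∀ θ, velocity (fun u => H θ u) 0 = v (b θ)) {sl : ℤ}
    (hsl : ∀ᶠ u in 𝓝[>] (0 : ℝ), IsLinkingNumber K (F 1) (fun θ => H θ u) sl) : sl = n := by
  have hb := h.boundary.smooth.continuous
  have h1 : (1 : ℝ) ∈ Icc (0 : ℝ) 1 := ⟨zero_le_one, le_rfl⟩
  have hd : ∀ x, 0 < det3 (X x) (Y x) (R (F 1 x)) := fun x => (hXY.positive x).2.2 _ (hRp _)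
  set k : S → E3 := fun x => frameCoord (X x) (Y x) (R (F 1 x)) (v x) with hk
  have kc : Continuous k :=
    continuous_frameCoord hM hXY.left hXY.right (hR.comp hv.1) hv fun x => (hd x).ne'
  set Z : ℝ → ℂ := fun θ => boundaryTwist R (F 1) b u X Y θ (k (b θ)) with hZ
  have Zc : Continuous Z := hXY.continuous_boundaryTwist hM h hR hRp (kc.comp hb)
  have Zp : Function.Periodic Z 1 := boundaryTwist_periodic (h.contMDiff 1) h.boundary h.periodic
    X Y fun θ => by simp only [h.boundary.periodic θ]
  set T : ℝ → E3 := velocity (fun θ' => F 1 (b θ')) with hT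
  set σ : ℝ → E3 := fun θ => coordDeriv (𝓡∂ 2) 𝓘(ℝ, E3) (F 1) (b θ) (u θ) with hσ
  set x : ℝ → E3 := fun θ => frameCoord (X (b θ)) (Y (b θ)) (R (F 1 (b θ))) (T θ) with hx
  set s : ℝ → E3 := fun θ => frameCoord (X (b θ)) (Y (b θ)) (R (F 1 (b θ))) (σ θ) with hs
  have hTeq : ∀ θ, coordDeriv (𝓡∂ 2) 𝓘(ℝ, E3) (F 1) (b θ) (surfaceVelocity b θ) = T θ := fun θ =>
    (velocity_comp_boundary (h.contMDiff 1) h.boundary.smooth θ).symm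
  have hxs : ∀ θ, ∃ c, 0 < det3 (x θ) (s θ) c := fun θ => by
    obtain ⟨c, hc⟩ := exists_det3_velocity_pos (h.contMDiff 1) (h.immersion 1 h1) h.boundary
      (h.outward θ) (θ := θ)
    rw [det3_frameCoord (hd (b θ)).ne'] at hc
    exact ⟨_, pos_of_mul_pos_right hc (hd (b θ)).le⟩
  have hg : ∀ θ, 0 < gram3 (x θ) (s θ) := fun θ => by
    obtain ⟨c, hc⟩ := hxs θ
    exact gram3_pos hc.ne'
  set g : ℝ → ℝ := fun θ => (gram3 (x θ) (s θ))⁻¹ with hgdef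
  have hgp : ∀ θ, 0 < g θ := fun θ => inv_pos.2 (hg θ)
  set C : ℝ → E3 := fun θ => frameMap (X (b θ)) (Y (b θ)) (R (F 1 (b θ))) (cross3 (x θ) (s θ)) with hC
  have hTx : ∀ θ, frameMap (X (b θ)) (Y (b θ)) (R (F 1 (b θ))) (x θ) = T θ := fun θ =>
    frameMap_frameCoord (hd (b θ)).ne' _
  have hσs : ∀ θ, frameMap (X (b θ)) (Y (b θ)) (R (F 1 (b θ))) (s θ) = σ θ := fun θ =>
    frameMap_frameCoord (hd (b θ)).ne' _
  have hvk : ∀ θ, frameMap (X (b θ)) (Y (b θ)) (R (F 1 (b θ))) (k (b θ)) = v (b θ) := fun θ =>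
    frameMap_frameCoord (hd (b θ)).ne' _
  have hdet : ∀ θ, 0 < det3 (T θ) (σ θ) (C θ) := fun θ => by
    rw [← hTx, ← hσs, hC, det3_map, det_frameMap, det3_cross3]
    exact mul_pos (hd (b θ)) (hg θ)
  -- By `eq_twist_expansion` the coefficients of `v` are the parts of `Z` divided by the Gram
  -- determinant. This positive factor is absorbed in the framing vectors `g • u` and `g • C`.
  refine h.boundary.linkingNumber_eq hM hS (h.contMDiff 1) hinj (h.immersion 1 h1) hH hHp hH0
    (p := fun θ => (Z θ).re) (q := fun θ => (Z θ).im)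
    (r := fun θ => (gram3 (x θ) (s θ) * dot3 (x θ) (k (b θ)) - (Z θ).re * dot3 (x θ) (s θ))
      / (dot3 (x θ) (x θ) * gram3 (x θ) (s θ)))
    (Complex.continuous_re.comp Zc) (Complex.continuous_im.comp Zc)
    (fun θ => by simp only [Zp θ]) (fun θ => by simp only [Zp θ])
    (a := fun θ => g θ • u θ) (fun θ => ?_) (c := fun θ => g θ • C θ) (fun θ => ?_) (fun θ => ?_)
    (by simpa only [Complex.re_add_im] using hn) hsl
  · exact mul_neg_of_pos_of_neg (hgp θ) (h.outward θ)
  · have e : coordDeriv (𝓡∂ 2) 𝓘(ℝ, E3) (F 1) (b θ) (g θ • u θ) = g θ • σ θ := map_smul _ _ _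
    rw [hTeq, e]
    have e2 : det3 (T θ) (g θ • σ θ) (g θ • C θ) = g θ * g θ * det3 (T θ) (σ θ) (C θ) := by
      simp only [det3_eq, PiLp.smul_apply, smul_eq_mul]; ring
    rw [e2]
    exact mul_pos (mul_pos (hgp θ) (hgp θ)) (hdet θ)
  · have e : coordDeriv (𝓡∂ 2) 𝓘(ℝ, E3) (F 1) (b θ) (g θ • u θ) = g θ • σ θ := map_smul _ _ _
    obtain ⟨c, hc⟩ := hxs θ
    have e2 := congrArg (frameMap (X (b θ)) (Y (b θ)) (R (F 1 (b θ))))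
      (eq_twist_expansion hc.ne' (k (b θ)))
    rw [map_add, map_add, map_smul, map_smul, map_smul, hTx, hσs, hvk] at e2
    rw [hTeq, e, smul_smul, smul_smul]
    exact (hHv θ).trans e2

/-- The self-linking number of a transverse push-off. -/
theorem selfLinking_eq_of_isotopy (hM : IsOrientedAtlas 𝓘(ℝ, E3) M) (hα : IsContactForm α)
    (hS : IsOrientedAtlas (𝓡∂ 2) S) (hε : ε = 1 ∨ ε = -1)
    (hF : ContMDiff (𝓘(ℝ, ℝ).prod (𝓡∂ 2)) 𝓘(ℝ, E3) ∞ (fun z : ℝ × S => F z.1 z.2))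
    (hFs : ∀ t ∈ Icc (0 : ℝ) 1, IsSeifertSurface (fun θ => F t (b θ)) (F t) b)
    (htr : ∀ t ∈ Ioc (0 : ℝ) 1, ∀ θ,
      0 < ε * (α (F t (b θ)) (velocity (fun θ' => F t (b θ')) θ) : ℝ)) {tb r sl : ℤ}
    (htb : IsThurstonBennequin α (fun θ => F 0 (b θ)) (F 0) b tb)
    (hr : IsRotationNumber α (fun θ => F 0 (b θ)) (F 0) b r)
    (hsl : IsSelfLinking α (fun θ => F 1 (b θ)) (F 1) b sl) : sl = tb - ε * r := by
  have hS0 := hFs 0 ⟨le_rfl, zero_le_one⟩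
  have hS1 := hFs 1 ⟨zero_le_one, le_rfl⟩
  have hb := hS0.isBoundaryCurve
  have hbc := hb.smooth.continuous
  have : T2Space S := T2Space.of_injective_continuous hS0.injective hS0.smooth.continuous
  obtain ⟨R, hR, hRp⟩ := hα.exists_pos_field
  obtain ⟨w, s, hw, hs, hwf, hsf, c, hcf, hpos, p, q, ρ, hpq, hwind⟩ := htb
  choose u hu hsu using hs
  have fw := isContField_of_contMDiff hwf.1
  have fs := isContField_of_contMDiff hsf.1
  have fc := isContField_of_contMDiff hcf.1
  have hsu' : ∀ θ, s θ = coordDeriv (𝓡∂ 2) 𝓘(ℝ, E3) (F 0) (b θ) (u θ) := hsu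
  rw [show s = fun θ => coordDeriv (𝓡∂ 2) 𝓘(ℝ, E3) (F 0) (b θ) (u θ) from funext hsu'] at fs
  -- `u` was chosen pointwise. Injectivity of the differential makes it unique, so it inherits the
  -- periodicity of `s`, and below also its continuity.
  have hup : Function.Periodic u 1 := fun θ => by
    refine hS0.immersion (b θ) ?_
    have h1 := hsf.2 θ
    rw [hsu, hsu, hb.periodic θ] at h1
    exact h1
  have hI : IsTransverseIsotopy α ε F b u := ⟨hF, hb, fun t ht => (hFs t ht).immersion, htr,
    isContSurfaceField_of_isContField hS0.smooth hbc hS0.immersion fs, hup, hu⟩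
  obtain ⟨X, Y, hX, hY, hXYp, p', q', hvel, hwind'⟩ := hr
  have hXY : IsContFrame α (F 0) X Y :=
    ⟨isContField_of_contMDiff hX, isContField_of_contMDiff hY, hXYp⟩
  have hd : ∀ x, det3 (X x) (Y x) (R (F 0 x)) ≠ 0 := fun x => ((hXYp x).2.2 _ (hRp _)).ne'
  set T : ℝ → E3 := velocity (fun θ' => F 0 (b θ')) with hT
  have c0 : Continuous fun θ : ℝ => ((0 : ℝ), θ) := by fun_prop
  have fT : IsContField (fun θ => F 0 (b θ)) T := (isContField_velocity hF hb.smooth).comp c0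
  have fX : IsContField (fun θ => F 0 (b θ)) (fun θ => X (b θ)) := hXY.left.comp hbc
  have fY : IsContField (fun θ => F 0 (b θ)) (fun θ => Y (b θ)) := hXY.right.comp hbc
  have fR : IsContField (fun θ => F 0 (b θ)) (fun θ => R (F 0 (b θ))) := hR.comp fX.1
  have perX : Function.Periodic (fun θ => X (b θ)) 1 := fun θ => by simp only [hb.periodic θ]
  have perY : Function.Periodic (fun θ => Y (b θ)) 1 := fun θ => by simp only [hb.periodic θ]
  have perR : Function.Periodic (fun θ => R (F 0 (b θ))) 1 := fun θ => by
    simp only [hb.periodic θ]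
  set y : ℝ → E3 := fun θ => frameCoord (X (b θ)) (Y (b θ)) (R (F 0 (b θ))) (w θ) with hy
  set x : ℝ → E3 := fun θ => frameCoord (X (b θ)) (Y (b θ)) (R (F 0 (b θ))) (T θ) with hx
  have yc : Continuous y := continuous_frameCoord hM fX fY fR fw fun θ => hd _
  have xc : Continuous x := continuous_frameCoord hM fX fY fR fT fun θ => hd _
  have yp : Function.Periodic y 1 := frameCoord_periodic perX perY perR hwf.2
  have xp : Function.Periodic x 1 :=
    frameCoord_periodic perX perY perR (velocity_comp_boundary_periodic hS0.smooth hb)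
  have y2 : ∀ θ, y θ 2 = 0 := fun θ => by
    have := (hXYp (b θ)).apply_eq (v := w θ) (hRp _)
    rw [(hw θ).1] at this
    exact (mul_eq_zero.1 this.symm).resolve_right (hRp _).ne'
  have hxpq : ∀ θ, x θ = !₂[p' θ, q' θ, 0] := fun θ => frameCoord_eq (hd _) (by
    rw [zero_smul, add_zero]; exact hvel θ)
  have hli : ∀ θ (k : ℝ), y θ + k • x θ ≠ 0 := fun θ k h0 => by
    have h1 := congrArg (frameMap (X (b θ)) (Y (b θ)) (R (F 0 (b θ)))) h0
    rw [map_add, map_smul, map_zero, frameMap_frameCoord (hd _), frameMap_frameCoord (hd _)] at h1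
    have h2 := LinearIndependent.pair_iff.1 (hw θ).2 k 1 (by rw [one_smul, add_comm]; exact h1)
    exact one_ne_zero h2.2
  have y0 : ∀ θ, y θ ≠ 0 := fun θ => by simpa using hli θ 0
  -- `w` and the velocity of `L` are independent vectors of `ξ`, so their coordinates in the frame
  -- are never antiparallel and wind equally often.
  have hw1 : HasWindingNumber (fun θ => ((y θ 0 : ℝ) : ℂ) + (y θ 1 : ℝ) * Complex.I) r := by
    have e : (fun θ => (p' θ : ℂ) + (q' θ : ℂ) * Complex.I)
        = fun θ => ((x θ 0 : ℝ) : ℂ) + (x θ 1 : ℝ) * Complex.I := by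
      funext θ; rw [hxpq]; rfl
    rw [e] at hwind'
    have := continuous_coord yc 0
    have := continuous_coord yc 1
    have := continuous_coord xc 0
    have := continuous_coord xc 1
    refine hwind'.of_forall_add_ne (by fun_prop) (by fun_prop) (fun θ => by simp only [xp θ])
      (fun θ => by simp only [yp θ]) fun θ k hk h0 => hli θ k ?_
    have hre := congrArg Complex.re h0
    have him := congrArg Complex.im h0
    simp at hre him
    refine E3.ext_coords ?_ ?_ ?_
    · simpa using hre
    · simpa using him
    · have : x θ 2 = 0 := by rw [hxpq]; rfl
      simp [y2, this]
  have hw0 := hasWindingNumber_boundaryTwist_of_twisting hM hI hR hRp hXY fw hwf.2 fc hcf.2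
    (fun θ => by rw [← hsu']; exact hpos θ) (fun θ => by rw [← hsu']; exact hpq θ) hwind
  obtain ⟨X', Y', hXY', hn⟩ := hI.exists_frame hM hα hR hRp yc yp y2 y0 hXY hw0
  obtain ⟨v, hv, hv0, H, hH, hHp, hH0, hHv, hlk⟩ := hsl
  have fv := isContField_of_contMDiff hv
  exact linkingNumber_eq_of_boundaryTwist hM hS hI hR hRp hXY' hS1.injective fv
    (hasWindingNumber_boundaryTwist_section hM hS hI hε hR hRp yc yp y2 hXY' hn hw1 fv hv0)
    hH hHp hH0 hHv hlk

/-- The self-linking number of a transverse push-off of a Legendrian knot. -/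
theorem IsCarriedSeifertSurface.selfLinking_eq (hM : IsOrientedAtlas 𝓘(ℝ, E3) M)
    (hα : IsContactForm α) (hS : IsOrientedAtlas (𝓡∂ 2) S) (hε : ε = 1 ∨ ε = -1) {L : ℝ → M}
    {f f' : S → M} (hf : IsSeifertSurface L f b) {A : ℝ → ℝ → M} {t₁ : ℝ}
    (htr : ∀ t ∈ Ioc (0 : ℝ) 1, ∀ θ,
      0 < ε * (α (A θ (t * t₁)) (velocity (fun θ' => A θ' (t * t₁)) θ) : ℝ))
    (h : IsCarriedSeifertSurface A t₁ f f' b) {tb r sl : ℤ} (htb : IsThurstonBennequin α L f b tb)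
    (hr : IsRotationNumber α L f b r) (hsl : IsSelfLinking α (fun θ => A θ t₁) f' b sl) :
    sl = tb - ε * r := by
  obtain ⟨F, hF, rfl, rfl, hFs⟩ := h
  -- The time is rescaled by `t₁`, of either sign, so that both push-offs become the end of an
  -- isotopy over `[0, 1]`.
  have hmem : ∀ t ∈ Icc (0 : ℝ) 1, t * t₁ ∈ uIcc 0 t₁ := fun t ht => by
    rcases le_total 0 t₁ with h1 | h1
    · rw [uIcc_of_le h1]
      exact ⟨mul_nonneg ht.1 h1, mul_le_of_le_one_left h1 ht.2⟩
    · rw [uIcc_of_ge h1]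
      exact ⟨by nlinarith [ht.1, ht.2], mul_nonpos_of_nonneg_of_nonpos ht.1 h1⟩
  have hK : ∀ t ∈ Icc (0 : ℝ) 1, (fun θ => A θ (t * t₁)) = fun θ => F (t * t₁) (b θ) :=
    fun t ht => funext fun θ => ((hFs _ (hmem t ht)).bdry_eq θ).symm
  have e0 : (0 : ℝ) * t₁ = 0 := zero_mul _
  have e1 : (1 : ℝ) * t₁ = t₁ := one_mul _
  have hL : L = fun θ => F (0 * t₁) (b θ) := by
    rw [e0]; exact funext fun θ => (hf.bdry_eq θ).symm
  have hT : (fun θ => A θ t₁) = fun θ => F (1 * t₁) (b θ) := by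
    rw [← hK 1 ⟨zero_le_one, le_rfl⟩, e1]
  have hsmooth : ContMDiff (𝓘(ℝ, ℝ).prod (𝓡∂ 2)) 𝓘(ℝ, E3) ∞
      (fun z : ℝ × S => F (z.1 * t₁) z.2) := by
    have h1 : ContMDiff 𝓘(ℝ, ℝ) 𝓘(ℝ, ℝ) ∞ fun t : ℝ => t * t₁ :=
      (contDiff_id.mul contDiff_const).contMDiff
    exact hF.comp ((h1.comp contMDiff_fst).prodMk contMDiff_snd)
  refine selfLinking_eq_of_isotopy (F := fun t => F (t * t₁)) hM hα hS hε hsmooth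
    (fun t ht => by rw [← hK t ht]; exact hFs _ (hmem t ht)) (fun t ht θ => ?_)
    (by rw [← hL, e0]; exact htb) (by rw [← hL, e0]; exact hr) (by rw [← hT, e1]; exact hsl)
  have h1 : ∀ K K' : ℝ → M, K = K' → 0 < ε * (α (K θ) (velocity K θ) : ℝ) →
      0 < ε * (α (K' θ) (velocity K' θ) : ℝ) := by
    rintro K _ rfl h; exact h
  exact h1 _ _ (hK t (Ioc_subset_Icc_self ht)) (htr t ht θ)

end SelfLinking
theorem mainTheorem4
    {M : Type*} [TopologicalSpace M] [T2Space M] [SecondCountableTopology M]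
    [ChartedSpace E3 M] [IsManifold 𝓘(ℝ, E3) ∞ M]
    (hM : IsOrientedAtlas 𝓘(ℝ, E3) M)
    (α : (p : M) → TangentSpace 𝓘(ℝ, E3) p →L[ℝ] ℝ) (hα : IsContactForm α)
    (L : ℝ → M) (hL : IsLegendrianKnot α L)
    {S : Type*} [TopologicalSpace S] [CompactSpace S] [ChartedSpace (EuclideanHalfSpace 2) S]
    [IsManifold (𝓡∂ 2) ∞ S] (hS : IsOrientedAtlas (𝓡∂ 2) S)
    (f : S → M) (b : ℝ → S) (hf : IsSeifertSurface L f b)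
    (tb r : ℤ) (htb : IsThurstonBennequin α L f b tb) (hr : IsRotationNumber α L f b r)
    (A : ℝ → ℝ → M) (hA : IsPushOffAnnulus α L A) :
    (∀ f' : S → M, IsCarriedSeifertSurface A (1 / 2) f f' b →
      ∀ sl : ℤ, IsSelfLinking α (fun θ => A θ (1 / 2)) f' b sl → sl = tb - r) ∧
    (∀ f' : S → M, IsCarriedSeifertSurface A (-(1 / 2)) f f' b →
      ∀ sl : ℤ, IsSelfLinking α (fun θ => A θ (-(1 / 2))) f' b sl → sl = tb + r) := by
  refine ⟨fun f' h sl hsl => ?_, fun f' h sl hsl => ?_⟩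
  · have h1 := h.selfLinking_eq hM hα hS (ε := 1) (Or.inl rfl) hf (fun t ht θ => by
      rw [Int.cast_one, one_mul]
      exact (hA.pos (t * (1 / 2)) ⟨by linarith [ht.1], by linarith [ht.2]⟩).2 θ) htb hr hsl
    rw [h1, one_mul]
  · have h1 := h.selfLinking_eq hM hα hS (ε := -1) (Or.inr rfl) hf (fun t ht θ => by
      rw [Int.cast_neg, Int.cast_one, neg_one_mul, neg_pos]
      exact (hA.neg (t * -(1 / 2)) ⟨by linarith [ht.2], by linarith [ht.1]⟩).2 θ) htb hr hsl
    rw [h1]; ring
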